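/- An instance of \textsc{Exact Subset Sum with Repetition} consists of pairwise distinct integers $a_1,\dots,a_n\ge 0$ and integers $S,k\ge 0$ with $k\le n$ such that every $r\in\mathbb{Z}_{\ge 0}^n$ with $\sum_{i=1}^n r_ia_i=S$ satisfies $\sum_{i=1}^n r_i=k$. The instance is feasible if some $r\in\mathbb{Z}_{\ge0}^n$ satisfies $\sum_{i=1}^n r_ia_i=S$. Let $P=\{\mathbf{x}\in\mathbb{R}^2: A\mathbf{x}\le\mathbf{b}\}$ be a polygon (bounded, with nonempty interior), given by a non-redundant system of inequalities. A circuit of $P$ is a vector $\mathbf{g}\ne\mathbf{0}$ with $A_i\mathbf{g}=0$ for some nonzero row $A_i$ of $A$ (equivalently, a nonzero vector parallel to an edge of $P$). A circuit move goes from $\mathbf{x}\in P$ to $\mathbf{x}+\alpha\mathbf{g}$, where $\mathbf{g}$ is a circuit and $\alpha>0$ is maximal with $\mathbf{x}+\alpha\mathbf{g}\in P$. For $\mathbf{c}\in\mathbb{R}^2$ and $\mathbf{s}\in P$, let $d^P_{\mathbf{c}}(\mathbf{s})$ be the smallest length $\ell$ of a sequence $\mathbf{x}_0=\mathbf{s},\mathbf{x}_1,\dots,\mathbf{x}_\ell$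 of points of $P$ such that each $\mathbf{x}_i$ arises from $\mathbf{x}_{i-1}$ by a circuit move, $\mathbf{c}^\top\mathbf{x}_0<\mathbf{c}^\top\mathbf{x}_1<\dots<\mathbf{c}^\top\mathbf{x}_\ell$, and $\mathbf{x}_\ell$ maximizes $\mathbf{c}^\top\mathbf{x}$ over $P$. \textbf{Theorem.} There is a single algorithm which, given any instance $(a_1,\dots,a_n,S,k)$ of \textsc{Exact Subset Sum with Repetition} and any integer $C\ge 0$, outputs rational data $(A,\mathbf{b},\mathbf{s},\mathbf{c})$ such that $A\mathbf{x}\le\mathbf{b}$ is a non-redundant description of a polygon $P$, $\mathbf{s}$ is a vertex of $P$, $\mathbf{c}$ is a cost vector, and the following hold: (i) if the instance is feasible, then $d^P_{\mathbf{c}}(\mathbf{s})\le 2k$; (ii) if the instance is infeasible, then $d^P_{\mathbf{c}}(\mathbf{s})>Ck$; (iii) the running time of the algorithm, in bit operations (logarithmic-cost random access machine), is bounded by a fixed polynomial in $n$, $\log M$, $k$ and $C$, where $M=\max\{S,a_1,\dots,a_n\}$; in particular, it is polynomial in $n$, $\log S$, $k$ and $C$ whenever all $a_i\le S$; (iv)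 the encoding length of $P$, $\mathbf{s}$ and $\mathbf{c}$ is bounded by a fixed polynomial in $n$, $\log S$, $k$ and $C$; (v) the number of edges of $P$ is at most $\max\{3,\,2Ck+2n\}$. -/

import Mathlib

open scoped Matrix

/-! ### Polyhedra, circuits and circuit walks -/

namespace CircuitWalks

/-- The polyhedron `{x ∈ ℝ^d | A x ≤ b}`. -/
def polyhedron {m d : ℕ} (A : Matrix (Fin m) (Fin d) ℝ) (b : Fin m → ℝ) : Set (Fin d → ℝ) :=
  {x | A *ᵥ x ≤ b}

/-- `g ≠ 0` is a circuit of `{x | A x ≤ b}` if there is a set `I` of `d - 1` row indices such that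
`A_I` has rank `d - 1` and `A_I g = 0`. -/
def IsCircuit {m d : ℕ} (A : Matrix (Fin m) (Fin d) ℝ) (g : Fin d → ℝ) : Prop :=
  g ≠ 0 ∧ ∃ I : Finset (Fin m), I.card + 1 = d ∧
    (A.submatrix (Subtype.val : {i // i ∈ I} → Fin m) id).rank + 1 = d ∧
    (A.submatrix (Subtype.val : {i // i ∈ I} → Fin m) id) *ᵥ g = 0

/-- `y` arises from `x` by a circuit move: `y = x + α g` for a circuit `g`, where `α > 0` is
the largest real number with `x + α g ∈ P`. -/
def IsCircuitMove {m d : ℕ} (A : Matrix (Fin m) (Fin d) ℝ) (b : Fin m → ℝ)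
    (x y : Fin d → ℝ) : Prop :=
  ∃ g : Fin d → ℝ, IsCircuit A g ∧ ∃ α : ℝ, 0 < α ∧
    IsGreatest {β : ℝ | x + β • g ∈ polyhedron A b} α ∧ y = x + α • g

/-- `(x_0, …, x_k)` is a circuit walk of length `k`. -/
def IsCircuitWalk {m d : ℕ} (A : Matrix (Fin m) (Fin d) ℝ) (b : Fin m → ℝ) (k : ℕ)
    (x : Fin (k + 1) → Fin d → ℝ) : Prop :=
  (∀ i, x i ∈ polyhedron A b) ∧ ∀ i : Fin k, IsCircuitMove A b (x i.castSucc) (x i.succ)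

/-- The sequence `(x_0, …, x_k)` is `c`-monotone: `cᵀx_0 < cᵀx_1 < ⋯ < cᵀx_k`. -/
def IsMonotone {d : ℕ} (c : Fin d → ℝ) (k : ℕ) (x : Fin (k + 1) → Fin d → ℝ) : Prop :=
  ∀ i : Fin k, c ⬝ᵥ x i.castSucc < c ⬝ᵥ x i.succ

/-- The `c`-monotone circuit distance from `s`: the least length of a `c`-monotone circuit walk
from `s` to a `c`-maximal point (`⊤` if there is no such walk). -/
noncomputable def monotoneCircuitDist {m d : ℕ} (A : Matrix (Fin m) (Fin d) ℝ) (b : Fin m → ℝ)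
    (c s : Fin d → ℝ) : ℕ∞ :=
  sInf {ℓ : ℕ∞ | ∃ k : ℕ, ℓ = (k : ℕ∞) ∧ ∃ x : Fin (k + 1) → Fin d → ℝ,
    IsCircuitWalk A b k x ∧ IsMonotone c k x ∧ x 0 = s ∧
      IsMaxOn (fun y => c ⬝ᵥ y) (polyhedron A b) (x (Fin.last k))}

/-- The description `A x ≤ b` is non-redundant: dropping any inequality enlarges the polyhedron. -/
def IsNonredundant {m d : ℕ} (A : Matrix (Fin m) (Fin d) ℝ) (b : Fin m → ℝ) : Prop :=
  ∀ i, ∃ x : Fin d → ℝ, (∀ j, j ≠ i → (A *ᵥ x) j ≤ b j) ∧ b i < (A *ᵥ x) i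

/-- The edges of a (filled convex) polygon in the plane: the sets of maximizers over `P` of a
nonzero linear functional that contain more than one point. -/
def polygonEdges (P : Set (Fin 2 → ℝ)) : Set (Set (Fin 2 → ℝ)) :=
  {F | F.Nontrivial ∧ ∃ h : Fin 2 → ℝ, h ≠ 0 ∧ F = {x ∈ P | ∀ y ∈ P, h ⬝ᵥ y ≤ h ⬝ᵥ x}}

/-- Rational data `(A, b, s, c)` in the plane with `m` inequalities. -/
structure PlanarData where
  m : ℕ
  A : Matrix (Fin m) (Fin 2) ℚ
  b : Fin m → ℚ
  s : Fin 2 → ℚ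
  c : Fin 2 → ℚ

namespace PlanarData

/-- The constraint matrix over `ℝ`. -/
def realA (D : PlanarData) : Matrix (Fin D.m) (Fin 2) ℝ := D.A.map (fun q : ℚ => (q : ℝ))

/-- The right-hand side over `ℝ`. -/
def realB (D : PlanarData) : Fin D.m → ℝ := fun i => (D.b i : ℝ)

/-- The point `s` in `ℝ²`. -/
def realS (D : PlanarData) : Fin 2 → ℝ := fun i => (D.s i : ℝ)

/-- The cost vector `c` in `ℝ²`. -/
def realC (D : PlanarData) : Fin 2 → ℝ := fun i => (D.c i : ℝ)

/-- The set `P = {x ∈ ℝ² | A x ≤ b}`. -/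
def P (D : PlanarData) : Set (Fin 2 → ℝ) := polyhedron D.realA D.realB

/-- `A x ≤ b` is a non-redundant description of a (filled, two-dimensional) convex polygon. -/
def DescribesPolygon (D : PlanarData) : Prop :=
  Bornology.IsBounded D.P ∧ (interior D.P).Nonempty ∧ IsNonredundant D.realA D.realB

/-- The monotone circuit distance `d^P_c(s)`. -/
noncomputable def dist (D : PlanarData) : ℕ∞ :=
  monotoneCircuitDist D.realA D.realB D.realC D.realS

/-- All rational numbers of the data: the rows `(A_{i0}, A_{i1}, b_i)`, then `s`, then `c`. -/
def entries (D : PlanarData) : List ℚ :=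
  (List.ofFn fun i : Fin D.m => [D.A i 0, D.A i 1, D.b i]).flatten ++
    [D.s 0, D.s 1, D.c 0, D.c 1]

end PlanarData

/-- The number of bits of an integer (with one bit for the sign). -/
def bitLength (z : ℤ) : ℕ := Nat.size z.natAbs + 1

/-- The encoding length of `P`, `s` and `c`: the total number of bits of the numerators and
denominators of all entries, plus the number of bits of `m`. -/
def PlanarData.encodingLength (D : PlanarData) : ℕ :=
  bitLength D.m + (D.entries.map fun q => bitLength q.num + bitLength q.den).sum

/-- A list of integers represents the data `(A, b, s, c)`: it consists of `m`, followed by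
each entry as numerator and positive denominator (the fractions need not be reduced). -/
def PlanarData.RepresentedBy (D : PlanarData) (l : List ℤ) : Prop :=
  ∃ f : List (ℤ × ℤ), (∀ x ∈ f, 0 < x.2) ∧ (f.map fun x => (x.1 : ℚ) / (x.2 : ℚ)) = D.entries ∧
    l = (D.m : ℤ) :: f.flatMap fun x => [x.1, x.2]

end CircuitWalks

/-! ### A random access machine with logarithmic cost -/

namespace LogCostRAM

/-- Arithmetic expressions; `get a e` is the cell with index `e` of the array number `a`. -/
inductive Expr where
  | lit (z : ℤ)
  | get (a : ℕ) (e : Expr)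
  | add (e f : Expr)
  | sub (e f : Expr)
  | mul (e f : Expr)

/-- Structured programs. `set a i e` stores the value of `e` in cell `i` of array `a`; `out e`
appends the value of `e` to the output; tests ask whether the value of an expression is positive. -/
inductive Program where
  | skip
  | set (a : ℕ) (i e : Expr)
  | out (e : Expr)
  | seq (p q : Program)
  | ite (e : Expr) (p q : Program)
  | while (e : Expr) (p : Program)

/-- A memory of integer arrays and the output written so far. -/
structure State where
  mem : ℕ → ℤ → ℤ
  output : List ℤ

/-- The initial state: the input is in the cells `0, 1, 2, …` of array `0`, all other cells
contain `0`, and the output is empty. -/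
def State.init (input : List ℤ) : State where
  mem := fun a i => if a = 0 ∧ 0 ≤ i then input.getD i.toNat 0 else 0
  output := []

/-- Storing the value `v` in cell `i` of array `a`. -/
def State.store (σ : State) (a : ℕ) (i v : ℤ) : State where
  mem := Function.update σ.mem a (Function.update (σ.mem a) i v)
  output := σ.output

/-- Appending the value `v` to the output. -/
def State.write (σ : State) (v : ℤ) : State where
  mem := σ.mem
  output := σ.output ++ [v]

/-- The value of an expression. -/
def Expr.val (σ : State) : Expr → ℤ
  | lit z => z
  | get a e => σ.mem a (e.val σ)
  | add e f => e.val σ + f.val σ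
  | sub e f => e.val σ - f.val σ
  | mul e f => e.val σ * f.val σ

open CircuitWalks (bitLength) in
/-- The bit cost of evaluating an expression: each operation is charged the bit lengths of its
operands (their product for a multiplication), a memory access the bit lengths of the index and
of the content of the cell. -/
def Expr.cost (σ : State) : Expr → ℕ
  | lit z => bitLength z
  | get a e => e.cost σ + bitLength (e.val σ) + bitLength (σ.mem a (e.val σ))
  | add e f => e.cost σ + f.cost σ + bitLength (e.val σ) + bitLength (f.val σ)
  | sub e f => e.cost σ + f.cost σ + bitLength (e.val σ) + bitLength (f.val σ)
  | mul e f => e.cost σ + f.cost σ + bitLength (e.val σ) * bitLength (f.val σ)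

open CircuitWalks (bitLength) in
/-- `Runs p σ t τ`: started in the state `σ`, the program `p` halts in the state `τ` after a
running time of exactly `t` (logarithmic cost, i.e. counted in bit operations). -/
inductive Runs : Program → State → ℕ → State → Prop where
  | skip (σ : State) : Runs .skip σ 1 σ
  | set (σ : State) (a : ℕ) (i e : Expr) :
      Runs (.set a i e) σ
        (1 + i.cost σ + e.cost σ + bitLength (i.val σ) + bitLength (e.val σ))
        (σ.store a (i.val σ) (e.val σ))
  | out (σ : State) (e : Expr) :
      Runs (.out e) σ (1 + e.cost σ + bitLength (e.val σ)) (σ.write (e.val σ))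
  | seq {p q : Program} {σ τ υ : State} {t u : ℕ} (hp : Runs p σ t τ) (hq : Runs q τ u υ) :
      Runs (.seq p q) σ (1 + t + u) υ
  | ite_pos {e : Expr} {p q : Program} {σ τ : State} {t : ℕ} (he : 0 < e.val σ)
      (hp : Runs p σ t τ) : Runs (.ite e p q) σ (1 + e.cost σ + bitLength (e.val σ) + t) τ
  | ite_neg {e : Expr} {p q : Program} {σ τ : State} {t : ℕ} (he : ¬ 0 < e.val σ)
      (hq : Runs q σ t τ) : Runs (.ite e p q) σ (1 + e.cost σ + bitLength (e.val σ) + t) τ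
  | while_pos {e : Expr} {p : Program} {σ τ υ : State} {t u : ℕ} (he : 0 < e.val σ)
      (hp : Runs p σ t τ) (hw : Runs (.while e p) τ u υ) :
      Runs (.while e p) σ (1 + e.cost σ + bitLength (e.val σ) + t + u) υ
  | while_neg {e : Expr} {p : Program} {σ : State} (he : ¬ 0 < e.val σ) :
      Runs (.while e p) σ (1 + e.cost σ + bitLength (e.val σ)) σ

end LogCostRAM

/-! ### Exact Subset Sum with Repetition -/

/-- An instance `(a_1, …, a_n, S, k)` of Exact Subset Sum with Repetition. -/
structure ExactSubsetSumInstance where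
  n : ℕ
  a : Fin n → ℕ
  S : ℕ
  k : ℕ
  distinct : Function.Injective a
  k_le : k ≤ n
  exact : ∀ r : Fin n → ℕ, ∑ i, r i * a i = S → ∑ i, r i = k

namespace ExactSubsetSumInstance

/-- The instance is feasible. -/
def Feasible (I : ExactSubsetSumInstance) : Prop :=
  ∃ r : Fin I.n → ℕ, ∑ i, r i * I.a i = I.S

/-- The largest of the numbers `S, a_1, …, a_n`. -/
def maxNumber (I : ExactSubsetSumInstance) : ℕ := max I.S (Finset.univ.sup I.a)

/-- The input `(n, S, k, C, a_1, …, a_n)` as a list of integers. -/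
def input (I : ExactSubsetSumInstance) (C : ℕ) : List ℤ :=
  [(I.n : ℤ), (I.S : ℤ), (I.k : ℤ), (C : ℤ)] ++ List.ofFn fun i => (I.a i : ℤ)

end ExactSubsetSumInstance

/-!
The polygon lies in a vertical strip whose left side is on the line `x = 0`, the walk starts at the
origin, and the cost of a point is its height. Below, the strip is bounded by one edge of slope
`M a` for every number `a` that is positive and at most `S`, and by one edge of slope `-N`, where `N`
is much smaller than `M`. Above, two chains of `m = C k` edges each meet in the optimum. The
parameters are chosen such that the moves of interest cross the strip from side to side: to the
right along an edge of slope `M a`, back to the left along the edge of slope `-N`. After some of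
these moves the height is the width of the strip times `M A + e`, where `A` is a sum of the chosen
numbers and `e` counts the moves back, in multiples of `N`.

The optimum lies on the line of slope `-N` that leaves the right side at the height given by
`A = S` and `e = N (k - 1)`. From a solution one gets a walk that climbs to this height and follows
this line to the optimum, with `2 k` moves in total, because all solutions have exactly `k` summands
(`dist_strip_le`). If there is no solution, this line is out of reach: `M` exceeds the total error
that `m` moves can accumulate, so a height `M A + e` on the line forces `A = S` (`eq_of_digits`,
`strip_step`, `strip_line`).

Any other walk has to climb the chains, and gains at most one level per move (`Inv.step`,
`Chain.lt_dist`). The sizes `eps j` of the edges on level `j` shrink by the huge factor `β` from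
level to level, and the edge lines of one level meet in an apex. All apexes lie on one line, the one
of slope `-N` through the optimum. A move goes along a row of the system and ends on another row, so
it multiplies the denominators of the coordinates by a determinant of size at most `2 K ^ 2`. Hence
the `i`-th point of the walk, multiplied by a small integer, lies in the lattice of multiples of
`eps i` (`Lattice.step`). A point more than one level further up is so close to the apex of level
`i`, in comparison with `eps i`, that a move from the `i`-th point to it would have to follow a line
exactly through this apex (`Deep.abs_le`, `Lattice.eq_zero`). If the `i`-th point is on an edge of
level `i`, that line is an edge line and leaves the polygon too early (`Deep.not_on_left`,
`Deep.not_on_right`). Otherwise the point belongs to the coarser lattice of level `i - 1`, to which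
the apex of level `i` can be joined in direction `(1, -N)` only (`Lattice.direction`), that is,
along the line through all the apexes.

Non-redundancy of the system follows from a point for every row that violates this row only; the
edges of the numbers are tangents of a parabola. The strip has `2 C k + n + 3` edges at most, which
suffices for `n ≥ 3`. For `n ≤ 2` feasibility is a polynomial condition, and the answer is a
triangle or a wedge, two chains above a base without numbers. The triangle also serves for `C k = 0`.

The rows are computed by a program with a few loops over the levels and the numbers. A program
without loops costs a number of bit operations that is quadratic in the bit length of the memory
(`Program.runs_exec`), and a loop is followed through an explicit sequence of states whose entries
are bounded (`takes_while`). The largest numbers are of the order of `β ^ m`, with about `m ^ 2`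
times `log S` bits, so time and encoding length are polynomial (`takes_program`,
`encodingLength_polygon_le`). Numbers larger than `S` do not enter the polygon, which therefore has
an encoding length that depends on `log S` only.
-/

namespace CircuitWalks

/-! ### Planar systems of integral inequalities -/

/-- The closed half-plane `a x + b y ≤ c` with integral coefficients. -/
structure HalfPlane where
  a : ℤ
  b : ℤ
  c : ℤ

namespace HalfPlane

/-- The value of the linear form of a half-plane at a point. -/
def form (R : HalfPlane) (x : Fin 2 → ℝ) : ℝ := R.a * x 0 + R.b * x 1

/-- The half-plane contains the point. -/
def Holds (R : HalfPlane) (x : Fin 2 → ℝ) : Prop := R.form x ≤ R.c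

end HalfPlane

/-- The planar data whose inequalities are the listed half-planes. -/
abbrev PlanarData.ofRows (rows : List HalfPlane) (s c : Fin 2 → ℚ) : PlanarData where
  m := rows.length
  A := fun i => ![((rows.get i).a : ℚ), ((rows.get i).b : ℚ)]
  b := fun i => ((rows.get i).c : ℚ)
  s := s
  c := c

theorem isCircuit_two_iff {m : ℕ} {A : Matrix (Fin m) (Fin 2) ℝ} {g : Fin 2 → ℝ} :
    IsCircuit A g ↔ g ≠ 0 ∧ ∃ i, (A i 0 ≠ 0 ∨ A i 1 ≠ 0) ∧ (A *ᵥ g) i = 0 := by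
  unfold IsCircuit
  refine and_congr_right fun hg => ?_
  constructor
  · rintro ⟨I, hI, hr, h0⟩
    obtain ⟨i, rfl⟩ := Finset.card_eq_one.1 (by omega : I.card = 1)
    refine ⟨i, ?_, congrFun h0 ⟨i, Finset.mem_singleton_self i⟩⟩
    by_contra hz
    push Not at hz
    have : (A.submatrix (Subtype.val : {j // j ∈ ({i} : Finset (Fin m))} → Fin m) id) = 0 := by
      ext ⟨j, hj⟩ k
      obtain rfl := Finset.mem_singleton.1 hj
      fin_cases k
      · exact hz.1
      · exact hz.2
    rw [this, Matrix.rank_zero] at hr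
    omega
  · rintro ⟨i, hne, h0⟩
    refine ⟨{i}, by rw [Finset.card_singleton], ?_, ?_⟩
    · have hle : (A.submatrix (Subtype.val : {j // j ∈ ({i} : Finset (Fin m))} → Fin m) id).rank
          ≤ 1 := by
        refine (Matrix.rank_le_card_height _).trans ?_
        simp
      have hne0 : (A.submatrix (Subtype.val : {j // j ∈ ({i} : Finset (Fin m))} → Fin m)
          id).rank ≠ 0 := by
        intro hz
        have hz' : (A.submatrix (Subtype.val : {j // j ∈ ({i} : Finset (Fin m))} → Fin m) id)
            = 0 := by
          rw [Matrix.rank, Submodule.finrank_eq_zero, LinearMap.range_eq_bot] at hz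
          refine Matrix.toLin'.injective ?_
          rw [map_zero, ← hz]
          rfl
        have h1 := congrFun (congrFun hz' ⟨i, Finset.mem_singleton_self i⟩) 0
        have h2 := congrFun (congrFun hz' ⟨i, Finset.mem_singleton_self i⟩) 1
        exact hne.elim (fun h => h h1) fun h => h h2
      omega
    · ext ⟨j, hj⟩
      obtain rfl := Finset.mem_singleton.1 hj
      exact h0

section OfRows

variable {rows : List HalfPlane} {s c : Fin 2 → ℚ}

theorem realA_zero (i : Fin rows.length) :
    (PlanarData.ofRows rows s c).realA i 0 = (rows.get i).a :=
  Rat.cast_intCast _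

theorem realA_one (i : Fin rows.length) :
    (PlanarData.ofRows rows s c).realA i 1 = (rows.get i).b :=
  Rat.cast_intCast _

theorem realA_mulVec (x : Fin 2 → ℝ) (i : Fin rows.length) :
    ((PlanarData.ofRows rows s c).realA *ᵥ x) i = (rows.get i).form x := by
  rw [Matrix.mulVec, dotProduct, Fin.sum_univ_two, realA_zero, realA_one, HalfPlane.form]

theorem realB_apply (i : Fin rows.length) :
    (PlanarData.ofRows rows s c).realB i = (rows.get i).c := by
  simp [PlanarData.realB]

theorem mem_P_iff {x : Fin 2 → ℝ} :
    x ∈ (PlanarData.ofRows rows s c).P ↔ ∀ R ∈ rows, R.Holds x := by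
  have h : x ∈ (PlanarData.ofRows rows s c).P ↔
      ∀ i : Fin rows.length, (rows.get i).form x ≤ (rows.get i).c := by
    refine forall_congr' fun i => ?_
    rw [realA_mulVec, realB_apply]
  rw [h]
  constructor
  · intro hx R hR
    obtain ⟨i, rfl⟩ := List.get_of_mem hR
    exact hx i
  · intro hx i
    exact hx _ (List.get_mem _ _)

/-- In the plane, a circuit is a nonzero vector in the kernel of a nonzero row. -/
theorem isCircuit_iff {g : Fin 2 → ℝ} :
    IsCircuit (PlanarData.ofRows rows s c).realA g ↔
      g ≠ 0 ∧ ∃ l ∈ rows, (l.a ≠ 0 ∨ l.b ≠ 0) ∧ l.form g = 0 := by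
  rw [isCircuit_two_iff]
  refine and_congr_right fun _ => ?_
  constructor
  · rintro ⟨i, hne, h0⟩
    refine ⟨rows.get i, List.get_mem _ _, ?_, (realA_mulVec g i).symm.trans h0⟩
    rw [realA_zero, realA_one] at hne
    exact_mod_cast hne
  · rintro ⟨l, hl, hne, h0⟩
    obtain ⟨i, rfl⟩ := List.get_of_mem hl
    refine ⟨i, ?_, (realA_mulVec g i).trans h0⟩
    rw [realA_zero, realA_one]
    exact_mod_cast hne

theorem HalfPlane.form_add_smul (R : HalfPlane) (x g : Fin 2 → ℝ) (α : ℝ) :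
    R.form (x + α • g) = R.form x + α * R.form g := by
  simp [HalfPlane.form]; ring

theorem HalfPlane.form_sub (R : HalfPlane) (x y : Fin 2 → ℝ) :
    R.form (x - y) = R.form x - R.form y := by
  simp [HalfPlane.form]; ring

/-- A circuit move keeps the value of some row and makes some other row tight. -/
theorem exists_rows_of_isCircuitMove {x y : Fin 2 → ℝ}
    (h : IsCircuitMove (PlanarData.ofRows rows s c).realA (PlanarData.ofRows rows s c).realB x y) :
    x ≠ y ∧ (∃ l ∈ rows, (l.a ≠ 0 ∨ l.b ≠ 0) ∧ l.form y = l.form x) ∧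
      ∃ R ∈ rows, R.form x < R.form y ∧ R.form y = R.c := by
  obtain ⟨g, hg, α, hα, hmax, rfl⟩ := h
  obtain ⟨hg0, l, hl, hne, hlg⟩ := isCircuit_iff.1 hg
  refine ⟨?_, ⟨l, hl, hne, by rw [HalfPlane.form_add_smul, hlg]; ring⟩, ?_⟩
  · intro h
    have : α • g = 0 := by simpa using h.symm
    rcases smul_eq_zero.1 this with h | h
    · exact hα.ne' h
    · exact hg0 h
  · by_contra hcon
    push Not at hcon
    have hin : ∀ R ∈ rows, R.Holds (x + α • g) := mem_P_iff.1 hmax.1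
    -- If no row blocks, a slightly longer step stays feasible.
    have key : ∀ R ∈ rows, ∀ᶠ t in nhdsWithin α (Set.Ioi α), R.form (x + t • g) ≤ R.c := by
      intro R hR
      by_cases hpos : 0 < R.form g
      · have h1 := hcon R hR (by rw [HalfPlane.form_add_smul]; nlinarith)
        have h2 : R.form (x + α • g) < R.c := lt_of_le_of_ne (hin R hR) h1
        have hc : Continuous fun t : ℝ => R.form (x + t • g) := by
          simp only [HalfPlane.form_add_smul]; fun_prop
        exact nhdsWithin_le_nhds ((hc.continuousAt.eventually_lt continuousAt_const h2).mono
          fun t ht => ht.le)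
      · filter_upwards [self_mem_nhdsWithin] with t ht
        have h1 := hin R hR
        unfold HalfPlane.Holds at h1
        rw [HalfPlane.form_add_smul] at h1 ⊢
        have : α < t := ht
        nlinarith
    have hall : ∀ᶠ t in nhdsWithin α (Set.Ioi α), ∀ R ∈ rows, R.form (x + t • g) ≤ R.c := by
      have := (Filter.eventually_all_finite (l := nhdsWithin α (Set.Ioi α))
        (List.finite_toSet rows)).2 key
      exact this
    obtain ⟨t, ht, hαt⟩ := (hall.and self_mem_nhdsWithin).exists
    have : t ≤ α := hmax.2 (mem_P_iff.2 ht)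
    exact absurd hαt (not_lt.2 this)

theorem isCircuitMove_of_rows {x y : Fin 2 → ℝ}
    (hy : y ∈ (PlanarData.ofRows rows s c).P) {l R : HalfPlane}
    (hl : l ∈ rows) (hne : l.a ≠ 0 ∨ l.b ≠ 0) (hlxy : l.form y = l.form x)
    (hR : R ∈ rows) (hlt : R.form x < R.form y) (htight : R.form y = R.c) :
    IsCircuitMove (PlanarData.ofRows rows s c).realA (PlanarData.ofRows rows s c).realB x y := by
  refine ⟨y - x, isCircuit_iff.2 ⟨?_, l, hl, hne, ?_⟩, 1, one_pos, ⟨?_, ?_⟩, by simp⟩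
  · intro h
    rw [sub_eq_zero] at h
    rw [h] at hlt
    exact lt_irrefl _ hlt
  · rw [HalfPlane.form_sub, hlxy, sub_self]
  · have : x + (1 : ℝ) • (y - x) = y := by simp
    change x + (1 : ℝ) • (y - x) ∈ (PlanarData.ofRows rows s c).P
    rwa [this]
  · intro t ht
    have h1 : R.form (x + t • (y - x)) ≤ R.c := mem_P_iff.1 ht R hR
    rw [HalfPlane.form_add_smul, HalfPlane.form_sub, ← htight] at h1
    by_contra hcon
    push Not at hcon
    nlinarith

/-- A list of half-planes describes a polygon if its intersection is bounded and contains a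
strictly feasible point, and every half-plane can be violated alone. -/
theorem describesPolygon_of (hnd : rows.Nodup)
    (hb : ∃ r : ℝ, ∀ x : Fin 2 → ℝ, (∀ R ∈ rows, R.Holds x) → |x 0| ≤ r ∧ |x 1| ≤ r)
    (hi : ∃ x : Fin 2 → ℝ, ∀ R ∈ rows, R.form x < R.c)
    (hn : ∀ R ∈ rows, ∃ x : Fin 2 → ℝ, (∀ R' ∈ rows, R' ≠ R → R'.Holds x) ∧ ¬ R.Holds x) :
    (PlanarData.ofRows rows s c).DescribesPolygon := by
  refine ⟨?_, ?_, ?_⟩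
  · obtain ⟨r, hr⟩ := hb
    refine (Metric.isBounded_closedBall (x := (0 : Fin 2 → ℝ)) (r := max r 0)).subset ?_
    intro x hx
    obtain ⟨h0, h1⟩ := hr x (mem_P_iff.1 hx)
    rw [mem_closedBall_zero_iff, pi_norm_le_iff_of_nonneg (le_max_right _ _)]
    intro i
    fin_cases i
    · exact h0.trans (le_max_left _ _)
    · exact h1.trans (le_max_left _ _)
  · obtain ⟨x, hx⟩ := hi
    refine ⟨x, mem_interior_iff_mem_nhds.2 ?_⟩
    have key : ∀ R ∈ rows, ∀ᶠ y in nhds x, R.form y ≤ R.c := by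
      intro R hR
      have hc : Continuous fun y : Fin 2 → ℝ => R.form y := by
        unfold HalfPlane.form; fun_prop
      exact (hc.continuousAt.eventually_lt continuousAt_const (hx R hR)).mono fun t ht => ht.le
    have := (Filter.eventually_all_finite (l := nhds x) (List.finite_toSet rows)).2 key
    filter_upwards [this] with y hy using mem_P_iff.2 hy
  · intro i
    obtain ⟨x, hx, hv⟩ := hn (rows.get i) (List.get_mem _ _)
    refine ⟨x, fun j hj => ?_, ?_⟩
    · rw [realA_mulVec, realB_apply]
      refine hx _ (List.get_mem _ _) fun h => hj ?_
      exact (List.nodup_iff_injective_get.1 hnd) h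
    · rw [realA_mulVec, realB_apply]
      exact not_le.1 hv

/-- Every edge of a polygon is cut out by one of the inequalities. -/
theorem encard_polygonEdges_le (hz : ∀ R ∈ rows, R.a ≠ 0 ∨ R.b ≠ 0) :
    (polygonEdges (PlanarData.ofRows rows s c).P).encard ≤ rows.length := by
  have hsub : polygonEdges (PlanarData.ofRows rows s c).P ⊆
      Set.range fun i : Fin rows.length =>
        {x ∈ (PlanarData.ofRows rows s c).P | (rows.get i).form x = (rows.get i).c} := by
    rintro F ⟨⟨p, hp, q, hq, hpq⟩, h, hh, rfl⟩
    -- The midpoint of two points of the edge lies on the line of some inequality.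
    set r : Fin 2 → ℝ := p + (1 / 2 : ℝ) • (q - p) with hr
    have hform : ∀ R : HalfPlane, R.form r = (R.form p + R.form q) / 2 := by
      intro R
      rw [hr, HalfPlane.form_add_smul, HalfPlane.form_sub]; ring
    have hpP := mem_P_iff.1 hp.1
    have hqP := mem_P_iff.1 hq.1
    have hpqv : h ⬝ᵥ p = h ⬝ᵥ q := le_antisymm (hq.2 p hp.1) (hp.2 q hq.1)
    have htight : ∃ R ∈ rows, R.form r = R.c := by
      by_contra hcon
      push Not at hcon
      have key : ∀ R ∈ rows, ∀ᶠ t in nhdsWithin (0 : ℝ) (Set.Ioi 0),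
          R.form (r + t • h) ≤ R.c := by
        intro R hR
        have h2 : R.form (r + (0 : ℝ) • h) < R.c := by
          rw [zero_smul, add_zero]
          refine lt_of_le_of_ne ?_ (hcon R hR)
          have := hpP R hR
          have := hqP R hR
          unfold HalfPlane.Holds at *
          rw [hform]; linarith
        have hc : Continuous fun t : ℝ => R.form (r + t • h) := by
          simp only [HalfPlane.form_add_smul]; fun_prop
        exact nhdsWithin_le_nhds ((hc.continuousAt.eventually_lt continuousAt_const h2).mono
          fun t ht => ht.le)
      have hall := (Filter.eventually_all_finite (l := nhdsWithin (0 : ℝ) (Set.Ioi 0))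
        (List.finite_toSet rows)).2 key
      obtain ⟨t, ht, h0t⟩ := (hall.and self_mem_nhdsWithin).exists
      have h1 := hp.2 _ (mem_P_iff.2 ht)
      have h2 : 0 < h ⬝ᵥ h := lt_of_le_of_ne (dotProduct_self_star_nonneg (v := h)) fun h0 =>
        hh (dotProduct_self_eq_zero.1 h0.symm)
      have h0t' : 0 < t := h0t
      rw [hr, dotProduct_add, dotProduct_add, dotProduct_smul, dotProduct_smul, dotProduct_sub,
        ← hpqv, sub_self, smul_zero, add_zero, smul_eq_mul] at h1
      nlinarith [mul_pos h0t' h2]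
    obtain ⟨R, hR, hRr⟩ := htight
    obtain ⟨i, rfl⟩ := List.get_of_mem hR
    refine ⟨i, ?_⟩
    set R := rows.get i
    have hp1 : R.form p = R.c := by
      have h1 := hpP R hR
      have h2 := hqP R hR
      unfold HalfPlane.Holds at *
      rw [hform] at hRr; linarith
    have hq1 : R.form q = R.c := by
      rw [hform, hp1] at hRr; linarith
    -- Both functionals are constant on `p`, `q`, so they are proportional.
    have hprop : ∀ x : Fin 2 → ℝ, R.form x = R.c ↔ h ⬝ᵥ x = h ⬝ᵥ p := by
      intro x
      have hd : p 0 ≠ q 0 ∨ p 1 ≠ q 1 := by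
        by_contra hcon
        push Not at hcon
        exact hpq (funext fun j => by fin_cases j <;> simp [hcon.1, hcon.2])
      have hh' : h 0 ≠ 0 ∨ h 1 ≠ 0 := by
        by_contra hcon
        push Not at hcon
        exact hh (funext fun j => by fin_cases j <;> simp [hcon.1, hcon.2])
      have hR0 : (R.a : ℝ) ≠ 0 ∨ (R.b : ℝ) ≠ 0 := by exact_mod_cast hz R hR
      simp only [HalfPlane.form] at hp1 hq1 ⊢
      simp only [dotProduct, Fin.sum_univ_two] at hpqv ⊢
      have e1 : (R.a : ℝ) * (p 0 - q 0) + R.b * (p 1 - q 1) = 0 := by linarith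
      have e2 : h 0 * (p 0 - q 0) + h 1 * (p 1 - q 1) = 0 := by linarith
      have e3 : (R.a : ℝ) * h 1 = R.b * h 0 := by
        rcases hd with hd | hd
        · have : (p 0 - q 0) * (R.a * h 1 - R.b * h 0) = 0 := by linear_combination h 1 * e1 - R.b * e2
          rcases mul_eq_zero.1 this with h' | h'
          · exact absurd (sub_eq_zero.1 h') hd
          · linarith
        · have : (p 1 - q 1) * (R.a * h 1 - R.b * h 0) = 0 := by linear_combination R.a * e2 - h 0 * e1
          rcases mul_eq_zero.1 this with h' | h'
          · exact absurd (sub_eq_zero.1 h') hd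
          · linarith
      have solve : ∀ {u v u' v' : ℝ}, (u ≠ 0 ∨ v ≠ 0) → u * v' = v * u' →
          u * (x 0 - p 0) + v * (x 1 - p 1) = 0 → u' * (x 0 - p 0) + v' * (x 1 - p 1) = 0 := by
        intro u v u' v' huv hc h0
        rcases huv with h' | h'
        · refine (mul_eq_zero.1 (?_ : u * _ = 0)).resolve_left h'
          linear_combination u' * h0 + (x 1 - p 1) * hc
        · refine (mul_eq_zero.1 (?_ : v * _ = 0)).resolve_left h'
          linear_combination v' * h0 - (x 0 - p 0) * hc
      constructor
      · intro h0
        have := solve hR0 e3 (by linarith)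
        linarith
      · intro h0
        have := solve hh' (show h 0 * (R.b : ℝ) = h 1 * R.a by linarith) (by linarith)
        linarith
    ext x
    simp only [Set.mem_ofPred_eq]
    refine and_congr_right fun hx => ?_
    rw [hprop]
    exact ⟨fun h0 y hy => h0 ▸ hp.2 y hy, fun h0 => le_antisymm (hp.2 x hx) (h0 p hp.1)⟩
  refine (Set.encard_le_encard hsub).trans ?_
  rw [← Set.image_univ]
  refine Set.encard_image_le _ _ |>.trans ?_
  simp [Set.encard_univ]

/-- The origin is a vertex as soon as two inequalities confine the polygon to a pointed cone
at it. -/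
theorem zero_mem_extremePoints (h0 : ∀ R ∈ rows, 0 ≤ R.c) {N : ℝ}
    (hcone : ∀ x : Fin 2 → ℝ, (∀ R ∈ rows, R.Holds x) → 0 ≤ x 0 ∧ 0 ≤ N * x 0 + x 1) :
    (PlanarData.ofRows rows 0 c).realS ∈ Set.extremePoints ℝ (PlanarData.ofRows rows 0 c).P := by
  have hs : (PlanarData.ofRows rows 0 c).realS = 0 := by
    ext i; simp [PlanarData.realS]
  rw [hs, mem_extremePoints]
  refine ⟨mem_P_iff.2 fun R hR => ?_, fun p hp q hq hpq => ?_⟩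
  · simpa [HalfPlane.Holds, HalfPlane.form] using h0 R hR
  · obtain ⟨u, v, hu, hv, huv, h⟩ := hpq
    obtain ⟨p0, p1⟩ := hcone p (mem_P_iff.1 hp)
    obtain ⟨q0, q1⟩ := hcone q (mem_P_iff.1 hq)
    have e0 : u * p 0 + v * q 0 = 0 := by simpa using congrFun h 0
    have e1 : u * p 1 + v * q 1 = 0 := by simpa using congrFun h 1
    have a1 := mul_nonneg hu.le p0
    have a2 := mul_nonneg hv.le q0
    have b1 := mul_nonneg hu.le p1
    have b2 := mul_nonneg hv.le q1
    have e2 : u * (N * p 0 + p 1) + v * (N * q 0 + q 1) = 0 := by linear_combination N * e0 + e1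
    have hp0 : p 0 = 0 := (mul_eq_zero.1 (by linarith : u * p 0 = 0)).resolve_left hu.ne'
    have hq0 : q 0 = 0 := (mul_eq_zero.1 (by linarith : v * q 0 = 0)).resolve_left hv.ne'
    have hp1 := (mul_eq_zero.1 (by linarith : u * (N * p 0 + p 1) = 0)).resolve_left hu.ne'
    have hq1 := (mul_eq_zero.1 (by linarith : v * (N * q 0 + q 1) = 0)).resolve_left hv.ne'
    rw [hp0] at hp1
    rw [hq0] at hq1
    constructor <;> ext i <;> fin_cases i <;> simp <;> linarith

/-- An invariant of monotone circuit walks that is incompatible with optimality bounds the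
monotone circuit distance from below. -/
theorem lt_dist_of_invariant {m : ℕ} (Inv : ℕ → (Fin 2 → ℝ) → Prop)
    (h0 : Inv 0 (PlanarData.ofRows rows s c).realS)
    (hstep : ∀ i < m, ∀ p ∈ (PlanarData.ofRows rows s c).P,
      ∀ r ∈ (PlanarData.ofRows rows s c).P, Inv i p →
      IsCircuitMove (PlanarData.ofRows rows s c).realA (PlanarData.ofRows rows s c).realB p r →
      (PlanarData.ofRows rows s c).realC ⬝ᵥ p < (PlanarData.ofRows rows s c).realC ⬝ᵥ r →
      Inv (i + 1) r)
    (hopt : ∀ i ≤ m, ∀ p, Inv i p → ¬ IsMaxOn (fun y => (PlanarData.ofRows rows s c).realC ⬝ᵥ y)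
      (PlanarData.ofRows rows s c).P p) :
    (m : ℕ∞) < (PlanarData.ofRows rows s c).dist := by
  have h1 : ((m + 1 : ℕ) : ℕ∞) ≤ (PlanarData.ofRows rows s c).dist := by
    refine le_sInf ?_
    rintro ℓ ⟨k, rfl, x, hwalk, hmono, hx0, hmax⟩
    by_contra hcon
    have hk : k ≤ m := by
      have : ¬ (m + 1 ≤ k) := fun h => hcon (by exact_mod_cast h)
      omega
    have hinv : ∀ i (hi : i < k + 1), Inv i (x ⟨i, hi⟩) := by
      intro i
      induction i with
      | zero => intro hi; exact hx0 ▸ h0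
      | succ i ih =>
        intro hi
        exact hstep i (by omega) _ (hwalk.1 ⟨i, by omega⟩) _ (hwalk.1 _) (ih (by omega))
          (hwalk.2 ⟨i, by omega⟩) (hmono ⟨i, by omega⟩)
    exact hopt k hk _ (hinv k (by omega)) hmax
  refine lt_of_lt_of_le ?_ h1
  exact_mod_cast Nat.lt_succ_self m

end OfRows

end CircuitWalks

namespace CircuitWalks

/-! ### The two chains of edges below the optimum -/

/-- The parameters of a pair of chains of `m` edges each that meet in the optimum; `β` is the
ratio between the sizes of consecutive edges. -/
structure Chain where
  m : ℕ
  N : ℤ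
  K : ℤ
  h : ℤ
  β : ℤ
  one_le_m : 1 ≤ m
  le_N : 4 * (m : ℤ) + 4 ≤ N
  le_K : 4 * (m : ℤ) * N ≤ K
  β_eq : β = (2 * K ^ 2) ^ (m + 4)

namespace Chain

variable (c : Chain)

/-- The size of the edges on level `j`. -/
def eps (j : ℕ) : ℤ := c.β ^ (c.m - j)

/-- The first coordinate of the apex of level `j`. -/
def del (j : ℕ) : ℤ := ∑ i ∈ Finset.range j, c.eps (i + 1)

/-- The unit of length. -/
def U : ℤ := c.β ^ c.m

/-- The negated slope of the right edge on level `j`. -/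
def rho (j : ℕ) : ℤ := c.m + 1 - j

/-- The left edge on level `j`, of slope `K / j`. For `j = 0` this is the side `0 ≤ x`. -/
def left (j : ℕ) : HalfPlane := ⟨-c.K, j, j * (c.h * c.U) - (c.K + j * c.N) * c.del j⟩

/-- The right edge on level `j`, of slope `-rho j`. -/
def right (j : ℕ) : HalfPlane := ⟨c.rho j, 1, c.h * c.U - (c.N - c.rho j) * c.del j⟩

/-- The apex of level `j`, where the left and the right edge line of this level meet. All apexes
lie on the line `N x + y = h U`; the apex of level `m` is the optimum. -/
def apex (j : ℕ) : Fin 2 → ℝ := ![(c.del j : ℝ), ((c.h * c.U - c.N * c.del j : ℤ) : ℝ)]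

/-- All edges of the two chains, from the top to the bottom. -/
def rows : List HalfPlane := (List.range c.m).flatMap fun t => [c.left (c.m - t), c.right (c.m - t)]

theorem mem_rows {R : HalfPlane} :
    R ∈ c.rows ↔ ∃ j, 1 ≤ j ∧ j ≤ c.m ∧ (R = c.left j ∨ R = c.right j) := by
  simp only [rows, List.mem_flatMap, List.mem_range, List.mem_cons, List.not_mem_nil, or_false]
  constructor
  · rintro ⟨t, ht, h⟩
    exact ⟨c.m - t, by omega, by omega, h⟩
  · rintro ⟨j, h1, hj, h⟩
    exact ⟨c.m - j, by omega, by rwa [Nat.sub_sub_self hj]⟩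

variable {c}

theorem eight_le_N : 8 ≤ c.N := by have := c.le_N; have := c.one_le_m; omega

theorem mN_le_K {j : ℕ} (hj : j ≤ c.m) : 4 * ((j : ℤ) * c.N) ≤ c.K := by
  have h1 := c.le_K
  have h2 : (j : ℤ) ≤ c.m := by exact_mod_cast hj
  have h3 := c.eight_le_N
  nlinarith

theorem four_N_le_K : 4 * c.N ≤ c.K := by
  have := c.mN_le_K c.one_le_m
  push_cast at this
  linarith

theorem K_pos : 0 < c.K := by have := c.four_N_le_K; have := c.eight_le_N; linarith

theorem m_le_K : 32 * (c.m : ℤ) ≤ c.K := by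
  have h1 := c.le_K
  have h2 := c.eight_le_N
  nlinarith [Int.natCast_nonneg c.m]

theorem β_large : (2 * c.K ^ 2) ^ 5 ≤ c.β := by
  rw [c.β_eq]
  have := c.K_pos
  exact pow_le_pow_right₀ (by nlinarith) (by have := c.one_le_m; omega)

theorem K_sq_le_β : 64 * c.K ^ 2 ≤ c.β := by
  refine le_trans ?_ c.β_large
  have h1 : 32 ≤ c.K := by have := c.four_N_le_K; have := c.eight_le_N; linarith
  have h2 : 1 ≤ c.K ^ 8 := one_le_pow₀ (by linarith)
  have h3 : 1024 ≤ c.K ^ 2 := by nlinarith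
  have h4 : (2 * c.K ^ 2) ^ 5 = 32 * c.K ^ 2 * c.K ^ 8 := by ring
  have h5 : c.K ^ 8 = (c.K ^ 2) ^ 4 := by ring
  have h6 : 2 ≤ c.K ^ 8 := by rw [h5]; nlinarith [pow_pos (show 0 < c.K ^ 2 by linarith) 3]
  rw [h4]; nlinarith

theorem β_pos : 0 < c.β := by have := c.K_sq_le_β; have := c.K_pos; nlinarith

theorem K_le_β : 64 * c.K ≤ c.β := by have := c.K_sq_le_β; have := c.K_pos; nlinarith

theorem eps_pos (j : ℕ) : 0 < c.eps j := pow_pos c.β_pos _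

theorem eps_eq {j : ℕ} (hj : j < c.m) : c.eps j = c.β * c.eps (j + 1) := by
  unfold eps
  rw [← pow_succ']
  congr 1
  omega

theorem U_eq : c.U = c.β * c.eps 1 := c.eps_eq (j := 0) c.one_le_m

theorem U_pos : 0 < c.U := c.eps_pos 0

theorem eps_le_eps {i j : ℕ} (hij : i ≤ j) : c.eps j ≤ c.eps i :=
  pow_le_pow_right₀ (by have := c.β_pos; omega) (by omega)

theorem eps_dvd_eps {i j : ℕ} (hij : i ≤ j) : c.eps j ∣ c.eps i := pow_dvd_pow _ (by omega)

theorem eps_dvd_U (j : ℕ) : c.eps j ∣ c.U := eps_dvd_eps (Nat.zero_le j)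

@[simp] theorem del_zero : c.del 0 = 0 := rfl

theorem del_succ (j : ℕ) : c.del (j + 1) = c.del j + c.eps (j + 1) := Finset.sum_range_succ _ _

theorem eps_dvd_del (j : ℕ) : c.eps j ∣ c.del j :=
  Finset.dvd_sum fun i hi => eps_dvd_eps (by have := Finset.mem_range.1 hi; omega)

theorem del_mono {i j : ℕ} (hij : i ≤ j) : c.del i ≤ c.del j :=
  Finset.sum_le_sum_of_subset_of_nonneg (Finset.range_mono hij) fun _ _ _ => (c.eps_pos _).le

theorem del_nonneg (j : ℕ) : 0 ≤ c.del j := del_zero (c := c) ▸ del_mono (Nat.zero_le j)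

theorem eps_le_del_sub {i j : ℕ} (hij : i < j) : c.eps (i + 1) ≤ c.del j - c.del i := by
  have := del_mono (c := c) (show i + 1 ≤ j from hij)
  rw [del_succ] at this
  linarith

/-- The sizes of the edges decrease geometrically, so an apex is close to the next one. -/
theorem del_sub_le {i j : ℕ} (hij : i < j) (hj : j ≤ c.m) :
    4 * (c.del j - c.del i) ≤ 5 * c.eps (i + 1) := by
  have tel : ∀ j, i ≤ j → j ≤ c.m → (c.β - 1) * (c.del j - c.del i) = c.eps i - c.eps j := by
    intro j hij
    induction j, hij using Nat.le_induction with
    | base => intro _; ring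
    | succ j hij ih =>
      intro hj
      have h1 := ih (by omega)
      have h2 := c.eps_eq (show j < c.m by omega)
      rw [del_succ]
      linear_combination h1 - h2
  have h1 := tel j hij.le hj
  have h2 := c.eps_eq (show i < c.m by omega)
  have h3 := c.eps_pos j
  have h4 := c.eps_pos (i + 1)
  have h5 : 5 ≤ c.β - 1 := by have := c.K_le_β; have := c.K_pos; linarith
  by_contra hcon
  push Not at hcon
  nlinarith

theorem del_le {j : ℕ} (hj : j ≤ c.m) : 4 * c.del j ≤ 5 * c.eps 1 := by
  rcases Nat.eq_zero_or_pos j with rfl | h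
  · have := c.eps_pos 1; simp; linarith
  · simpa using del_sub_le h hj

theorem rho_nonneg {j : ℕ} (hj : j ≤ c.m) : 1 ≤ c.rho j := by unfold rho; omega

theorem rho_le {j : ℕ} (hj : 1 ≤ j) : c.rho j ≤ c.m := by unfold rho; omega

/-- The slack of a left edge in coordinates centred at an apex. -/
theorem left_form_sub (i j : ℕ) (r : Fin 2 → ℝ) :
    (c.left j).form r - (c.left j).c = -c.K * (r 0 - c.apex i 0) + j * (r 1 - c.apex i 1) +
      (c.K + j * c.N) * (c.del j - c.del i : ℤ) := by
  simp [HalfPlane.form, left, apex]; ring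

/-- The slack of a right edge in coordinates centred at an apex. -/
theorem right_form_sub (i j : ℕ) (r : Fin 2 → ℝ) :
    (c.right j).form r - (c.right j).c = c.rho j * (r 0 - c.apex i 0) + (r 1 - c.apex i 1) +
      (c.N - c.rho j) * (c.del j - c.del i : ℤ) := by
  simp [HalfPlane.form, right, apex]; ring

variable (c)

/-- The point satisfies the inequalities of both chains. -/
def Under (r : Fin 2 → ℝ) : Prop := ∀ R ∈ c.rows, R.Holds r

/-- The point is the optimum or lies on an edge line more than one level beyond level `i`. -/
def Deep (i : ℕ) (r : Fin 2 → ℝ) : Prop :=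
  (∃ l, i + 2 ≤ l ∧ l ≤ c.m ∧
    ((c.left l).form r = (c.left l).c ∨ (c.right l).form r = (c.right l).c)) ∨ r = c.apex c.m

variable {c}

theorem Under.left {r : Fin 2 → ℝ} (hr : c.Under r) {j : ℕ} (h1 : 1 ≤ j) (hj : j ≤ c.m) :
    (c.left j).form r ≤ (c.left j).c :=
  hr _ (c.mem_rows.2 ⟨j, h1, hj, Or.inl rfl⟩)

theorem Under.right {r : Fin 2 → ℝ} (hr : c.Under r) {j : ℕ} (h1 : 1 ≤ j) (hj : j ≤ c.m) :
    (c.right j).form r ≤ (c.right j).c :=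
  hr _ (c.mem_rows.2 ⟨j, h1, hj, Or.inr rfl⟩)

/-- The part of a left edge line cut out by its two neighbours is short. -/
theorem abs_le_of_left {K L N e ρ x y : ℝ} (hK : 0 < K) (hL : 1 ≤ L) (hN : 8 ≤ N)
    (hLN : 4 * (L * N) ≤ K) (he : 0 < e) (hρ : 0 ≤ ρ) (h : -K * x + L * y = 0)
    (hright : ρ * x + y ≤ 0) (hleft : -K * x + (L - 1) * y + (K + (L - 1) * N) * -e ≤ 0) :
    |x| ≤ 2 * K * e ∧ |y| ≤ 2 * K * e := by
  have hLK : L ≤ K := by nlinarith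
  have hy0 : y ≤ 0 := by
    by_contra hcon
    push Not at hcon
    have h1 : 0 < K * x := by nlinarith
    have hx : 0 < x := pos_of_mul_pos_right h1 hK.le
    have := mul_nonneg hρ hx.le
    linarith
  have hy1 : -(2 * K * e) ≤ y := by
    have h1 : -y ≤ (K + (L - 1) * N) * e := by linarith
    have h2 : (K + (L - 1) * N) * e ≤ 2 * K * e :=
      mul_le_mul_of_nonneg_right (by linarith) he.le
    linarith
  have hx0 : x ≤ 0 := by
    have h1 : K * x ≤ 0 := by nlinarith
    by_contra hcon
    push Not at hcon
    have := mul_pos hK hcon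
    linarith
  have hx1 : y ≤ x := by
    have h1 : K * y ≤ K * x := by nlinarith
    exact le_of_mul_le_mul_left h1 hK
  rw [abs_of_nonpos hx0, abs_of_nonpos hy0]
  constructor <;> linarith

/-- The part of a right edge line cut out by its two neighbours is short. -/
theorem abs_le_of_right {K L N e ρ x y : ℝ} (hK : 0 < K) (hL : 0 ≤ L) (hN : 8 ≤ N)
    (hNK : 4 * N ≤ K) (hρN : ρ * N ≤ K) (he : 0 < e) (hρ : 1 ≤ ρ) (h : ρ * x + y = 0)
    (hleft : -K * x + L * y ≤ 0) (hright : (ρ + 1) * x + y + (N - (ρ + 1)) * -e ≤ 0) :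
    |x| ≤ 2 * K * e ∧ |y| ≤ 2 * K * e := by
  have hy : y = -(ρ * x) := by linarith
  have hx0 : 0 ≤ x := by
    rw [hy] at hleft
    have h1 : 0 ≤ (K + L * ρ) * x := by linarith
    exact nonneg_of_mul_nonneg_right h1 (by positivity)
  have hx1 : x ≤ N * e := by
    have h1 : 0 ≤ (ρ + 1) * e := by positivity
    linarith
  have h1 : N * e ≤ K * e := mul_le_mul_of_nonneg_right (by linarith) he.le
  have h2 : ρ * x ≤ ρ * (N * e) := mul_le_mul_of_nonneg_left hx1 (by linarith)
  have h3 : ρ * N * e ≤ K * e := mul_le_mul_of_nonneg_right hρN he.le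
  have h4 := mul_pos hK he
  rw [hy, abs_neg, abs_of_nonneg hx0, abs_of_nonneg (mul_nonneg (by linarith) hx0)]
  constructor <;> linarith

/-- A point of the polygon deep in the chains is very close to some later apex. -/
theorem Deep.exists_apex {i : ℕ} (hi : i < c.m) {r : Fin 2 → ℝ} (hr : c.Under r)
    (hd : c.Deep i r) : ∃ l, i < l ∧ l ≤ c.m ∧ |r 0 - c.apex l 0| ≤ 2 * c.K * c.eps (i + 1) ∧
      |r 1 - c.apex l 1| ≤ 2 * c.K * c.eps (i + 1) := by
  have hK : (0 : ℝ) < c.K := by exact_mod_cast c.K_pos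
  have hN : (8 : ℝ) ≤ c.N := by exact_mod_cast c.eight_le_N
  rcases hd with ⟨l, hil, hl, hd⟩ | rfl
  · refine ⟨l, by omega, hl, ?_⟩
    obtain ⟨l, rfl⟩ : ∃ l', l = l' + 1 := ⟨l - 1, by omega⟩
    have heps : (c.eps (l + 1) : ℝ) ≤ c.eps (i + 1) := by
      exact_mod_cast eps_le_eps (by omega : i + 1 ≤ l + 1)
    have hpos : (0 : ℝ) < c.eps (l + 1) := by exact_mod_cast c.eps_pos _
    have hmN : 4 * (((l + 1 : ℕ) : ℝ) * c.N) ≤ c.K := by exact_mod_cast c.mN_le_K hl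
    have hL1 : (1 : ℝ) ≤ ((l + 1 : ℕ) : ℝ) := by exact_mod_cast Nat.succ_pos l
    have hdel : c.del l - c.del (l + 1) = -c.eps (l + 1) := by rw [del_succ]; ring
    have hρ1 : (1 : ℝ) ≤ c.rho (l + 1) := by exact_mod_cast rho_nonneg hl
    have hρm : (c.rho (l + 1) : ℝ) ≤ c.m := by exact_mod_cast rho_le (Nat.succ_pos l)
    have hmK : 4 * ((c.m : ℝ) * c.N) ≤ c.K := by exact_mod_cast c.mN_le_K le_rfl
    have hρl : (c.rho l : ℝ) = c.rho (l + 1) + 1 := by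
      have : c.rho l = c.rho (l + 1) + 1 := by unfold rho; push_cast; ring
      exact_mod_cast this
    have hleft := sub_nonpos.2 (hr.left (show 1 ≤ l + 1 by omega) hl)
    have hright := sub_nonpos.2 (hr.right (show 1 ≤ l + 1 by omega) hl)
    have hleft' := sub_nonpos.2 (hr.left (show 1 ≤ l by omega) (show l ≤ c.m by omega))
    have hright' := sub_nonpos.2 (hr.right (show 1 ≤ l by omega) (show l ≤ c.m by omega))
    rw [left_form_sub (l + 1)] at hleft hleft'
    rw [right_form_sub (l + 1)] at hright hright'
    rw [hdel] at hleft' hright'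
    rw [hρl] at hright'
    set x := r 0 - c.apex (l + 1) 0
    set y := r 1 - c.apex (l + 1) 1
    set L : ℝ := ((l + 1 : ℕ) : ℝ) with hL
    have hlL : (l : ℝ) = L - 1 := by rw [hL]; push_cast; ring
    rw [hlL] at hleft'
    simp only [sub_self, Int.cast_zero, mul_zero, add_zero, Int.cast_neg] at hleft hright hleft' hright'
    set e : ℝ := (c.eps (l + 1) : ℝ)
    set ρ : ℝ := (c.rho (l + 1) : ℝ)
    have hKe : (c.K : ℝ) * e ≤ c.K * c.eps (i + 1) := mul_le_mul_of_nonneg_left heps hK.le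
    rcases hd with hd | hd
    · have hd0 := sub_eq_zero.2 hd
      rw [left_form_sub (l + 1)] at hd0
      simp only [sub_self, Int.cast_zero, mul_zero, add_zero] at hd0
      have hd0 : -c.K * x + L * y = 0 := hd0
      obtain ⟨h1, h2⟩ := abs_le_of_left hK hL1 hN hmN hpos (by linarith) hd0 hright hleft'
      constructor <;> linarith
    · have hd0 := sub_eq_zero.2 hd
      rw [right_form_sub (l + 1)] at hd0
      simp only [sub_self, Int.cast_zero, mul_zero, add_zero] at hd0
      have hd0 : ρ * x + y = 0 := hd0
      have hNK : 4 * (c.N : ℝ) ≤ c.K := by exact_mod_cast c.four_N_le_K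
      obtain ⟨h1, h2⟩ := abs_le_of_right hK (by linarith) hN hNK (by nlinarith) hpos hρ1 hd0 hleft
        hright'
      constructor <;> linarith
  · refine ⟨c.m, hi, le_rfl, ?_⟩
    have : (0 : ℝ) < c.eps (i + 1) := by exact_mod_cast c.eps_pos _
    simp only [sub_self, abs_zero]
    constructor <;> positivity

/-- A point deep in the chains is so close to the apex of level `i` that no row with moderate
coefficients can tell them apart on the scale of level `i`. -/
theorem Deep.abs_le {i : ℕ} (hi : i < c.m) {r : Fin 2 → ℝ} (hr : c.Under r) (hd : c.Deep i r)
    {a b : ℤ} (ha : |a| ≤ c.K) (hb : |b| ≤ c.K) :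
    |a * (r 0 - c.apex i 0) + b * (r 1 - c.apex i 1)| ≤
      ((2 * c.K ^ 2) ^ 2 * c.eps (i + 1) : ℝ) := by
  obtain ⟨l, hil, hl, hx, hy⟩ := hd.exists_apex hi hr
  have hK : (32 : ℝ) ≤ c.K := by
    have h1 := c.four_N_le_K
    have h2 := c.eight_le_N
    exact_mod_cast (by linarith : (32 : ℤ) ≤ c.K)
  have hN : 4 * (c.N : ℝ) ≤ c.K := by exact_mod_cast c.four_N_le_K
  have hN0 : (0 : ℝ) ≤ c.N := by have := c.eight_le_N; exact_mod_cast (by linarith : (0 : ℤ) ≤ c.N)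
  have he : (0 : ℝ) < c.eps (i + 1) := by exact_mod_cast c.eps_pos _
  have ha' : |(a : ℝ)| ≤ c.K := by exact_mod_cast ha
  have hb' : |(b : ℝ)| ≤ c.K := by exact_mod_cast hb
  have hg : 4 * ((c.del l - c.del i : ℤ) : ℝ) ≤ 5 * c.eps (i + 1) := by
    exact_mod_cast del_sub_le hil hl
  have hg0 : (0 : ℝ) ≤ ((c.del l - c.del i : ℤ) : ℝ) := by
    exact_mod_cast sub_nonneg.2 (del_mono hil.le)
  set g : ℝ := ((c.del l - c.del i : ℤ) : ℝ) with hgdef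
  have hsplit : (a : ℝ) * (r 0 - c.apex i 0) + b * (r 1 - c.apex i 1) =
      a * (r 0 - c.apex l 0) + b * (r 1 - c.apex l 1) + (a * g - b * (c.N * g)) := by
    rw [hgdef]; simp [apex]; ring
  rw [hsplit]
  set e : ℝ := (c.eps (i + 1) : ℝ)
  have t1 : |(a : ℝ) * (r 0 - c.apex l 0)| ≤ c.K * (2 * c.K * e) := by
    rw [abs_mul]; exact mul_le_mul ha' hx (abs_nonneg _) (by linarith)
  have t2 : |(b : ℝ) * (r 1 - c.apex l 1)| ≤ c.K * (2 * c.K * e) := by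
    rw [abs_mul]; exact mul_le_mul hb' hy (abs_nonneg _) (by linarith)
  have t3 : |(a : ℝ) * g| ≤ c.K * (2 * e) := by
    rw [abs_mul, abs_of_nonneg hg0]; exact mul_le_mul ha' (by linarith) hg0 (by linarith)
  have t4 : |(b : ℝ) * (c.N * g)| ≤ c.K * (c.K * (2 * e)) := by
    rw [abs_mul, abs_of_nonneg (mul_nonneg hN0 hg0)]
    refine mul_le_mul hb' ?_ (mul_nonneg hN0 hg0) (by linarith)
    exact mul_le_mul (by linarith) (by linarith) hg0 (by linarith)
  have hsum : |(a : ℝ) * (r 0 - c.apex l 0) + b * (r 1 - c.apex l 1) + (a * g - b * (c.N * g))| ≤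
      c.K * (2 * c.K * e) + c.K * (2 * c.K * e) + (c.K * (2 * e) + c.K * (c.K * (2 * e))) :=
    (abs_add_le _ _).trans (add_le_add ((abs_add_le _ _).trans (add_le_add t1 t2))
      ((abs_sub _ _).trans (add_le_add t3 t4)))
  refine hsum.trans ?_
  have h2 : (1024 : ℝ) ≤ (c.K : ℝ) ^ 2 := by nlinarith
  have h3 : (c.K : ℝ) * (2 * c.K * e) + c.K * (2 * c.K * e) + (c.K * (2 * e) +
      c.K * (c.K * (2 * e))) ≤ 8 * c.K ^ 2 * e := by
    have : (c.K : ℝ) * e ≤ c.K ^ 2 * e := mul_le_mul_of_nonneg_right (by nlinarith) he.le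
    linarith
  refine h3.trans ?_
  have : (8 : ℝ) * c.K ^ 2 ≤ (2 * c.K ^ 2) ^ 2 := by nlinarith
  exact mul_le_mul_of_nonneg_right this he.le

/-- The point becomes a multiple of `eps j` after multiplication with a positive integer of size
at most `(2 K ^ 2) ^ i`. -/
def Lattice (c : Chain) (j i : ℕ) (p : Fin 2 → ℝ) : Prop :=
  ∃ q x y : ℤ, 1 ≤ q ∧ q ≤ (2 * c.K ^ 2) ^ i ∧ q * p 0 = c.eps j * x ∧ q * p 1 = c.eps j * y

theorem Lattice.mono {j j' i : ℕ} (hj : j ≤ j') {p : Fin 2 → ℝ} (h : c.Lattice j i p) :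
    c.Lattice j' i p := by
  obtain ⟨q, x, y, h1, h2, h3, h4⟩ := h
  obtain ⟨d, hd⟩ := c.eps_dvd_eps hj
  refine ⟨q, d * x, d * y, h1, h2, ?_, ?_⟩
  · rw [h3, hd]; push_cast; ring
  · rw [h4, hd]; push_cast; ring

/-- The invariant of the first `i` points of a walk: either only edges below level `i` have been
involved so far, or the last point is the first one on level `i`. -/
def Inv (c : Chain) (i : ℕ) (p : Fin 2 → ℝ) : Prop :=
  (1 ≤ i ∧ c.Lattice (i - 1) i p) ∨
    (c.Lattice i i p ∧ ((c.left i).form p = (c.left i).c ∨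
      (1 ≤ i ∧ (c.right i).form p = (c.right i).c)))

theorem Inv.lattice {i : ℕ} {p : Fin 2 → ℝ} (h : c.Inv i p) : c.Lattice i i p :=
  h.elim (fun h => h.2.mono (Nat.sub_le _ _)) fun h => h.1

theorem apex_dvd (i : ℕ) : ∃ x y : ℤ, c.apex i 0 = c.eps i * x ∧ c.apex i 1 = c.eps i * y := by
  obtain ⟨x, hx⟩ := c.eps_dvd_del i
  obtain ⟨u, hu⟩ := c.eps_dvd_U i
  refine ⟨x, c.h * u - c.N * x, ?_, ?_⟩
  · simp [apex, hx]
  · simp only [apex, Matrix.cons_val_one, Matrix.cons_val_fin_one]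
    rw [hx, hu]; push_cast; ring

theorem X_pow_lt_β {i : ℕ} (hi : i < c.m + 4) : (2 * c.K ^ 2) ^ i < c.β := by
  rw [c.β_eq]
  exact pow_lt_pow_right₀ (by have := c.K_pos; nlinarith) hi

/-- A row through a lattice point that passes very close to an apex passes through it. -/
theorem Lattice.eq_zero {i : ℕ} (hi : i < c.m) {p : Fin 2 → ℝ} (h : c.Lattice i i p) {a b : ℤ}
    (hab : |a * (p 0 - c.apex i 0) + b * (p 1 - c.apex i 1)| ≤
      (2 * c.K ^ 2) ^ 2 * c.eps (i + 1)) :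
    a * (p 0 - c.apex i 0) + b * (p 1 - c.apex i 1) = 0 := by
  obtain ⟨q, x, y, hq1, hq2, hx, hy⟩ := h
  obtain ⟨x', y', hx', hy'⟩ := c.apex_dvd i
  have hq0 : (0 : ℝ) < q := by exact_mod_cast (by omega : 0 < q)
  set Z : ℤ := a * (x - q * x') + b * (y - q * y') with hZ
  have hmul : (q : ℝ) * (a * (p 0 - c.apex i 0) + b * (p 1 - c.apex i 1)) = c.eps i * Z := by
    rw [hZ, hx', hy']; push_cast
    linear_combination a * hx + b * hy
  have he : (0 : ℤ) < c.eps (i + 1) := c.eps_pos _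
  have hZ0 : Z = 0 := by
    by_contra hne
    have h1 : (1 : ℤ) ≤ |Z| := Int.one_le_abs hne
    have h2 : (c.eps i : ℝ) * |(Z : ℝ)| ≤ q * ((2 * c.K ^ 2) ^ 2 * c.eps (i + 1)) := by
      have he' : (0 : ℝ) < c.eps i := by exact_mod_cast c.eps_pos i
      rw [← abs_of_pos he', ← abs_mul, ← hmul, abs_mul, abs_of_pos hq0]
      exact mul_le_mul_of_nonneg_left hab hq0.le
    have h3 : c.eps i * |Z| ≤ q * ((2 * c.K ^ 2) ^ 2 * c.eps (i + 1)) := by exact_mod_cast h2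
    rw [c.eps_eq hi] at h3
    have h4 : q * ((2 * c.K ^ 2) ^ 2 * c.eps (i + 1)) ≤
        (2 * c.K ^ 2) ^ (i + 2) * c.eps (i + 1) := by
      have h0 : (0 : ℤ) ≤ (2 * c.K ^ 2) ^ 2 * c.eps (i + 1) := by positivity
      calc _ ≤ (2 * c.K ^ 2) ^ i * ((2 * c.K ^ 2) ^ 2 * c.eps (i + 1)) :=
            mul_le_mul_of_nonneg_right hq2 h0
        _ = _ := by ring
    have h5 := c.X_pow_lt_β (show i + 2 < c.m + 4 by omega)
    have h6 : c.β * c.eps (i + 1) ≤ c.β * c.eps (i + 1) * |Z| :=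
      le_mul_of_one_le_right (mul_nonneg c.β_pos.le he.le) h1
    nlinarith
  rw [hZ0] at hmul
  simpa [hq0.ne'] using hmul

/-- A line that avoids the direction `(-1, N)` cannot join an apex to a coarser lattice point. -/
theorem Lattice.direction {i : ℕ} (h1 : 1 ≤ i) (hi : i < c.m) {p : Fin 2 → ℝ}
    (h : c.Lattice (i - 1) i p) {a b : ℤ} (ha : |a| ≤ c.K) (hb : |b| ≤ c.K)
    (hab : a * (p 0 - c.apex i 0) + b * (p 1 - c.apex i 1) = 0) : a = c.N * b := by
  obtain ⟨q, x, y, hq1, hq2, hx, hy⟩ := h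
  obtain ⟨j, rfl⟩ : ∃ j, i = j + 1 := ⟨i - 1, by omega⟩
  simp only [Nat.add_sub_cancel] at hx hy
  obtain ⟨d, hd⟩ := c.eps_dvd_del j
  obtain ⟨u, hu⟩ := c.eps_dvd_U j
  have hej := c.eps_eq (show j < c.m by omega)
  have he : c.eps (j + 1) ≠ 0 := (c.eps_pos _).ne'
  have hE : c.eps j * (a * x + b * y - q * (b * c.h * u) - q * (a - c.N * b) * d) =
      q * (a - c.N * b) * c.eps (j + 1) := by
    have : (q : ℝ) * (a * (p 0 - c.apex (j + 1) 0) + b * (p 1 - c.apex (j + 1) 1)) = 0 := by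
      rw [hab, mul_zero]
    simp only [apex, Matrix.cons_val_zero, Matrix.cons_val_one, Matrix.cons_val_fin_one] at this
    rw [del_succ, hd, hu] at this
    push_cast at this
    have h2 : (c.eps j : ℝ) * (a * x + b * y - q * (b * c.h * u) - q * (a - c.N * b) * d) =
      q * (a - c.N * b) * c.eps (j + 1) := by
      linear_combination this - a * hx - b * hy
    exact_mod_cast h2
  rw [hej, mul_right_comm, mul_comm] at hE
  have hdvd : c.β ∣ q * (a - c.N * b) := by
    refine ⟨a * x + b * y - q * (b * c.h * u) - q * (a - c.N * b) * d, ?_⟩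
    apply mul_left_cancel₀ he
    linear_combination -hE
  by_contra hne
  have hne' : a - c.N * b ≠ 0 := sub_ne_zero.2 hne
  have h3 : c.β ≤ |q * (a - c.N * b)| :=
    Int.le_of_dvd (abs_pos.2 (mul_ne_zero (by omega) hne')) ((dvd_abs _ _).2 hdvd)
  have hN := c.four_N_le_K
  have hN8 := c.eight_le_N
  have h4 : |a - c.N * b| ≤ 2 * c.K ^ 2 := by
    have : |c.N * b| ≤ c.N * c.K := by
      rw [abs_mul, abs_of_pos (by linarith)]
      exact mul_le_mul_of_nonneg_left hb (by linarith)
    have := abs_sub a (c.N * b)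
    nlinarith
  have h5 : |q * (a - c.N * b)| ≤ (2 * c.K ^ 2) ^ (j + 1) * (2 * c.K ^ 2) := by
    rw [abs_mul, abs_of_pos (show 0 < q by omega)]
    exact mul_le_mul hq2 h4 (abs_nonneg _) (pow_nonneg (by positivity) _)
  have h6 := c.X_pow_lt_β (show j + 2 < c.m + 4 by omega)
  rw [← pow_succ] at h5
  linarith

end Chain

end CircuitWalks

/-! ### One move climbs at most one level -/

namespace CircuitWalks

namespace Chain

variable {c : Chain}

/-- Two rows vanishing on a common nonzero vector have the same kernel. -/
theorem form_eq_zero_of_parallel {a b a' b' x y u v : ℝ} (hab : a ≠ 0 ∨ b ≠ 0)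
    (hxy : x ≠ 0 ∨ y ≠ 0) (h1 : a * x + b * y = 0) (h2 : a' * x + b' * y = 0)
    (h3 : a * u + b * v = 0) : a' * u + b' * v = 0 := by
  have hdet : a * b' = b * a' := by
    rcases hxy with h | h
    · refine sub_eq_zero.1 ((mul_eq_zero.1 (?_ : x * (a * b' - b * a') = 0)).resolve_left h)
      linear_combination b' * h1 - b * h2
    · refine sub_eq_zero.1 ((mul_eq_zero.1 (?_ : y * (a * b' - b * a') = 0)).resolve_left h)
      linear_combination a * h2 - a' * h1
  rcases hab with h | h
  · refine (mul_eq_zero.1 (?_ : a * (a' * u + b' * v) = 0)).resolve_left h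
    linear_combination a' * h3 + v * hdet
  · refine (mul_eq_zero.1 (?_ : b * (a' * u + b' * v) = 0)).resolve_left h
    linear_combination b' * h3 - u * hdet

theorem apex_not_under {i : ℕ} (hi : i < c.m) : ¬ c.Under (c.apex i) := by
  intro h
  have h1 := sub_nonpos.2 (h.left (show 1 ≤ i + 1 by omega) hi)
  rw [left_form_sub i, sub_self, sub_self, mul_zero, mul_zero, add_zero, zero_add, del_succ,
    add_sub_cancel_left] at h1
  have hK : (0 : ℝ) < c.K := by exact_mod_cast c.K_pos
  have hN : (8 : ℝ) ≤ c.N := by exact_mod_cast c.eight_le_N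
  have he : (0 : ℝ) < c.eps (i + 1) := by exact_mod_cast c.eps_pos _
  have : 0 < ((c.K : ℝ) + ((i + 1 : ℕ) : ℝ) * c.N) * c.eps (i + 1) := by positivity
  linarith

/-- A left edge line of level `i` leaves the polygon before it gets deep. -/
theorem Deep.not_on_left {i : ℕ} (hi : i < c.m) {r : Fin 2 → ℝ} (hr : c.Under r)
    (hd : c.Deep i r) : -c.K * (r 0 - c.apex i 0) + i * (r 1 - c.apex i 1) ≠ 0 := by
  intro h
  have hK : (0 : ℝ) < c.K := by exact_mod_cast c.K_pos
  have hN : (8 : ℝ) ≤ c.N := by exact_mod_cast c.eight_le_N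
  have hNK : 4 * (c.N : ℝ) ≤ c.K := by exact_mod_cast c.four_N_le_K
  have he : (0 : ℝ) < c.eps (i + 1) := by exact_mod_cast c.eps_pos _
  have hleft := sub_nonpos.2 (hr.left (show 1 ≤ i + 1 by omega) hi)
  rw [left_form_sub i, del_succ, add_sub_cancel_left] at hleft
  push_cast at hleft
  have hi0 : (0 : ℝ) ≤ i := Nat.cast_nonneg i
  rcases hd with ⟨l, hil, hl, hd | hd⟩ | rfl
  · have hd0 := sub_eq_zero.2 hd
    rw [left_form_sub i] at hd0
    have hlN : 4 * ((l : ℝ) * c.N) ≤ c.K := by exact_mod_cast c.mN_le_K hl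
    have hg : 4 * ((c.del l - c.del i : ℤ) : ℝ) ≤ 5 * c.eps (i + 1) := by
      exact_mod_cast del_sub_le (by omega : i < l) hl
    have hg0 : (0 : ℝ) ≤ ((c.del l - c.del i : ℤ) : ℝ) := by
      exact_mod_cast sub_nonneg.2 (del_mono (by omega))
    have hil' : (i : ℝ) + 2 ≤ l := by exact_mod_cast hil
    set x := r 0 - c.apex i 0
    set y := r 1 - c.apex i 1
    set g : ℝ := ((c.del l - c.del i : ℤ) : ℝ)
    set e : ℝ := (c.eps (i + 1) : ℝ)
    have h1 : y ≤ -(c.K * e) := by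
      have : 0 ≤ ((i : ℝ) + 1) * c.N * e := by positivity
      linarith
    have h2 : ((l : ℝ) - i) * y + (c.K + l * c.N) * g = 0 := by linarith
    have h3 : ((l : ℝ) - i) * y ≤ 2 * -(c.K * e) := by
      have : ((l : ℝ) - i) * y ≤ ((l : ℝ) - i) * -(c.K * e) :=
        mul_le_mul_of_nonneg_left h1 (by linarith)
      have h4 : 0 < c.K * e := mul_pos hK he
      nlinarith
    have h4 : ((c.K : ℝ) + l * c.N) * g ≤ (5 / 4 * c.K) * (5 / 4 * e) :=
      mul_le_mul (by linarith) (by linarith) hg0 (by linarith)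
    have h5 : 0 < c.K * e := mul_pos hK he
    linarith
  · have hd0 := sub_eq_zero.2 hd
    rw [right_form_sub i] at hd0
    have hg : 4 * ((c.del l - c.del i : ℤ) : ℝ) ≤ 5 * c.eps (i + 1) := by
      exact_mod_cast del_sub_le (by omega : i < l) hl
    have hg0 : (0 : ℝ) ≤ ((c.del l - c.del i : ℤ) : ℝ) := by
      exact_mod_cast sub_nonneg.2 (del_mono (by omega))
    have hρ : (1 : ℝ) ≤ c.rho l := by exact_mod_cast rho_nonneg hl
    set x := r 0 - c.apex i 0
    set y := r 1 - c.apex i 1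
    set g : ℝ := ((c.del l - c.del i : ℤ) : ℝ)
    set e : ℝ := (c.eps (i + 1) : ℝ)
    set ρ : ℝ := (c.rho l : ℝ)
    have h1 : y ≤ -(c.K * e) := by
      have : 0 ≤ ((i : ℝ) + 1) * c.N * e := by positivity
      linarith
    have hx : x ≤ 0 := by
      have h2 : c.K * x ≤ 0 := by
        have : (i : ℝ) * y ≤ 0 := mul_nonpos_of_nonneg_of_nonpos hi0 (by nlinarith)
        linarith
      by_contra hcon
      push Not at hcon
      have := mul_pos hK hcon
      linarith
    have h2 : ρ * x ≤ 0 := mul_nonpos_of_nonneg_of_nonpos (by linarith) hx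
    have h3 : (c.N - ρ) * g ≤ c.N * (5 / 4 * e) := by nlinarith
    have h4 : (c.N : ℝ) * e ≤ 1 / 4 * c.K * e := mul_le_mul_of_nonneg_right (by linarith) he.le
    have h5 : 0 < c.K * e := mul_pos hK he
    linarith
  · have hg0 : (0 : ℝ) < ((c.del c.m - c.del i : ℤ) : ℝ) := by
      have := eps_le_del_sub (c := c) hi
      have := c.eps_pos (i + 1)
      exact_mod_cast (by linarith : 0 < c.del c.m - c.del i)
    have : -(c.K : ℝ) * (c.apex c.m 0 - c.apex i 0) + i * (c.apex c.m 1 - c.apex i 1) =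
        -((c.K + i * c.N) * ((c.del c.m - c.del i : ℤ) : ℝ)) := by
      simp [apex]; ring
    rw [this] at h
    have : 0 < ((c.K : ℝ) + i * c.N) * ((c.del c.m - c.del i : ℤ) : ℝ) := by positivity
    linarith

/-- A right edge line of level `i` leaves the polygon before it gets deep. -/
theorem Deep.not_on_right {i : ℕ} (h1i : 1 ≤ i) (hi : i < c.m) {r : Fin 2 → ℝ} (hr : c.Under r)
    (hd : c.Deep i r) : c.rho i * (r 0 - c.apex i 0) + (r 1 - c.apex i 1) ≠ 0 := by
  intro h
  have hK : (0 : ℝ) < c.K := by exact_mod_cast c.K_pos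
  have hN : (8 : ℝ) ≤ c.N := by exact_mod_cast c.eight_le_N
  have he : (0 : ℝ) < c.eps (i + 1) := by exact_mod_cast c.eps_pos _
  have hright := sub_nonpos.2 (hr.right (show 1 ≤ i + 1 by omega) hi)
  have hρs : (c.rho (i + 1) : ℝ) = c.rho i - 1 := by
    have : c.rho (i + 1) = c.rho i - 1 := by unfold rho; push_cast; ring
    exact_mod_cast this
  have hρN : 7 ≤ (c.N : ℝ) - c.rho i := by
    have h1 := c.le_N
    have h2 := rho_le (c := c) h1i
    have h3 := c.one_le_m
    exact_mod_cast (by omega : 7 ≤ c.N - c.rho i)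
  rw [right_form_sub i, del_succ, add_sub_cancel_left, hρs] at hright
  have hρ : (1 : ℝ) ≤ c.rho i := by exact_mod_cast rho_nonneg hi.le
  rcases hd with ⟨l, hil, hl, hd | hd⟩ | rfl
  · have hd0 := sub_eq_zero.2 hd
    rw [left_form_sub i] at hd0
    have hlN : 4 * ((l : ℝ) * c.N) ≤ c.K := by exact_mod_cast c.mN_le_K hl
    have hg : 4 * ((c.del l - c.del i : ℤ) : ℝ) ≤ 5 * c.eps (i + 1) := by
      exact_mod_cast del_sub_le (by omega : i < l) hl
    have hg0 : (0 : ℝ) ≤ ((c.del l - c.del i : ℤ) : ℝ) := by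
      exact_mod_cast sub_nonneg.2 (del_mono (by omega))
    have hl0 : (0 : ℝ) ≤ l := Nat.cast_nonneg l
    set x := r 0 - c.apex i 0
    set y := r 1 - c.apex i 1
    set g : ℝ := ((c.del l - c.del i : ℤ) : ℝ)
    set e : ℝ := (c.eps (i + 1) : ℝ)
    set ρ : ℝ := (c.rho i : ℝ)
    have hy : y = -(ρ * x) := by linarith
    have h1 : 8 * e ≤ x := by nlinarith
    have h2 : (c.K + l * ρ) * x = (c.K + l * c.N) * g := by rw [hy] at hd0; linarith
    have h3 : c.K * (8 * e) ≤ (c.K + l * ρ) * x := by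
      have : 0 ≤ l * ρ * x :=
        mul_nonneg (mul_nonneg hl0 (by linarith)) (by linarith)
      nlinarith
    have h4 : ((c.K : ℝ) + l * c.N) * g ≤ (5 / 4 * c.K) * (5 / 4 * e) :=
      mul_le_mul (by linarith) (by linarith) hg0 (by linarith)
    have h5 : 0 < c.K * e := mul_pos hK he
    linarith
  · have hd0 := sub_eq_zero.2 hd
    rw [right_form_sub i] at hd0
    have hg : 4 * ((c.del l - c.del i : ℤ) : ℝ) ≤ 5 * c.eps (i + 1) := by
      exact_mod_cast del_sub_le (by omega : i < l) hl
    have hρl : (c.rho l : ℝ) = c.rho i - (l - i) := by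
      have : c.rho l = c.rho i - (l - i) := by unfold rho; ring
      exact_mod_cast this
    have hil' : (i : ℝ) + 2 ≤ l := by exact_mod_cast hil
    rw [hρl] at hd0
    set x := r 0 - c.apex i 0
    set y := r 1 - c.apex i 1
    set g : ℝ := ((c.del l - c.del i : ℤ) : ℝ)
    set e : ℝ := (c.eps (i + 1) : ℝ)
    set n : ℝ := (c.N : ℝ) - c.rho i
    obtain ⟨d, hd'⟩ : ∃ d : ℝ, d = (l : ℝ) - i := ⟨_, rfl⟩
    have hn : (c.N : ℝ) = n + c.rho i := by ring
    rw [hn, ← hd'] at hd0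
    rw [hn] at hright
    have h1 : (n + 1) * e ≤ x := by linarith
    have hd2 : 2 ≤ d := by linarith
    have h2 : d * x = (n + d) * g := by linarith
    have h3 : d * ((n + 1) * e) ≤ d * x := mul_le_mul_of_nonneg_left h1 (by linarith)
    have h4 : (n + d) * (4 * g) ≤ (n + d) * (5 * e) := mul_le_mul_of_nonneg_left hg (by linarith)
    have h5 : (4 * (d * (n + 1)) - 5 * (n + d)) * e ≤ 0 := by linarith
    have h6 : 0 < 4 * (d * (n + 1)) - 5 * (n + d) := by nlinarith
    have := mul_pos h6 he
    linarith
  · have hg0 : (0 : ℝ) < ((c.del c.m - c.del i : ℤ) : ℝ) := by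
      have := eps_le_del_sub (c := c) hi
      have := c.eps_pos (i + 1)
      exact_mod_cast (by linarith : 0 < c.del c.m - c.del i)
    have : (c.rho i : ℝ) * (c.apex c.m 0 - c.apex i 0) + (c.apex c.m 1 - c.apex i 1) =
        -((c.N - c.rho i) * ((c.del c.m - c.del i : ℤ) : ℝ)) := by
      simp [apex]; ring
    rw [this] at h
    have : 0 < ((c.N : ℝ) - c.rho i) * ((c.del c.m - c.del i : ℤ) : ℝ) :=
      mul_pos (by linarith) hg0
    linarith

/-- One move climbs at most one level, unless it follows the line `N x + y = h U` through all
the apexes. -/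
theorem Inv.not_deep {i : ℕ} (hi : i < c.m) {p r : Fin 2 → ℝ} (hp : c.Under p) (hr : c.Under r)
    (hinv : c.Inv i p) {l : HalfPlane} (ha : |l.a| ≤ c.K) (hb : |l.b| ≤ c.K)
    (hne : l.a ≠ 0 ∨ l.b ≠ 0) (hl : l.form r = l.form p)
    (hline : l.a = c.N * l.b → c.N * p 0 + p 1 ≠ (c.h * c.U : ℤ)) : ¬ c.Deep i r := by
  intro hd
  have h1 := hd.abs_le hi hr ha hb
  have h2 : (l.a : ℝ) * (r 0 - c.apex i 0) + l.b * (r 1 - c.apex i 1) =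
      l.a * (p 0 - c.apex i 0) + l.b * (p 1 - c.apex i 1) := by
    unfold HalfPlane.form at hl
    linear_combination hl
  rw [h2] at h1
  have h3 := hinv.lattice.eq_zero hi h1
  have hneR : (l.a : ℝ) ≠ 0 ∨ (l.b : ℝ) ≠ 0 := by exact_mod_cast hne
  have hpne : p 0 - c.apex i 0 ≠ 0 ∨ p 1 - c.apex i 1 ≠ 0 := by
    by_contra hcon
    push Not at hcon
    refine apex_not_under hi ?_
    have : p = c.apex i := by
      ext j
      fin_cases j
      · exact sub_eq_zero.1 hcon.1
      · exact sub_eq_zero.1 hcon.2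
    exact this ▸ hp
  rcases hinv with ⟨h1i, hlat⟩ | ⟨-, hon | ⟨h1i, hon⟩⟩
  · have h4 := hlat.direction h1i hi ha hb h3
    refine hline h4 ?_
    have hb0 : (l.b : ℝ) ≠ 0 := by
      rcases hneR with h | h
      · intro h0
        apply h
        rw [h4]; push_cast; rw [h0, mul_zero]
      · exact h
    rw [h4] at h3
    push_cast at h3
    have h5 : (l.b : ℝ) * (c.N * (p 0 - c.apex i 0) + (p 1 - c.apex i 1)) = 0 := by
      linear_combination h3
    have h6 := (mul_eq_zero.1 h5).resolve_left hb0
    simp only [apex, Matrix.cons_val_zero, Matrix.cons_val_one, Matrix.cons_val_fin_one] at h6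
    push_cast at h6 ⊢
    linarith
  · have h4 := sub_eq_zero.2 hon
    rw [left_form_sub i, sub_self, Int.cast_zero, mul_zero, add_zero] at h4
    exact hd.not_on_left hi hr (form_eq_zero_of_parallel hneR hpne h3 h4 (h2.trans h3))
  · have h4 := sub_eq_zero.2 hon
    rw [right_form_sub i, sub_self, Int.cast_zero, mul_zero, add_zero] at h4
    have h5 := form_eq_zero_of_parallel (a' := c.rho i) (b' := 1) hneR hpne h3
      (by rw [one_mul]; exact h4) (h2.trans h3)
    rw [one_mul] at h5
    exact hd.not_on_right h1i hi hr h5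

/-- Moving to a tight row multiplies the denominators by a determinant of two rows. -/
theorem Lattice.step {i j : ℕ} {p r : Fin 2 → ℝ} (h : c.Lattice j i p) {l R : HalfPlane}
    (hla : |l.a| ≤ c.K) (hlb : |l.b| ≤ c.K) (hRa : |R.a| ≤ c.K) (hRb : |R.b| ≤ c.K)
    (hl : l.form r = l.form p) (hRlt : R.form p < R.form r) (hR : R.form r = R.c)
    (hdvd : c.eps j ∣ R.c) (hne : l.a ≠ 0 ∨ l.b ≠ 0) : c.Lattice j (i + 1) r := by
  obtain ⟨q, x, y, hq1, hq2, hx, hy⟩ := h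
  obtain ⟨d, hd⟩ := hdvd
  set D : ℤ := R.b * l.a - R.a * l.b with hD
  have hR' : (R.a : ℝ) * r 0 + R.b * r 1 = c.eps j * d := by
    have : R.form r = (c.eps j * d : ℤ) := by rw [hR, hd]
    simpa [HalfPlane.form] using this
  unfold HalfPlane.form at hl hRlt
  have e0 : (q : ℝ) * D * r 0 = c.eps j * (D * x - l.b * (q * d - R.a * x - R.b * y) : ℤ) := by
    rw [hD]; push_cast
    linear_combination (q * R.b) * hl - (q * l.b) * hR' + ((R.b : ℝ) * l.a) * hx
      + ((R.b : ℝ) * l.b) * hy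
  have e1 : (q : ℝ) * D * r 1 = c.eps j * (D * y + l.a * (q * d - R.a * x - R.b * y) : ℤ) := by
    rw [hD]; push_cast
    linear_combination (-q * R.a) * hl + (q * l.a) * hR' - ((R.a : ℝ) * l.a) * hx
      - ((R.a : ℝ) * l.b) * hy
  have hD0 : D ≠ 0 := by
    intro h0
    have h0' : (R.b : ℝ) * l.a - R.a * l.b = 0 := by
      have : ((R.b * l.a - R.a * l.b : ℤ) : ℝ) = 0 := by rw [← hD, h0, Int.cast_zero]
      push_cast at this
      exact this
    have hneR : (l.a : ℝ) ≠ 0 ∨ (l.b : ℝ) ≠ 0 := by exact_mod_cast hne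
    have : (R.a : ℝ) * (r 0 - p 0) + R.b * (r 1 - p 1) = 0 := by
      rcases hneR with h | h
      · refine (mul_eq_zero.1 (?_ : (l.a : ℝ) * _ = 0)).resolve_left h
        linear_combination (R.a : ℝ) * hl + (r 1 - p 1) * h0'
      · refine (mul_eq_zero.1 (?_ : (l.b : ℝ) * _ = 0)).resolve_left h
        linear_combination (R.b : ℝ) * hl - (r 0 - p 0) * h0'
    linarith
  have hDle : |D| ≤ 2 * c.K ^ 2 := by
    have h1 : |R.b * l.a| ≤ c.K * c.K := by
      rw [abs_mul]; exact mul_le_mul hRb hla (abs_nonneg _) c.K_pos.le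
    have h2 : |R.a * l.b| ≤ c.K * c.K := by
      rw [abs_mul]; exact mul_le_mul hRa hlb (abs_nonneg _) c.K_pos.le
    have := abs_sub (R.b * l.a) (R.a * l.b)
    nlinarith
  have hq : q * |D| ≤ (2 * c.K ^ 2) ^ (i + 1) := by
    rw [pow_succ]
    exact mul_le_mul hq2 hDle (abs_nonneg _) (by positivity)
  have h1D := Int.one_le_abs hD0
  rcases abs_choice D with hs | hs
  · refine ⟨q * |D|, D * x - l.b * (q * d - R.a * x - R.b * y),
      D * y + l.a * (q * d - R.a * x - R.b * y), by nlinarith, hq, ?_, ?_⟩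
    · rw [hs, ← e0]; push_cast; ring
    · rw [hs, ← e1]; push_cast; ring
  · refine ⟨q * |D|, -(D * x - l.b * (q * d - R.a * x - R.b * y)),
      -(D * y + l.a * (q * d - R.a * x - R.b * y)), by nlinarith, hq, ?_, ?_⟩
    · rw [hs]; push_cast at e0 ⊢; linear_combination -e0
    · rw [hs]; push_cast at e1 ⊢; linear_combination -e1

theorem left_abs {j : ℕ} (hj : j ≤ c.m) : |(c.left j).a| ≤ c.K ∧ |(c.left j).b| ≤ c.K := by
  have h1 := c.m_le_K
  have h2 := c.K_pos
  constructor
  · simp only [left, abs_neg, abs_of_pos h2, le_refl]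
  · simp only [left]
    rw [abs_of_nonneg (by omega)]
    omega

theorem right_abs {j : ℕ} (h1j : 1 ≤ j) (hj : j ≤ c.m) :
    |(c.right j).a| ≤ c.K ∧ |(c.right j).b| ≤ c.K := by
  have h1 := c.m_le_K
  have h2 := c.K_pos
  have h3 := rho_nonneg hj
  have h4 := rho_le (c := c) h1j
  constructor
  · simp only [right]
    rw [abs_of_nonneg (by omega)]
    omega
  · simp only [right, abs_one]; omega

theorem eps_dvd_left (j : ℕ) : c.eps j ∣ (c.left j).c :=
  dvd_sub (((eps_dvd_U j).mul_left _).mul_left _) ((eps_dvd_del j).mul_left _)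

theorem eps_dvd_right (j : ℕ) : c.eps j ∣ (c.right j).c :=
  dvd_sub ((eps_dvd_U j).mul_left _) ((eps_dvd_del j).mul_left _)

/-- The invariant is inherited by the next point of a walk. -/
theorem Inv.step {base : List HalfPlane}
    (hbase : ∀ R ∈ base, |R.a| ≤ c.K ∧ |R.b| ≤ c.K ∧ c.U ∣ R.c)
    {i : ℕ} (hi : i < c.m) {p r : Fin 2 → ℝ} (hp : c.Under p) (hr : c.Under r)
    (hinv : c.Inv i p) {l R : HalfPlane} (hl : l ∈ base ++ c.rows) (hR : R ∈ base ++ c.rows)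
    (hne : l.a ≠ 0 ∨ l.b ≠ 0) (hlrp : l.form r = l.form p)
    (hRlt : R.form p < R.form r) (htight : R.form r = R.c)
    (hline : l.a = c.N * l.b → c.N * p 0 + p 1 ≠ (c.h * c.U : ℤ)) :
    c.Inv (i + 1) r ∧ r ≠ c.apex c.m := by
  have habs : ∀ R ∈ base ++ c.rows, |R.a| ≤ c.K ∧ |R.b| ≤ c.K := by
    intro R hR
    rcases List.mem_append.1 hR with h | h
    · exact ⟨(hbase R h).1, (hbase R h).2.1⟩
    · obtain ⟨j, h1, hj, rfl | rfl⟩ := c.mem_rows.1 h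
      · exact left_abs hj
      · exact right_abs h1 hj
  obtain ⟨hla, hlb⟩ := habs l hl
  obtain ⟨hRa, hRb⟩ := habs R hR
  have hnd := hinv.not_deep hi hp hr hla hlb hne hlrp hline
  refine ⟨?_, fun h => hnd (Or.inr h)⟩
  have hstep := fun (j : ℕ) (hij : i ≤ j) (hdvd : c.eps j ∣ R.c) =>
    (hinv.lattice.mono hij).step hla hlb hRa hRb hlrp hRlt htight hdvd hne
  rcases List.mem_append.1 hR with h | h
  · exact Or.inl ⟨by omega, hstep i le_rfl ((eps_dvd_U i).trans (hbase R h).2.2)⟩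
  · obtain ⟨j, h1, hj, hRj⟩ := c.mem_rows.1 h
    have hji : j ≤ i + 1 := by
      by_contra hcon
      refine hnd (Or.inl ⟨j, by omega, hj, ?_⟩)
      rcases hRj with rfl | rfl
      · exact Or.inl htight
      · exact Or.inr htight
    have hdvd : c.eps j ∣ R.c := by
      rcases hRj with rfl | rfl
      · exact eps_dvd_left j
      · exact eps_dvd_right j
    rcases Nat.lt_or_ge i j with hij | hij
    · obtain rfl : j = i + 1 := by omega
      refine Or.inr ⟨hstep _ (by omega) hdvd, ?_⟩
      rcases hRj with rfl | rfl
      · exact Or.inl htight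
      · exact Or.inr ⟨by omega, htight⟩
    · exact Or.inl ⟨by omega, hstep i le_rfl ((eps_dvd_eps hij).trans hdvd)⟩

theorem inv_zero : c.Inv 0 0 := by
  refine Or.inr ⟨⟨1, 0, 0, le_rfl, by simp, by simp, by simp⟩, Or.inl ?_⟩
  simp [HalfPlane.form, left]

end Chain

end CircuitWalks

/-! ### The shape of the two chains -/

namespace CircuitWalks

namespace Chain

variable {c : Chain}

theorem del_le_U {j : ℕ} (hj : j ≤ c.m) : 32 * (c.K * c.del j) ≤ c.U := by
  have h1 := c.del_le hj
  have h2 := c.U_eq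
  have h3 := c.K_le_β
  have h4 := c.eps_pos 1
  have h5 := c.K_pos
  have h6 : c.K * (4 * c.del j) ≤ c.K * (5 * c.eps 1) := mul_le_mul_of_nonneg_left h1 h5.le
  have h7 : 64 * c.K * c.eps 1 ≤ c.β * c.eps 1 := mul_le_mul_of_nonneg_right h3 h4.le
  have h8 := mul_pos h5 h4
  linarith

/-- Points well below the optimum satisfy the inequalities of the chains. -/
theorem under_of_low {r : Fin 2 → ℝ} {W : ℝ} (hW : c.U ≤ W) (h0 : -1 ≤ r 0) (h0W : r 0 ≤ W + 1)
    (h1 : r 1 ≤ (c.h * c.U : ℤ) - c.N * W) : c.Under r := by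
  intro R hR
  obtain ⟨j, h1j, hj, rfl | rfl⟩ := c.mem_rows.1 hR
  all_goals
    have hd : 32 * ((c.K : ℝ) * c.del j) ≤ c.U := by exact_mod_cast c.del_le_U hj
    have hd0 : (0 : ℝ) ≤ c.del j := by exact_mod_cast c.del_nonneg j
    have hK : (32 : ℝ) ≤ c.K := by
      have h1 := c.four_N_le_K
      have h2 := c.eight_le_N
      exact_mod_cast (by linarith : (32 : ℤ) ≤ c.K)
    have hKU : 64 * (c.K : ℝ) ≤ c.U := by
      have h1 := c.K_le_β
      have h2 := c.U_eq
      have h3 := c.eps_pos 1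
      have h4 := c.β_pos
      exact_mod_cast (by nlinarith : 64 * c.K ≤ c.U)
    have hj1 : (1 : ℝ) ≤ j := by exact_mod_cast h1j
    have hN : (8 : ℝ) ≤ c.N := by exact_mod_cast c.eight_le_N
    have hjN : 4 * ((j : ℝ) * c.N) ≤ c.K := by exact_mod_cast c.mN_le_K hj
    push_cast at h1
  · unfold HalfPlane.Holds
    simp only [HalfPlane.form, left]
    push_cast
    have e1 : (j : ℝ) * r 1 ≤ j * (c.h * c.U - c.N * W) := mul_le_mul_of_nonneg_left h1 (by linarith)
    have e2 : -(c.K : ℝ) * r 0 ≤ c.K := by nlinarith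
    have e3 : (j * c.N) * (c.del j : ℝ) ≤ c.K * c.del j :=
      mul_le_mul_of_nonneg_right (by nlinarith) hd0
    have e4 : (8 : ℝ) * W ≤ j * c.N * W := mul_le_mul_of_nonneg_right (by nlinarith) (by linarith)
    linarith
  · unfold HalfPlane.Holds
    simp only [HalfPlane.form, right]
    push_cast
    have hρ : (1 : ℝ) ≤ c.rho j := by exact_mod_cast rho_nonneg hj
    have hρN : 2 * (c.rho j : ℝ) ≤ c.N := by
      have h1 := c.le_N
      have h2 := rho_le (c := c) h1j
      exact_mod_cast (by omega : 2 * c.rho j ≤ c.N)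
    have e1 : (c.rho j : ℝ) * r 0 ≤ c.rho j * (W + 1) := mul_le_mul_of_nonneg_left h0W (by linarith)
    have e2 : (c.N - c.rho j : ℝ) * (c.del j + 1) ≤ (c.N - c.rho j) * W :=
      mul_le_mul_of_nonneg_left (by nlinarith) (by linarith)
    linarith

theorem apex_under : c.Under (c.apex c.m) := by
  intro R hR
  obtain ⟨j, h1j, hj, rfl | rfl⟩ := c.mem_rows.1 hR
  all_goals
    have hd0 : ((c.del j - c.del c.m : ℤ) : ℝ) ≤ 0 := by
      exact_mod_cast sub_nonpos.2 (c.del_mono hj)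
    have hK : (0 : ℝ) < c.K := by exact_mod_cast c.K_pos
    have hN : (8 : ℝ) ≤ c.N := by exact_mod_cast c.eight_le_N
    refine sub_nonpos.1 ?_
  · rw [left_form_sub c.m, sub_self, sub_self, mul_zero, mul_zero, add_zero, zero_add]
    exact mul_nonpos_of_nonneg_of_nonpos (by positivity) hd0
  · rw [right_form_sub c.m, sub_self, sub_self, mul_zero, add_zero, zero_add]
    refine mul_nonpos_of_nonneg_of_nonpos ?_ hd0
    have h1 := c.le_N
    have h2 := rho_le (c := c) h1j
    exact_mod_cast (by omega : 0 ≤ c.N - c.rho j)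

theorem left_apex : (c.left c.m).form (c.apex c.m) = (c.left c.m).c := by
  refine sub_eq_zero.1 ?_
  rw [left_form_sub c.m]; simp

/-- The apex of the last level is the only highest point. -/
theorem eq_apex_of_le {r : Fin 2 → ℝ} (hr : c.Under r) (h : c.apex c.m 1 ≤ r 1) :
    r = c.apex c.m := by
  have h1 := sub_nonpos.2 (hr.left c.one_le_m le_rfl)
  have h2 := sub_nonpos.2 (hr.right c.one_le_m le_rfl)
  rw [left_form_sub c.m, sub_self, Int.cast_zero, mul_zero, add_zero] at h1
  rw [right_form_sub c.m, sub_self, Int.cast_zero, mul_zero, add_zero] at h2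
  have hK : (0 : ℝ) < c.K := by exact_mod_cast c.K_pos
  have hρ : (c.rho c.m : ℝ) = 1 := by
    have : c.rho c.m = 1 := by unfold rho; ring
    exact_mod_cast this
  have hm : (0 : ℝ) ≤ c.m := Nat.cast_nonneg _
  rw [hρ, one_mul] at h2
  have hx : r 0 - c.apex c.m 0 = 0 := by
    have h3 : r 0 - c.apex c.m 0 ≤ 0 := by linarith
    have h4 : 0 ≤ (c.m : ℝ) * (r 1 - c.apex c.m 1) := mul_nonneg hm (by linarith)
    have h5 : 0 ≤ r 0 - c.apex c.m 0 := by
      refine nonneg_of_mul_nonneg_right (a := (c.K : ℝ)) ?_ hK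
      linarith
    linarith
  ext j
  fin_cases j
  · exact sub_eq_zero.1 hx
  · change r 1 = c.apex c.m 1
    linarith

/-- A point on one of the chains is high up. -/
theorem lt_of_tight {r : Fin 2 → ℝ} {W : ℝ} (hW : c.U ≤ W) (h0 : 0 ≤ r 0) (h0W : r 0 ≤ W)
    {R : HalfPlane} (hR : R ∈ c.rows) (ht : R.form r = R.c) :
    (c.h * c.U : ℤ) - c.N * W < r 1 := by
  obtain ⟨j, h1j, hj, rfl | rfl⟩ := c.mem_rows.1 hR
  all_goals
    have hd : 32 * ((c.K : ℝ) * c.del j) ≤ c.U := by exact_mod_cast c.del_le_U hj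
    have hd0 : (0 : ℝ) ≤ c.del j := by exact_mod_cast c.del_nonneg j
    have hU : (0 : ℝ) < c.U := by exact_mod_cast c.U_pos
    have hK : (32 : ℝ) ≤ c.K := by
      have h1 := c.four_N_le_K
      have h2 := c.eight_le_N
      exact_mod_cast (by linarith : (32 : ℤ) ≤ c.K)
    have hj1 : (1 : ℝ) ≤ j := by exact_mod_cast h1j
    have hN : (8 : ℝ) ≤ c.N := by exact_mod_cast c.eight_le_N
    have hjN : 4 * ((j : ℝ) * c.N) ≤ c.K := by exact_mod_cast c.mN_le_K hj
    push_cast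
  · simp only [HalfPlane.form, left] at ht
    push_cast at ht
    by_contra hcon
    push Not at hcon
    have e1 : (j : ℝ) * r 1 ≤ j * (c.h * c.U - c.N * W) :=
      mul_le_mul_of_nonneg_left hcon (by linarith)
    have e2 : 0 ≤ (c.K : ℝ) * r 0 := by positivity
    have e3 : (j * c.N) * (c.del j : ℝ) ≤ c.K * c.del j :=
      mul_le_mul_of_nonneg_right (by nlinarith) hd0
    have e4 : (8 : ℝ) * W ≤ j * c.N * W := mul_le_mul_of_nonneg_right (by nlinarith) (by linarith)
    linarith
  · simp only [HalfPlane.form, right] at ht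
    push_cast at ht
    have hρ : (1 : ℝ) ≤ c.rho j := by exact_mod_cast rho_nonneg hj
    have hρN : (c.rho j : ℝ) < c.N := by
      have h1 := c.le_N
      have h2 := rho_le (c := c) h1j
      exact_mod_cast (by omega : c.rho j < c.N)
    have e1 : (c.rho j : ℝ) * r 0 ≤ c.rho j * W := mul_le_mul_of_nonneg_left h0W (by linarith)
    have e2 : (c.N - c.rho j : ℝ) * c.del j < (c.N - c.rho j) * W :=
      mul_lt_mul_of_pos_left (by nlinarith) (by linarith)
    linarith

/-- The line through the apexes meets the chains in the optimum only. -/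
theorem eq_apex_of_tight {r : Fin 2 → ℝ} (hr : c.Under r)
    {R : HalfPlane} (hR : R ∈ c.rows) (ht : R.form r = R.c)
    (hline : c.N * r 0 + r 1 = (c.h * c.U : ℤ)) : r = c.apex c.m := by
  have key : ∃ j, j ≤ c.m ∧ r = c.apex j := by
    obtain ⟨j, h1j, hj, rfl | rfl⟩ := c.mem_rows.1 hR
    all_goals
      refine ⟨j, hj, ?_⟩
      push_cast at hline
      have h0 : r 0 = c.del j := by
        simp only [HalfPlane.form, left, right] at ht
        push_cast at ht
        first
        | have hne : (c.K + j * c.N : ℝ) ≠ 0 := by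
            have hK : (0 : ℝ) < c.K := by exact_mod_cast c.K_pos
            have hN : (8 : ℝ) ≤ c.N := by exact_mod_cast c.eight_le_N
            positivity
          refine sub_eq_zero.1 ((mul_eq_zero.1 (?_ : (c.K + j * c.N : ℝ) * _ = 0)).resolve_left hne)
          linear_combination (j : ℝ) * hline - ht
        | have hne : (c.N - c.rho j : ℝ) ≠ 0 := by
            have h1 := c.le_N
            have h2 := rho_le (c := c) h1j
            have : (0 : ℝ) < c.N - c.rho j := by exact_mod_cast (by omega : 0 < c.N - c.rho j)
            exact this.ne'
          refine sub_eq_zero.1 ((mul_eq_zero.1 (?_ : (c.N - c.rho j : ℝ) * _ = 0)).resolve_left hne)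
          linear_combination hline - ht
      ext k
      fin_cases k
      · exact h0
      · simp only [apex, Matrix.cons_val_one, Matrix.cons_val_fin_one, Fin.mk_one]
        push_cast
        rw [h0] at hline
        linarith
  obtain ⟨j, hj, rfl⟩ := key
  rcases Nat.lt_or_ge j c.m with h | h
  · exact absurd hr (apex_not_under h)
  · rw [le_antisymm hj h]

theorem mem_rows_left {j : ℕ} (h1 : 1 ≤ j) (hj : j ≤ c.m) : c.left j ∈ c.rows :=
  c.mem_rows.2 ⟨j, h1, hj, Or.inl rfl⟩

/-- The corner of size `U` in which all witnesses for the non-redundancy of the chains lie. -/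
def Corner (c : Chain) (r : Fin 2 → ℝ) : Prop :=
  0 ≤ r 0 ∧ r 0 ≤ c.U ∧ (c.h * c.U : ℤ) - c.U ≤ r 1 ∧ r 1 ≤ (c.h * c.U : ℤ)

theorem apex_corner : c.Corner (c.apex c.m) := by
  have hd : 32 * ((c.K : ℝ) * c.del c.m) ≤ c.U := by exact_mod_cast c.del_le_U le_rfl
  have hd0 : (0 : ℝ) ≤ c.del c.m := by exact_mod_cast c.del_nonneg _
  have hK : (1 : ℝ) ≤ c.K := by exact_mod_cast c.K_pos
  have hNK : 4 * (c.N : ℝ) ≤ c.K := by exact_mod_cast c.four_N_le_K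
  have hN : (8 : ℝ) ≤ c.N := by exact_mod_cast c.eight_le_N
  have h1 : (c.N : ℝ) * c.del c.m ≤ c.K * c.del c.m := mul_le_mul_of_nonneg_right (by linarith) hd0
  have h2 : 1 * (c.del c.m : ℝ) ≤ c.K * c.del c.m := mul_le_mul_of_nonneg_right hK hd0
  have h3 : 0 ≤ (c.N : ℝ) * c.del c.m := by positivity
  refine ⟨hd0, ?_, ?_, ?_⟩
  · change (c.del c.m : ℝ) ≤ c.U
    linarith
  all_goals
    simp only [apex, Matrix.cons_val_one, Matrix.cons_val_fin_one]
    push_cast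
    linarith

theorem le_del_sub_of_lt {j l : ℕ} (hlj : l < j) :
    (c.eps j : ℝ) ≤ -((c.del l - c.del j : ℤ) : ℝ) := by
  have h1 := c.eps_le_del_sub hlj
  have h2 := c.eps_le_eps (show l + 1 ≤ j from hlj)
  have : c.eps j ≤ -(c.del l - c.del j) := by linarith
  exact_mod_cast this

theorem del_sub_le_of_lt {j l : ℕ} (hl : l ≤ c.m) (hjl : j < l) :
    4 * (c.K * ((c.del l - c.del j : ℤ) : ℝ)) ≤ c.eps j ∧ 64 * (c.K : ℝ) ≤ c.eps j := by
  have h1 := c.del_sub_le hjl hl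
  have h2 := c.eps_eq (show j < c.m by omega)
  have h3 := c.K_le_β
  have h4 := c.eps_pos (j + 1)
  have h5 := c.K_pos
  have h6 : 64 * c.K * c.eps (j + 1) ≤ c.β * c.eps (j + 1) :=
    mul_le_mul_of_nonneg_right h3 h4.le
  have h7 : (4 * (c.del l - c.del j)) * c.K ≤ 5 * c.eps (j + 1) * c.K :=
    mul_le_mul_of_nonneg_right h1 h5.le
  have h8 : c.K * 1 ≤ c.K * c.eps (j + 1) := mul_le_mul_of_nonneg_left h4 h5.le
  constructor
  · exact_mod_cast (by linarith : 4 * (c.K * (c.del l - c.del j)) ≤ c.eps j)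
  · exact_mod_cast (by linarith : 64 * c.K ≤ c.eps j)

theorem cast_del_sub_nonneg {j l : ℕ} (h : j ≤ l) : (0 : ℝ) ≤ ((c.del l - c.del j : ℤ) : ℝ) := by
  exact_mod_cast sub_nonneg.2 (c.del_mono h)

theorem cast_del_sub_nonpos {j l : ℕ} (h : l ≤ j) : ((c.del l - c.del j : ℤ) : ℝ) ≤ 0 := by
  exact_mod_cast sub_nonpos.2 (c.del_mono h)

/-- A left edge can be violated alone: push a point in its interior outwards. -/
theorem exists_violating_left {j : ℕ} (h1j : 1 ≤ j) (hj : j ≤ c.m) :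
    ∃ r, c.Corner r ∧ (∀ R ∈ c.rows, R ≠ c.left j → R.Holds r) ∧ ¬ (c.left j).Holds r := by
  have hm : (1 : ℝ) ≤ c.m := by exact_mod_cast c.one_le_m
  have hK : (32 : ℝ) * c.m ≤ c.K := by exact_mod_cast c.m_le_K
  have hN : (8 : ℝ) ≤ c.N := by exact_mod_cast c.eight_le_N
  have hNK : 4 * (c.N : ℝ) ≤ c.K := by exact_mod_cast c.four_N_le_K
  have hj1 : (1 : ℝ) ≤ j := by exact_mod_cast h1j
  have hjm : (j : ℝ) ≤ c.m := by exact_mod_cast hj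
  have he : (1 : ℝ) ≤ c.eps j := by exact_mod_cast c.eps_pos j
  have he1 : (c.eps j : ℝ) ≤ c.eps 1 := by exact_mod_cast c.eps_le_eps h1j
  have hd : 32 * ((c.K : ℝ) * c.del j) ≤ c.U := by exact_mod_cast c.del_le_U hj
  have hde : (c.eps j : ℝ) ≤ c.del j := by
    have := c.eps_le_del_sub (show j - 1 < j by omega)
    rw [Nat.sub_add_cancel h1j] at this
    have h2 := c.del_nonneg (j - 1)
    exact_mod_cast (by linarith : c.eps j ≤ c.del j)
  -- The point lies halfway between the apex and the previous edge, up to a factor `m`.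
  obtain ⟨u, hu⟩ : ∃ u : ℝ, u = c.eps j / (2 * c.m) := ⟨_, rfl⟩
  have hum : u * (2 * c.m) = c.eps j := by rw [hu]; field_simp
  have hu0 : 0 < u := by rw [hu]; positivity
  have huK : 16 * (c.eps j : ℝ) ≤ u * c.K := by nlinarith
  have huj : u * j ≤ c.eps j / 2 := by nlinarith
  have huK' : u * c.K ≤ c.K * c.eps j := by
    have : u ≤ c.eps j := by nlinarith
    rw [mul_comm]; exact mul_le_mul_of_nonneg_left this (by linarith)
  set r : Fin 2 → ℝ := ![c.apex j 0 - u * j, c.apex j 1 - u * c.K + 1] with hr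
  have hr0 : r 0 - c.apex j 0 = -(u * j) := by simp [hr]
  have hr1 : r 1 - c.apex j 1 = -(u * c.K) + 1 := by simp [hr]; ring
  have ha0 : c.apex j 0 = c.del j := rfl
  have ha1 : c.apex j 1 = c.h * c.U - c.N * c.del j := by simp [apex]
  refine ⟨r, ⟨?_, ?_, ?_, ?_⟩, ?_, ?_⟩
  · linarith
  · have : (1 : ℝ) * c.del j ≤ c.K * c.del j := mul_le_mul_of_nonneg_right (by linarith) (by linarith)
    have : 0 ≤ u * j := by positivity
    nlinarith
  · push_cast
    have h1 : c.K * (c.eps j : ℝ) ≤ c.K * c.del j := mul_le_mul_of_nonneg_left hde (by linarith)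
    have h2 : (c.N : ℝ) * c.del j ≤ c.K * c.del j :=
      mul_le_mul_of_nonneg_right (by linarith) (by linarith)
    have h3 : (0 : ℝ) ≤ c.K * c.del j := mul_nonneg (by linarith) (by linarith)
    linarith
  · push_cast
    have h2 : 0 ≤ (c.N : ℝ) * c.del j := mul_nonneg (by linarith) (by linarith)
    linarith
  · intro R hR hne
    obtain ⟨l, h1l, hl, rfl | rfl⟩ := c.mem_rows.1 hR
    · have hlj : l ≠ j := fun h => hne (h ▸ rfl)
      refine sub_nonpos.1 ?_
      rw [left_form_sub j, hr0, hr1]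
      have hlm : (l : ℝ) ≤ c.m := by exact_mod_cast hl
      have hl0 : (0 : ℝ) ≤ l := Nat.cast_nonneg l
      have hlN : 4 * ((l : ℝ) * c.N) ≤ c.K := by exact_mod_cast c.mN_le_K hl
      have hlN0 : 0 ≤ (l : ℝ) * c.N := mul_nonneg hl0 (by linarith)
      rcases lt_or_gt_of_ne hlj with h | h
      · have hg := le_del_sub_of_lt (c := c) h
        set g := ((c.del l - c.del j : ℤ) : ℝ)
        have h1 : (c.K + l * c.N) * g ≤ c.K * (-(c.eps j : ℝ)) := by nlinarith
        have h2 : u * c.K * (j - l) ≤ c.K * c.eps j / 2 := by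
          have h4 : u * c.K * (j - l) ≤ u * c.K * c.m :=
            mul_le_mul_of_nonneg_left (by linarith) (by nlinarith)
          have h5 : c.K * (u * (2 * c.m)) = c.K * c.eps j := by rw [hum]
          linarith
        have h3 : (c.K : ℝ) ≤ c.K * c.eps j := le_mul_of_one_le_right (by linarith) he
        linarith
      · obtain ⟨hg, hKe⟩ := del_sub_le_of_lt hl h
        have hg0 := cast_del_sub_nonneg (c := c) h.le
        set g := ((c.del l - c.del j : ℤ) : ℝ)
        have hlj' : (1 : ℝ) ≤ l - j := by
          have : (j : ℝ) + 1 ≤ l := by exact_mod_cast h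
          linarith
        have h1 : (c.K + l * c.N) * g ≤ 2 * c.K * g :=
          mul_le_mul_of_nonneg_right (by linarith) hg0
        have h2 : u * c.K * 1 ≤ u * c.K * (l - j) := mul_le_mul_of_nonneg_left hlj' (by linarith)
        linarith
    · refine sub_nonpos.1 ?_
      rw [right_form_sub j, hr0, hr1]
      have hρ : (1 : ℝ) ≤ c.rho l := by exact_mod_cast rho_nonneg hl
      have hρN : (c.rho l : ℝ) ≤ c.N := by
        have h1 := c.le_N
        have h2 := rho_le (c := c) h1l
        exact_mod_cast (by omega : c.rho l ≤ c.N)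
      have h1 : 0 ≤ (c.rho l : ℝ) * (u * j) := mul_nonneg (by linarith) (by positivity)
      rcases Nat.lt_or_ge j l with h | h
      · obtain ⟨hg, -⟩ := del_sub_le_of_lt hl h
        have hg0 := cast_del_sub_nonneg (c := c) h.le
        set g := ((c.del l - c.del j : ℤ) : ℝ)
        have h2 : (c.N - c.rho l) * g ≤ c.K * g := mul_le_mul_of_nonneg_right (by linarith) hg0
        linarith
      · have hg0 := cast_del_sub_nonpos (c := c) h
        have h2 : (c.N - c.rho l : ℝ) * ((c.del l - c.del j : ℤ) : ℝ) ≤ 0 :=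
          mul_nonpos_of_nonneg_of_nonpos (by linarith) hg0
        linarith
  · intro hcon
    have h1 := sub_nonpos.2 hcon
    rw [left_form_sub j, hr0, hr1, sub_self, Int.cast_zero, mul_zero, add_zero] at h1
    linarith

/-- A right edge can be violated alone: push a point in its interior outwards. -/
theorem exists_violating_right {j : ℕ} (h1j : 1 ≤ j) (hj : j ≤ c.m) :
    ∃ r, c.Corner r ∧ (∀ R ∈ c.rows, R ≠ c.right j → R.Holds r) ∧ ¬ (c.right j).Holds r := by
  have hm : (1 : ℝ) ≤ c.m := by exact_mod_cast c.one_le_m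
  have hK : (32 : ℝ) * c.m ≤ c.K := by exact_mod_cast c.m_le_K
  have hN : (8 : ℝ) ≤ c.N := by exact_mod_cast c.eight_le_N
  have hNm : 4 * (c.m : ℝ) + 4 ≤ c.N := by exact_mod_cast c.le_N
  have hNK : 4 * (c.N : ℝ) ≤ c.K := by exact_mod_cast c.four_N_le_K
  have he : (1 : ℝ) ≤ c.eps j := by exact_mod_cast c.eps_pos j
  have hd : 32 * ((c.K : ℝ) * c.del j) ≤ c.U := by exact_mod_cast c.del_le_U hj
  have hde : (c.eps j : ℝ) ≤ c.del j := by
    have := c.eps_le_del_sub (show j - 1 < j by omega)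
    rw [Nat.sub_add_cancel h1j] at this
    have h2 := c.del_nonneg (j - 1)
    exact_mod_cast (by linarith : c.eps j ≤ c.del j)
  have hρj : (1 : ℝ) ≤ c.rho j := by exact_mod_cast rho_nonneg hj
  have hρm : (c.rho j : ℝ) ≤ c.m := by exact_mod_cast rho_le h1j
  have h1d : (1 : ℝ) * c.del j ≤ c.K * c.del j :=
    mul_le_mul_of_nonneg_right (by linarith) (by linarith)
  have hρe : (c.rho j : ℝ) * c.eps j ≤ c.K * c.del j :=
    mul_le_mul (by linarith) hde (by linarith) (by linarith)
  have hρe1 : (c.eps j : ℝ) ≤ c.rho j * c.eps j := le_mul_of_one_le_left (by linarith) hρj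
  have hNd : (c.N : ℝ) * c.del j ≤ c.K * c.del j :=
    mul_le_mul_of_nonneg_right (by linarith) (by linarith)
  have hNd0 : 0 ≤ (c.N : ℝ) * c.del j := mul_nonneg (by linarith) (by linarith)
  set r : Fin 2 → ℝ := ![c.apex j 0 + 2 * c.eps j, c.apex j 1 - 2 * (c.rho j * c.eps j) + 1] with hr
  have hr0 : r 0 - c.apex j 0 = 2 * c.eps j := by simp [hr]
  have hr1 : r 1 - c.apex j 1 = -(2 * (c.rho j * c.eps j)) + 1 := by simp [hr]; ring
  have ha0 : c.apex j 0 = c.del j := rfl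
  have ha1 : c.apex j 1 = c.h * c.U - c.N * c.del j := by simp [apex]
  refine ⟨r, ⟨?_, ?_, ?_, ?_⟩, ?_, ?_⟩
  · linarith
  · linarith
  · push_cast; linarith
  · push_cast; linarith
  · intro R hR hne
    obtain ⟨l, h1l, hl, rfl | rfl⟩ := c.mem_rows.1 hR
    · refine sub_nonpos.1 ?_
      rw [left_form_sub j, hr0, hr1]
      have hlm : (l : ℝ) ≤ c.m := by exact_mod_cast hl
      have hl0 : (0 : ℝ) ≤ l := Nat.cast_nonneg l
      have hlN : 4 * ((l : ℝ) * c.N) ≤ c.K := by exact_mod_cast c.mN_le_K hl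
      have hlN0 : 0 ≤ (l : ℝ) * c.N := mul_nonneg hl0 (by linarith)
      have h1 : (c.K : ℝ) * 1 ≤ c.K * c.eps j := mul_le_mul_of_nonneg_left he (by linarith)
      have h2 : 0 ≤ (l : ℝ) * (c.rho j * c.eps j) := mul_nonneg hl0 (by linarith)
      rcases Nat.lt_or_ge j l with h | h
      · obtain ⟨hg, -⟩ := del_sub_le_of_lt hl h
        have hg0 := cast_del_sub_nonneg (c := c) h.le
        set g := ((c.del l - c.del j : ℤ) : ℝ)
        have h3 : (c.K + l * c.N) * g ≤ 2 * c.K * g :=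
          mul_le_mul_of_nonneg_right (by linarith) hg0
        have h4 : (1 : ℝ) * c.eps j ≤ c.K * c.eps j :=
          mul_le_mul_of_nonneg_right (by linarith) (by linarith)
        linarith
      · have hg0 := cast_del_sub_nonpos (c := c) h
        have h3 : (c.K + l * c.N : ℝ) * ((c.del l - c.del j : ℤ) : ℝ) ≤ 0 :=
          mul_nonpos_of_nonneg_of_nonpos (by linarith) hg0
        linarith
    · have hlj : l ≠ j := fun h => hne (h ▸ rfl)
      refine sub_nonpos.1 ?_
      rw [right_form_sub j, hr0, hr1]
      have hρ : (1 : ℝ) ≤ c.rho l := by exact_mod_cast rho_nonneg hl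
      have hρl : (c.rho l : ℝ) ≤ c.m := by exact_mod_cast rho_le h1l
      have hsub : (c.rho l : ℝ) = c.rho j + (j - l) := by
        have : c.rho l = c.rho j + (j - l) := by unfold rho; ring
        exact_mod_cast this
      have hslope : c.rho l * (2 * (c.eps j : ℝ)) + (-(2 * (c.rho j * c.eps j)) + 1) =
          2 * ((j - l) * c.eps j) + 1 := by rw [hsub]; ring
      rw [hslope]
      rcases lt_or_gt_of_ne hlj with h | h
      · have hg := le_del_sub_of_lt (c := c) h
        set g := ((c.del l - c.del j : ℤ) : ℝ)
        have hjm : (j : ℝ) ≤ c.m := by exact_mod_cast hj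
        have hl1 : (1 : ℝ) ≤ l := by exact_mod_cast h1l
        have h1 : (c.N - c.rho l : ℝ) * c.eps j ≤ (c.N - c.rho l) * -g :=
          mul_le_mul_of_nonneg_left hg (by linarith)
        have h2 : (3 * c.m + 4 : ℝ) * c.eps j ≤ (c.N - c.rho l) * c.eps j :=
          mul_le_mul_of_nonneg_right (by linarith) (by linarith)
        have h3 : ((j : ℝ) - l) * c.eps j ≤ c.m * c.eps j :=
          mul_le_mul_of_nonneg_right (by linarith) (by linarith)
        have h4 : 0 ≤ (c.m : ℝ) * c.eps j := by nlinarith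
        linarith
      · obtain ⟨hg, hKe⟩ := del_sub_le_of_lt hl h
        have hg0 := cast_del_sub_nonneg (c := c) h.le
        set g := ((c.del l - c.del j : ℤ) : ℝ)
        have hlj' : (1 : ℝ) ≤ l - j := by
          have : (j : ℝ) + 1 ≤ l := by exact_mod_cast h
          linarith
        have h1 : (c.N - c.rho l) * g ≤ c.K * g := mul_le_mul_of_nonneg_right (by linarith) hg0
        have h2 : 1 * (c.eps j : ℝ) ≤ (l - j) * c.eps j :=
          mul_le_mul_of_nonneg_right hlj' (by linarith)
        linarith
  · intro hcon
    have h1 := sub_nonpos.2 hcon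
    rw [right_form_sub j, hr0, hr1, sub_self, Int.cast_zero, mul_zero, add_zero] at h1
    linarith

theorem rows_nodup : c.rows.Nodup := by
  rw [rows, List.nodup_flatMap]
  have hK := c.K_pos
  constructor
  · intro j hj
    have hj := List.mem_range.1 hj
    have h1 := rho_nonneg (c := c) (show c.m - j ≤ c.m by omega)
    simp only [List.nodup_cons, List.mem_singleton, List.not_mem_nil, not_false_eq_true,
      List.nodup_nil, and_true]
    intro h
    have := congrArg HalfPlane.a h
    simp only [left, right] at this
    omega
  · refine List.nodup_range.pairwise_of_forall_ne ?_
    intro i hi j hj hij R hRi hRj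
    have hi := List.mem_range.1 hi
    have hj := List.mem_range.1 hj
    simp only [List.mem_cons, List.not_mem_nil, or_false] at hRi hRj
    have h1 := rho_nonneg (c := c) (show c.m - j ≤ c.m by omega)
    have h2 := rho_nonneg (c := c) (show c.m - i ≤ c.m by omega)
    rcases hRi with rfl | rfl <;> rcases hRj with h | h
    · have := congrArg HalfPlane.b h
      simp only [left] at this
      omega
    · have := congrArg HalfPlane.a h
      simp only [left, right] at this
      omega
    · have := congrArg HalfPlane.a h
      simp only [left, right] at this
      omega
    · have := congrArg HalfPlane.a h
      simp only [right, rho] at this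
      omega

theorem rows_length : c.rows.length = 2 * c.m := by
  simp [rows, List.length_flatMap, mul_comm]

end Chain

end CircuitWalks

namespace CircuitWalks

/-! ### Polygons with a prescribed base below the two chains -/

section OfRows

variable {rows : List HalfPlane} {s c : Fin 2 → ℚ}

/-- A sequence of circuit moves bounds the monotone circuit distance from above. -/
theorem dist_le_of_sequence {k : ℕ} (f : ℕ → Fin 2 → ℝ)
    (h0 : f 0 = (PlanarData.ofRows rows s c).realS)
    (hP : ∀ i ≤ k, f i ∈ (PlanarData.ofRows rows s c).P)
    (hmove : ∀ i < k, IsCircuitMove (PlanarData.ofRows rows s c).realA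
      (PlanarData.ofRows rows s c).realB (f i) (f (i + 1)))
    (hmono : ∀ i < k, (PlanarData.ofRows rows s c).realC ⬝ᵥ f i <
      (PlanarData.ofRows rows s c).realC ⬝ᵥ f (i + 1))
    (hmax : IsMaxOn (fun y => (PlanarData.ofRows rows s c).realC ⬝ᵥ y)
      (PlanarData.ofRows rows s c).P (f k)) :
    (PlanarData.ofRows rows s c).dist ≤ k := by
  refine sInf_le ⟨k, rfl, fun i => f i, ⟨fun i => hP i (by omega), fun i => ?_⟩, fun i => ?_, h0,
    hmax⟩
  · exact hmove i i.2
  · exact hmono i i.2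

/-- The cost vector `(0, 1)`. -/
def heightCost : Fin 2 → ℚ := ![0, 1]

theorem realC_heightCost (x : Fin 2 → ℝ) :
    (PlanarData.ofRows rows s heightCost).realC ⬝ᵥ x = x 1 := by
  simp [PlanarData.realC, heightCost, dotProduct, Fin.sum_univ_two]

end OfRows

namespace Chain

variable {c : Chain} {base : List HalfPlane}

theorem Under.add_le {r : Fin 2 → ℝ} (hr : c.Under r) : r 0 + r 1 ≤ (c.h * c.U : ℤ) := by
  have h := hr.right c.one_le_m le_rfl
  have hρ : c.rho c.m = 1 := by unfold rho; ring
  simp only [HalfPlane.form, Chain.right, hρ] at h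
  have h1 : (0 : ℝ) ≤ (((c.N - 1) * c.del c.m : ℤ) : ℝ) := by
    have h2 := c.eight_le_N
    have h3 := c.del_nonneg c.m
    exact_mod_cast mul_nonneg (by linarith) h3
  push_cast at h h1 ⊢
  linarith

/-- The polygon cut out by a base and the two chains. -/
theorem describesPolygon {s t : Fin 2 → ℚ} (hnd : base.Nodup) (hdisj : ∀ R ∈ base, R ∉ c.rows)
    (hb : ∃ B : ℝ, ∀ r : Fin 2 → ℝ, (∀ R ∈ base, R.Holds r) → c.Under r → |r 0| ≤ B ∧ |r 1| ≤ B)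
    (hint : ∃ r : Fin 2 → ℝ, (∀ R ∈ base, R.form r < R.c) ∧ c.Under ![r 0, r 1 + 1])
    (hcorner : ∀ r, c.Corner r → ∀ R ∈ base, R.Holds r)
    (hwit : ∀ R ∈ base, ∃ r, c.Under r ∧ (∀ R' ∈ base, R' ≠ R → R'.Holds r) ∧ ¬ R.Holds r) :
    (PlanarData.ofRows (base ++ c.rows) s t).DescribesPolygon := by
  refine describesPolygon_of (List.nodup_append.2 ⟨hnd, rows_nodup, ?_⟩) ?_ ?_ ?_
  · rintro R hR _ hR' rfl
    exact hdisj R hR hR'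
  · obtain ⟨B, hB⟩ := hb
    exact ⟨B, fun r hr => hB r (fun R hR => hr R (List.mem_append_left _ hR))
      fun R hR => hr R (List.mem_append_right _ hR)⟩
  · obtain ⟨r, h1, h2⟩ := hint
    refine ⟨r, fun R hR => ?_⟩
    rcases List.mem_append.1 hR with h | h
    · exact h1 R h
    · have h3 := h2 R h
      have hb : (1 : ℝ) ≤ R.b := by
        obtain ⟨j, h1j, -, rfl | rfl⟩ := c.mem_rows.1 h
        · simp only [left]; exact_mod_cast h1j
        · simp [right]
      simp only [HalfPlane.Holds, HalfPlane.form, Matrix.cons_val_zero, Matrix.cons_val_one,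
        Matrix.cons_val_fin_one] at h3 ⊢
      linarith
  · intro R hR
    rcases List.mem_append.1 hR with h | h
    · obtain ⟨r, h1, h2, h3⟩ := hwit R h
      refine ⟨r, fun R' hR' hne => ?_, h3⟩
      rcases List.mem_append.1 hR' with h' | h'
      · exact h2 R' h' hne
      · exact h1 R' h'
    · obtain ⟨r, h1, h2, h3⟩ : ∃ r, c.Corner r ∧ (∀ R' ∈ c.rows, R' ≠ R → R'.Holds r) ∧
          ¬ R.Holds r := by
        obtain ⟨j, h1j, hj, rfl | rfl⟩ := c.mem_rows.1 h
        · exact exists_violating_left h1j hj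
        · exact exists_violating_right h1j hj
      refine ⟨r, fun R' hR' hne => ?_, h3⟩
      rcases List.mem_append.1 hR' with h' | h'
      · exact hcorner r h1 R' h'
      · exact h2 R' h' hne

theorem mem_P_append {s t : Fin 2 → ℚ} {r : Fin 2 → ℝ} :
    r ∈ (PlanarData.ofRows (base ++ c.rows) s t).P ↔ (∀ R ∈ base, R.Holds r) ∧ c.Under r := by
  rw [mem_P_iff]
  exact ⟨fun h => ⟨fun R hR => h R (List.mem_append_left _ hR),
    fun R hR => h R (List.mem_append_right _ hR)⟩,
    fun h R hR => (List.mem_append.1 hR).elim (h.1 R) (h.2 R)⟩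

theorem apex_mem_P {s t : Fin 2 → ℚ} (hcorner : ∀ r, c.Corner r → ∀ R ∈ base, R.Holds r) :
    c.apex c.m ∈ (PlanarData.ofRows (base ++ c.rows) s t).P :=
  mem_P_append.2 ⟨hcorner _ apex_corner, apex_under⟩

/-- A monotone circuit walk that never follows the line through the apexes needs more than `m`
moves. The predicate `J` may be used to control that line. -/
theorem lt_dist (hbase : ∀ R ∈ base, |R.a| ≤ c.K ∧ |R.b| ≤ c.K ∧ c.U ∣ R.c)
    (hcorner : ∀ r, c.Corner r → ∀ R ∈ base, R.Holds r)
    (J : ℕ → (Fin 2 → ℝ) → Prop) (hJ0 : J 0 0)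
    (hline : ∀ i < c.m, ∀ p ∈ (PlanarData.ofRows (base ++ c.rows) 0 heightCost).P, J i p →
      p ≠ c.apex c.m → ∀ l ∈ base ++ c.rows, l.a = c.N * l.b →
        c.N * p 0 + p 1 ≠ (c.h * c.U : ℤ))
    (hstep : ∀ i < c.m, ∀ p ∈ (PlanarData.ofRows (base ++ c.rows) 0 heightCost).P,
      ∀ r ∈ (PlanarData.ofRows (base ++ c.rows) 0 heightCost).P, J i p → p 1 < r 1 →
      ∀ l ∈ base ++ c.rows, l.form r = l.form p →
      ∀ R ∈ base ++ c.rows, R.form p < R.form r → R.form r = R.c → J (i + 1) r)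
    (h0 : (0 : Fin 2 → ℝ) ∈ (PlanarData.ofRows (base ++ c.rows) 0 heightCost).P) :
    (c.m : ℕ∞) < (PlanarData.ofRows (base ++ c.rows) 0 heightCost).dist := by
  have hs : (PlanarData.ofRows (base ++ c.rows) 0 heightCost).realS = 0 := by
    ext i; simp [PlanarData.realS]
  refine lt_dist_of_invariant
    (fun i p => p ∈ (PlanarData.ofRows (base ++ c.rows) 0 heightCost).P ∧ c.Inv i p ∧
      p ≠ c.apex c.m ∧ J i p) ?_ ?_ ?_
  · rw [hs]
    refine ⟨h0, inv_zero, fun h => ?_, hJ0⟩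
    have := congrFun h 0
    have h1 : (0 : ℝ) < c.del c.m := by
      have h2 := c.eps_le_del_sub c.one_le_m
      have h3 := c.eps_pos 1
      simp only [del_zero, sub_zero, zero_add] at h2
      exact_mod_cast (by linarith : 0 < c.del c.m)
    simp only [apex, Pi.zero_apply, Matrix.cons_val_zero] at this
    linarith
  · rintro i hi p - r hr ⟨hp, hinv, hne, hj⟩ hmove hmono
    rw [realC_heightCost, realC_heightCost] at hmono
    obtain ⟨-, ⟨l, hl, hlne, hlpr⟩, R, hR, hlt, ht⟩ := exists_rows_of_isCircuitMove hmove
    have h1 := Inv.step hbase hi (mem_P_append.1 hp).2 (mem_P_append.1 hr).2 hinv hl hR hlne hlpr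
      hlt ht (hline i hi p hp hj hne l hl)
    exact ⟨hr, h1.1, h1.2, hstep i hi p hp r hr hj hmono l hl hlpr R hR hlt ht⟩
  · rintro i - p ⟨hp, -, hne, -⟩ hmax
    have h1 := hmax (apex_mem_P hcorner)
    simp only [Set.mem_ofPred_eq, realC_heightCost] at h1
    exact hne (eq_apex_of_le (mem_P_append.1 hp).2 h1)

end Chain

/-! ### The parameters of the construction -/

/-- The sizes of an instance: the required number `m` of moves, the number `k` of summands and the
target sum `S`. -/
structure Gadget where
  m : ℕ
  k : ℕ
  S : ℕ
  one_le_m : 1 ≤ m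
  one_le_k : 1 ≤ k
  one_le_S : 1 ≤ S

namespace Gadget

/-- The slope of the moves back to the left side. -/
def N (m : ℕ) : ℤ := 4 * m + 4

/-- The slope that stands for one unit of a number of the instance. It is large enough for `M A + e`
to determine `A` as long as the error `e` has grown by at most `N` in each of `m` moves. -/
def M (m k : ℕ) : ℤ := N m * (m + k)

/-- The height of the target, in units of the width of the strip: the numbers of a solution
contribute `M S`, and the `k` moves back to the left `N` each. -/
def H (m k S : ℕ) : ℤ := M m k * S + N m * k

/-- The steepness of the left chain. -/
def K (m k S : ℕ) : ℤ := 4 * m * H m k S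

/-- The width of the polygon in units of length. -/
def w (S : ℕ) : ℤ := (S + 1) ^ 2

/-- The ratio between the sizes of consecutive edges of the chains. -/
def β (m k S : ℕ) : ℤ := (2 * K m k S ^ 2) ^ (m + 4)

variable (G : Gadget)

theorem N_pos : 8 ≤ N G.m := by
  have := G.one_le_m
  unfold N
  omega

theorem N_le_H : N G.m ≤ H G.m G.k G.S := by
  have h1 := G.N_pos
  have h2 : (1 : ℤ) ≤ G.k := by exact_mod_cast G.one_le_k
  unfold H M
  have : (0 : ℤ) ≤ N G.m * (G.m + G.k) * G.S := by positivity
  nlinarith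

/-- The chains of the construction. -/
def chain : Chain where
  m := G.m
  N := N G.m
  K := K G.m G.k G.S
  h := H G.m G.k G.S * w G.S
  β := β G.m G.k G.S
  one_le_m := G.one_le_m
  le_N := le_rfl
  le_K := mul_le_mul_of_nonneg_left G.N_le_H (by positivity)
  β_eq := rfl

/-- The unit of length. -/
def U (m k S : ℕ) : ℤ := β m k S ^ m

/-- The side `0 ≤ x`. -/
def leftRow : HalfPlane := ⟨-1, 0, 0⟩

/-- The bottom, parallel to the moves back to the left side. -/
def bottomRow (m : ℕ) : HalfPlane := ⟨-N m, -1, 0⟩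

/-- The right side, parallel to the left one. -/
def rightRow (m k S : ℕ) : HalfPlane := ⟨1, 0, w S * U m k S⟩

/-- The edge whose slope encodes the number `a`; these edges are tangents of a parabola. -/
def itemRow (m k S a : ℕ) : HalfPlane :=
  ⟨M m k * a, -1, M m k * a * (w S + a - 2 * S) * U m k S⟩

/-- The base of the strip: both sides, the bottom and one edge for each number. -/
def stripBase (m k S : ℕ) (items : List ℕ) : List HalfPlane :=
  leftRow :: bottomRow m :: rightRow m k S :: items.map (itemRow m k S)

/-- The base of the wedge, which does not encode any number. -/
def wedgeBase : List HalfPlane := [leftRow, ⟨0, -1, 0⟩]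

variable {G}

theorem mem_stripBase {m k S : ℕ} {items : List ℕ} {R : HalfPlane} :
    R ∈ stripBase m k S items ↔ R = leftRow ∨ R = bottomRow m ∨ R = rightRow m k S ∨
      ∃ a ∈ items, R = itemRow m k S a := by
  simp [stripBase, eq_comm]

end Gadget

end CircuitWalks

/-! ### The strip -/

namespace CircuitWalks

namespace Gadget

variable {G : Gadget} {items : List ℕ}

@[simp] theorem chain_m : G.chain.m = G.m := rfl

@[simp] theorem chain_N : G.chain.N = N G.m := rfl

@[simp] theorem chain_K : G.chain.K = K G.m G.k G.S := rfl

@[simp] theorem chain_U : G.chain.U = U G.m G.k G.S := rfl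

@[simp] theorem chain_h : G.chain.h = H G.m G.k G.S * w G.S := rfl

/-- The inequalities between the parameters, over the reals. -/
structure RealBounds (m k S N M H K w U : ℝ) : Prop where
  m_pos : 1 ≤ m
  k_pos : 1 ≤ k
  S_pos : 1 ≤ S
  N_pos : 8 ≤ N
  M_pos : N ≤ M
  U_pos : 64 * K ≤ U
  H_eq : H = M * S + N * k
  K_eq : K = 4 * m * H
  w_eq : w = (S + 1) ^ 2

theorem realBounds (G : Gadget) : RealBounds G.m G.k G.S (N G.m : ℤ) (M G.m G.k : ℤ)
    (H G.m G.k G.S : ℤ) (K G.m G.k G.S : ℤ) (w G.S : ℤ) (U G.m G.k G.S : ℤ) where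
  m_pos := by exact_mod_cast G.one_le_m
  k_pos := by exact_mod_cast G.one_le_k
  S_pos := by exact_mod_cast G.one_le_S
  N_pos := by exact_mod_cast G.N_pos
  M_pos := by
    have h1 := G.N_pos
    have h2 : (1 : ℤ) ≤ G.k := by exact_mod_cast G.one_le_k
    have h3 : N G.m ≤ M G.m G.k := le_mul_of_one_le_right (by linarith) (by omega)
    exact_mod_cast h3
  U_pos := by
    have h1 := G.chain.K_le_β
    have h2 := G.chain.U_eq
    have h3 := G.chain.eps_pos 1
    have h4 := G.chain.β_pos
    have : 64 * G.chain.K ≤ G.chain.U := by nlinarith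
    exact_mod_cast this
  H_eq := by simp [H]
  K_eq := by simp [K]
  w_eq := by simp [w]

namespace RealBounds

variable {m k S N M H K w U : ℝ}

theorem le_H (h : RealBounds m k S N M H K w U) : M * S + N ≤ H := by
  have := h.H_eq; have := h.k_pos; have := h.N_pos; nlinarith

theorem U_one (h : RealBounds m k S N M H K w U) : 2048 ≤ U := by
  have h1 := h.le_H; have h2 := h.N_pos; have h3 := h.M_pos; have h4 := h.S_pos
  have h5 := h.K_eq; have h6 := h.m_pos; have h7 := h.U_pos
  have h8 : 0 ≤ M * S := by nlinarith
  nlinarith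

theorem w_ge (h : RealBounds m k S N M H K w U) : S ^ 2 + 1 + 2 * S = w := by
  rw [h.w_eq]; ring

theorem low (h : RealBounds m k S N M H K w U) :
    M * S * (w * U) ≤ H * w * U - N * (w * U) := by
  have h1 := h.le_H; have h2 := h.U_one; have h3 := h.w_ge; have := h.S_pos
  have : 0 ≤ w * U := by nlinarith
  nlinarith

theorem U_le (h : RealBounds m k S N M H K w U) : U ≤ w * U := by
  have h2 := h.U_one; have h3 := h.w_ge; have := h.S_pos
  nlinarith

/-- The right-hand side of an item row is nonnegative. -/
theorem item_nonneg (h : RealBounds m k S N M H K w U) {a : ℝ} (ha : 1 ≤ a) :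
    0 ≤ M * a * (w + a - 2 * S) * U := by
  have h2 := h.U_one; have h3 := h.w_ge; have h4 := h.N_pos; have h5 := h.M_pos
  have : 0 ≤ w + a - 2 * S := by nlinarith [sq_nonneg S]
  have : 0 ≤ M * a := by nlinarith
  positivity

end RealBounds

theorem forall_stripBase {m k S : ℕ} {P : HalfPlane → Prop} (h1 : P leftRow) (h2 : P (bottomRow m))
    (h3 : P (rightRow m k S)) (h4 : ∀ a ∈ items, P (itemRow m k S a)) :
    ∀ R ∈ stripBase m k S items, P R := by
  intro R hR
  rcases mem_stripBase.1 hR with rfl | rfl | rfl | ⟨a, ha, rfl⟩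
  · exact h1
  · exact h2
  · exact h3
  · exact h4 a ha

/-- The numbers that occur as slopes. -/
def Admissible (S : ℕ) (items : List ℕ) : Prop := items.Nodup ∧ ∀ a ∈ items, 1 ≤ a ∧ a ≤ S

theorem holds_left {r : Fin 2 → ℝ} : leftRow.Holds r ↔ 0 ≤ r 0 := by
  simp [HalfPlane.Holds, HalfPlane.form, leftRow]

theorem holds_bottom {m : ℕ} {r : Fin 2 → ℝ} : (bottomRow m).Holds r ↔ 0 ≤ N m * r 0 + r 1 := by
  simp only [HalfPlane.Holds, HalfPlane.form, bottomRow]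
  push_cast
  constructor <;> intro h <;> linarith

theorem holds_right {m k S : ℕ} {r : Fin 2 → ℝ} :
    (rightRow m k S).Holds r ↔ r 0 ≤ w S * U m k S := by
  simp [HalfPlane.Holds, HalfPlane.form, rightRow]

theorem holds_item {m k S a : ℕ} {r : Fin 2 → ℝ} : (itemRow m k S a).Holds r ↔
    M m k * a * r 0 - r 1 ≤ M m k * a * (w S + a - 2 * S) * U m k S := by
  simp only [HalfPlane.Holds, HalfPlane.form, itemRow]
  push_cast
  constructor <;> intro h <;> linarith

theorem strip_corner (hI : Admissible G.S items) (r : Fin 2 → ℝ) (hr : G.chain.Corner r) :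
    ∀ R ∈ stripBase G.m G.k G.S items, R.Holds r := by
  have hB := G.realBounds
  obtain ⟨h0, h1, h2, h3⟩ := hr
  simp only [chain_U, chain_h] at h1 h2 h3
  push_cast at h2 h3
  have hU := hB.U_one
  have hN := hB.N_pos
  have hH := hB.le_H
  have hM := hB.M_pos
  have hS := hB.S_pos
  have hw := hB.w_ge
  have hlow := hB.low
  have hUw := hB.U_le
  have hr1 : (M G.m G.k : ℝ) * G.S * U G.m G.k G.S ≤ r 1 := by
    have : (M G.m G.k : ℝ) * G.S * U G.m G.k G.S ≤ M G.m G.k * G.S * (w G.S * U G.m G.k G.S) :=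
      mul_le_mul_of_nonneg_left hUw (by nlinarith)
    have : (U G.m G.k G.S : ℝ) ≤ N G.m * (w G.S * U G.m G.k G.S) := by nlinarith
    linarith
  refine forall_stripBase (holds_left.2 h0) (holds_bottom.2 ?_) (holds_right.2 ?_) ?_
  · have : 0 ≤ (M G.m G.k : ℝ) * G.S * U G.m G.k G.S := by
      have : 0 ≤ (M G.m G.k : ℝ) * G.S := by nlinarith
      positivity
    have : 0 ≤ (N G.m : ℝ) * r 0 := by positivity
    linarith
  · linarith
  · intro a ha
    obtain ⟨ha1, haS⟩ := hI.2 a ha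
    have ha1' : (1 : ℝ) ≤ a := by exact_mod_cast ha1
    have haS' : (a : ℝ) ≤ G.S := by exact_mod_cast haS
    refine holds_item.2 ?_
    have h4 := hB.item_nonneg ha1'
    have h5 : (M G.m G.k : ℝ) * a * r 0 ≤ M G.m G.k * G.S * U G.m G.k G.S :=
      mul_le_mul (mul_le_mul_of_nonneg_left haS' (by linarith)) h1 h0 (by nlinarith)
    linarith

theorem strip_nodup (hI : Admissible G.S items) : (stripBase G.m G.k G.S items).Nodup := by
  have hN := G.N_pos
  have hM : 0 < M G.m G.k := by
    have h1 := G.realBounds.N_pos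
    have h2 := G.realBounds.M_pos
    exact_mod_cast (by linarith : (0 : ℝ) < M G.m G.k)
  have hinj : Function.Injective (itemRow G.m G.k G.S) := by
    intro a b h
    have := congrArg HalfPlane.a h
    simp only [itemRow] at this
    exact_mod_cast mul_left_cancel₀ hM.ne' this
  have hitem : ∀ a ∈ items, 0 < (itemRow G.m G.k G.S a).a ∧ (itemRow G.m G.k G.S a).b = -1 := by
    intro a ha
    have : (1 : ℤ) ≤ a := by exact_mod_cast (hI.2 a ha).1
    exact ⟨mul_pos hM (by omega), rfl⟩
  simp only [stripBase, List.nodup_cons, List.mem_cons, List.mem_map, not_or, not_exists, not_and]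
  refine ⟨⟨?_, ?_, ?_⟩, ⟨?_, ?_⟩, ?_, hI.1.map hinj⟩
  · intro h; simpa [leftRow, bottomRow] using congrArg HalfPlane.b h
  · intro h; simpa [leftRow, rightRow] using congrArg HalfPlane.a h
  · intro a ha h
    have h1 := (hitem a ha).1
    rw [h] at h1
    simp [leftRow] at h1
  · intro h; simpa [bottomRow, rightRow] using congrArg HalfPlane.b h
  · intro a ha h
    have h1 := (hitem a ha).1
    rw [h] at h1
    simp only [bottomRow] at h1
    linarith
  · intro a ha h
    have h1 := (hitem a ha).2
    rw [h] at h1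
    simp [rightRow] at h1

theorem strip_disjoint : ∀ R ∈ stripBase G.m G.k G.S items, R ∉ G.chain.rows := by
  have key : ∀ R ∈ G.chain.rows, 1 ≤ R.b := by
    intro R hR
    obtain ⟨j, h1, -, rfl | rfl⟩ := G.chain.mem_rows.1 hR
    · simp only [Chain.left]; exact_mod_cast h1
    · simp [Chain.right]
  refine forall_stripBase ?_ ?_ ?_ ?_
  · intro h; simpa [leftRow] using key _ h
  · intro h; simpa [bottomRow] using key _ h
  · intro h; simpa [rightRow] using key _ h
  · intro a _ h; simpa [itemRow] using key _ h

theorem under_of_low {r : Fin 2 → ℝ} (h0 : -1 ≤ r 0)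
    (h0W : r 0 ≤ w G.S * U G.m G.k G.S + 1)
    (h1 : r 1 ≤ M G.m G.k * G.S * (w G.S * U G.m G.k G.S)) : G.chain.Under r := by
  have hB := G.realBounds
  refine Chain.under_of_low (W := w G.S * U G.m G.k G.S) hB.U_le h0 h0W ?_
  have := hB.low
  simp only [chain_h, chain_U, chain_N]
  push_cast
  linarith

/-- Every inequality of the base of the strip can be violated alone. -/
theorem strip_witness (hI : Admissible G.S items) : ∀ R ∈ stripBase G.m G.k G.S items,
    ∃ r, G.chain.Under r ∧ (∀ R' ∈ stripBase G.m G.k G.S items, R' ≠ R → R'.Holds r) ∧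
      ¬ R.Holds r := by
  have hB := G.realBounds
  have hU := hB.U_one
  have hN := hB.N_pos
  have hM := hB.M_pos
  have hS := hB.S_pos
  have hw := hB.w_ge
  have hUw := hB.U_le
  have hlow := hB.low
  have hMS : (M G.m G.k : ℝ) ≤ M G.m G.k * G.S := le_mul_of_one_le_right (by linarith) hS
  have hMW : (M G.m G.k : ℝ) * G.S ≤ M G.m G.k * G.S * (w G.S * U G.m G.k G.S) :=
    le_mul_of_one_le_right (by linarith) (by linarith)
  have hitem : ∀ a ∈ items, (1 : ℝ) ≤ a ∧ (a : ℝ) ≤ G.S := fun a ha =>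
    ⟨by exact_mod_cast (hI.2 a ha).1, by exact_mod_cast (hI.2 a ha).2⟩
  refine forall_stripBase ?_ ?_ ?_ ?_
  · refine ⟨![-1, N G.m], under_of_low (by simp) ?_ ?_, forall_stripBase ?_ ?_ ?_ ?_, ?_⟩
    · simp; linarith
    · simp; linarith
    · intro h; exact absurd rfl h
    · intro _; refine holds_bottom.2 ?_; simp
    · intro _; refine holds_right.2 ?_; simp; linarith
    · intro a ha _
      refine holds_item.2 ?_
      have h1 := hB.item_nonneg (hitem a ha).1
      have h2 : 0 ≤ (M G.m G.k : ℝ) * a := mul_nonneg (by linarith) (by linarith [(hitem a ha).1])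
      simp
      linarith
    · rw [holds_left]; simp
  · refine ⟨![0, -1], under_of_low (by simp) ?_ ?_, forall_stripBase ?_ ?_ ?_ ?_, ?_⟩
    · simp; linarith
    · simp; linarith
    · intro _; refine holds_left.2 ?_; simp
    · intro h; exact absurd rfl h
    · intro _; refine holds_right.2 ?_; simp; linarith
    · intro a ha _
      refine holds_item.2 ?_
      have ha1 := (hitem a ha).1
      have h2 : 1 ≤ (M G.m G.k : ℝ) * a := by nlinarith
      have h3 : (1 : ℝ) ≤ w G.S + a - 2 * G.S := by nlinarith
      have h4 : (1 : ℝ) ≤ M G.m G.k * a * (w G.S + a - 2 * G.S) := by nlinarith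
      have h5 : (1 : ℝ) ≤ M G.m G.k * a * (w G.S + a - 2 * G.S) * U G.m G.k G.S := by nlinarith
      simp
      linarith
    · rw [holds_bottom]; simp
  · refine ⟨![w G.S * U G.m G.k G.S + 1, M G.m G.k * G.S * (w G.S * U G.m G.k G.S)],
      under_of_low ?_ (by simp) (by simp), forall_stripBase ?_ ?_ ?_ ?_, ?_⟩
    · simp; linarith
    · intro _; refine holds_left.2 ?_; simp; linarith
    · intro _; refine holds_bottom.2 ?_
      simp only [Matrix.cons_val_zero, Matrix.cons_val_one, Matrix.cons_val_fin_one]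
      have : 0 ≤ (N G.m : ℝ) * (w G.S * U G.m G.k G.S + 1) := mul_nonneg (by linarith) (by linarith)
      linarith
    · intro h; exact absurd rfl h
    · intro a ha _
      refine holds_item.2 ?_
      simp only [Matrix.cons_val_zero, Matrix.cons_val_one, Matrix.cons_val_fin_one]
      obtain ⟨ha1, haS⟩ := hitem a ha
      have h1 : (M G.m G.k : ℝ) * a * 1 ≤ M G.m G.k * a * U G.m G.k G.S :=
        mul_le_mul_of_nonneg_left (by linarith) (mul_nonneg (by linarith) (by linarith))
      have h2 : (a : ℝ) * (2 * G.S - a + 1) ≤ G.S * w G.S := by nlinarith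
      have h3 : (M G.m G.k : ℝ) * U G.m G.k G.S * (a * (2 * G.S - a + 1)) ≤
          M G.m G.k * U G.m G.k G.S * (G.S * w G.S) :=
        mul_le_mul_of_nonneg_left h2 (mul_nonneg (by linarith) (by linarith))
      linarith
    · rw [holds_right]; simp
  · intro a ha
    obtain ⟨ha1, haS⟩ := hitem a ha
    have hy : (M G.m G.k : ℝ) * a ^ 2 * U G.m G.k G.S ≤
        M G.m G.k * G.S * (w G.S * U G.m G.k G.S) := by
      have h2 : (a : ℝ) ^ 2 ≤ G.S * w G.S := by nlinarith
      have h3 : (M G.m G.k : ℝ) * U G.m G.k G.S * a ^ 2 ≤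
          M G.m G.k * U G.m G.k G.S * (G.S * w G.S) :=
        mul_le_mul_of_nonneg_left h2 (mul_nonneg (by linarith) (by linarith))
      linarith
    have hx : 0 ≤ (w G.S : ℝ) * U G.m G.k G.S - 2 * (G.S - a) * U G.m G.k G.S := by
      have : 0 ≤ ((w G.S : ℝ) - 2 * (G.S - a)) * U G.m G.k G.S :=
        mul_nonneg (by nlinarith) (by linarith)
      linarith
    have hx' : 0 ≤ 2 * ((G.S : ℝ) - a) * U G.m G.k G.S :=
      mul_nonneg (by linarith) (by linarith)
    have hy0 : 1 ≤ (M G.m G.k : ℝ) * a ^ 2 * U G.m G.k G.S := by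
      have h1 : (1 : ℝ) ≤ a ^ 2 := one_le_pow₀ ha1
      have h2 : (1 : ℝ) ≤ M G.m G.k * a ^ 2 := by nlinarith
      nlinarith
    -- The point just below the point of tangency with the parabola.
    refine ⟨![w G.S * U G.m G.k G.S - 2 * (G.S - a) * U G.m G.k G.S,
        M G.m G.k * a ^ 2 * U G.m G.k G.S - 1],
      under_of_low ?_ ?_ ?_, forall_stripBase ?_ ?_ ?_ ?_, ?_⟩
    · simp only [Matrix.cons_val_zero]; linarith
    · simp only [Matrix.cons_val_zero]; linarith
    · simp only [Matrix.cons_val_one, Matrix.cons_val_fin_one]; linarith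
    · intro _; refine holds_left.2 ?_; simp only [Matrix.cons_val_zero]; linarith
    · intro _; refine holds_bottom.2 ?_
      simp only [Matrix.cons_val_zero, Matrix.cons_val_one, Matrix.cons_val_fin_one]
      have := mul_nonneg (show (0 : ℝ) ≤ N G.m by linarith) hx
      linarith
    · intro _; refine holds_right.2 ?_; simp only [Matrix.cons_val_zero]; linarith
    · intro b hb hne
      refine holds_item.2 ?_
      simp only [Matrix.cons_val_zero, Matrix.cons_val_one, Matrix.cons_val_fin_one]
      have hab : (1 : ℝ) ≤ ((a : ℝ) - b) ^ 2 := by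
        have h1 : (a : ℤ) - b ≠ 0 := by
          intro h
          exact hne (by rw [show b = a by omega])
        have h2 : (1 : ℤ) ≤ ((a : ℤ) - b) ^ 2 := by
          have := sq_pos_of_ne_zero h1
          omega
        exact_mod_cast h2
      have h2 : (1 : ℝ) ≤ M G.m G.k * ((a : ℝ) - b) ^ 2 := by nlinarith
      have h3 : (1 : ℝ) ≤ M G.m G.k * ((a : ℝ) - b) ^ 2 * U G.m G.k G.S := by nlinarith
      linarith
    · rw [holds_item]
      simp only [Matrix.cons_val_zero, Matrix.cons_val_one, Matrix.cons_val_fin_one]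
      intro h
      linarith

theorem strip_describesPolygon {s t : Fin 2 → ℚ} (hI : Admissible G.S items) :
    (PlanarData.ofRows (stripBase G.m G.k G.S items ++ G.chain.rows) s t).DescribesPolygon := by
  have hB := G.realBounds
  have hU := hB.U_one
  have hN := hB.N_pos
  have hM := hB.M_pos
  have hS := hB.S_pos
  have hw := hB.w_ge
  have hUw := hB.U_le
  have hMS : (M G.m G.k : ℝ) ≤ M G.m G.k * G.S := le_mul_of_one_le_right (by linarith) hS
  refine Chain.describesPolygon (strip_nodup hI) strip_disjoint ?_ ?_ (strip_corner hI)
    (strip_witness hI)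
  · refine ⟨(w G.S : ℝ) * U G.m G.k G.S * N G.m + H G.m G.k G.S * w G.S * U G.m G.k G.S,
      fun r hr hu => ?_⟩
    have h1 := holds_left.1 (hr _ (mem_stripBase.2 (Or.inl rfl)))
    have h2 := holds_bottom.1 (hr _ (mem_stripBase.2 (Or.inr (Or.inl rfl))))
    have h3 := holds_right.1 (hr _ (mem_stripBase.2 (Or.inr (Or.inr (Or.inl rfl)))))
    have h4 := hu.add_le
    simp only [chain_h, chain_U] at h4
    push_cast at h4
    have h5 := hB.le_H
    have h6 : 0 ≤ (H G.m G.k G.S : ℝ) * w G.S * U G.m G.k G.S := by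
      rw [mul_assoc]; exact mul_nonneg (by linarith) (by linarith)
    have h7 : (N G.m : ℝ) * r 0 ≤ w G.S * U G.m G.k G.S * N G.m := by
      rw [mul_comm]; exact mul_le_mul_of_nonneg_right h3 (by linarith)
    have h8 : (w G.S : ℝ) * U G.m G.k G.S * 1 ≤ w G.S * U G.m G.k G.S * N G.m :=
      mul_le_mul_of_nonneg_left (by linarith) (by linarith)
    exact ⟨abs_le.2 ⟨by linarith, by linarith⟩, abs_le.2 ⟨by linarith, by linarith⟩⟩
  · refine ⟨![1, 1], forall_stripBase ?_ ?_ ?_ ?_, under_of_low (by simp) ?_ ?_⟩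
    · simp [HalfPlane.form, leftRow]
    · simp [HalfPlane.form, bottomRow]; linarith
    · simp [HalfPlane.form, rightRow]; linarith
    · intro a ha
      have ha1 : (1 : ℝ) ≤ a := by exact_mod_cast (hI.2 a ha).1
      have h2 : 1 ≤ (M G.m G.k : ℝ) * a := by nlinarith
      have h3 : (1 : ℝ) ≤ (w G.S + a - 2 * G.S) * U G.m G.k G.S := by nlinarith
      have h4 : (M G.m G.k : ℝ) * a * 1 ≤
          M G.m G.k * a * ((w G.S + a - 2 * G.S) * U G.m G.k G.S) :=
        mul_le_mul_of_nonneg_left h3 (by linarith)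
      simp [HalfPlane.form, itemRow]
      linarith
    · simp; linarith
    · simp only [Matrix.cons_val_one, Matrix.cons_val_fin_one]
      have : (M G.m G.k : ℝ) * G.S * 1 ≤ M G.m G.k * G.S * (w G.S * U G.m G.k G.S) :=
        mul_le_mul_of_nonneg_left (by linarith) (by linarith)
      linarith

end Gadget

end CircuitWalks

/-! ### Long walks in the strip of an infeasible instance -/

namespace CircuitWalks

namespace Gadget

variable {G : Gadget} {items : List ℕ}

theorem M_mul_le_K {a : ℕ} (ha : a ≤ G.S) : M G.m G.k * a ≤ K G.m G.k G.S := by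
  have hB := G.realBounds
  have h1 := hB.le_H
  have h2 := hB.K_eq
  have h3 := hB.m_pos
  have h4 := hB.M_pos
  have h5 := hB.N_pos
  have ha' : (a : ℝ) ≤ G.S := by exact_mod_cast ha
  have h6 : (M G.m G.k : ℝ) * a ≤ M G.m G.k * G.S := mul_le_mul_of_nonneg_left ha' (by linarith)
  have h7 : 0 ≤ (M G.m G.k : ℝ) * G.S := mul_nonneg (by linarith) (by positivity)
  have : (M G.m G.k : ℝ) * a ≤ K G.m G.k G.S := by nlinarith
  exact_mod_cast this

theorem strip_coefficients (hI : Admissible G.S items) :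
    ∀ R ∈ stripBase G.m G.k G.S items, |R.a| ≤ G.chain.K ∧ |R.b| ≤ G.chain.K ∧ G.chain.U ∣ R.c := by
  have h1 := G.chain.K_pos
  have h2 := G.chain.four_N_le_K
  have h3 := G.N_pos
  simp only [chain_N, chain_K] at h1 h2
  simp only [chain_K, chain_U]
  have hM : 0 ≤ M G.m G.k := by unfold M; positivity
  refine forall_stripBase ?_ ?_ ?_ ?_
  · exact ⟨by simp [leftRow]; omega, by simp [leftRow]; omega, dvd_zero _⟩
  · refine ⟨?_, by simp [bottomRow]; omega, dvd_zero _⟩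
    simp only [bottomRow, abs_neg]
    rw [abs_of_nonneg (by omega)]
    omega
  · exact ⟨by simp [rightRow]; omega, by simp [rightRow]; omega, Dvd.intro_left _ rfl⟩
  · intro a ha
    refine ⟨?_, by simp [itemRow]; omega, Dvd.intro_left _ rfl⟩
    simp only [itemRow]
    rw [abs_of_nonneg (by positivity)]
    exact M_mul_le_K (hI.2 a ha).2

/-- The invariant of a walk in the strip: its point is on one of the sides at a height that is a
combination of the numbers, up to a small error, or it is already above the line from which the
optimum can be reached in one move. -/
def Strip (G : Gadget) (items : List ℕ) (i : ℕ) (p : Fin 2 → ℝ) : Prop :=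
  (∃ A ∈ AddSubmonoid.closure {a | a ∈ items}, ∃ e : ℤ, 0 ≤ e ∧ e ≤ N G.m * i ∧
    (p 0 = 0 ∨ p 0 = w G.S * U G.m G.k G.S) ∧
    p 1 = w G.S * U G.m G.k G.S * (M G.m G.k * A + e : ℤ)) ∨
  ((H G.m G.k G.S - N G.m) * (w G.S * U G.m G.k G.S) < p 1 ∧
    (N G.m * p 0 + p 1 = H G.m G.k G.S * w G.S * U G.m G.k G.S → p = G.chain.apex G.m))

/-- Comparing two numbers written in base `M`. -/
theorem eq_of_digits (hi : i ≤ G.m) {A : ℕ} {e : ℤ} (he0 : 0 ≤ e) (he : e ≤ N G.m * i)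
    (h : M G.m G.k * A + e = H G.m G.k G.S - N G.m) : A = G.S := by
  have hN := G.N_pos
  have hk : (1 : ℤ) ≤ G.k := by exact_mod_cast G.one_le_k
  have hi' : (i : ℤ) ≤ G.m := by exact_mod_cast hi
  have hm : (1 : ℤ) ≤ G.m := by exact_mod_cast G.one_le_m
  have h1 : N G.m * i ≤ N G.m * G.m := mul_le_mul_of_nonneg_left hi' (by linarith)
  have h2 : M G.m G.k = N G.m * G.m + N G.m * G.k := by unfold M; ring
  have hH : H G.m G.k G.S = M G.m G.k * G.S + N G.m * G.k := rfl
  have h3 : 0 < N G.m * G.m := by positivity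
  have h4 : N G.m * 1 ≤ N G.m * G.k := mul_le_mul_of_nonneg_left hk (by linarith)
  have hM : 0 < M G.m G.k := by linarith
  have h5 : M G.m G.k * ((A : ℤ) - G.S) < M G.m G.k * 1 := by linarith
  have h6 : M G.m G.k * (-1) < M G.m G.k * ((A : ℤ) - G.S) := by linarith
  have h7 := lt_of_mul_lt_mul_left h5 hM.le
  have h8 := lt_of_mul_lt_mul_left h6 hM.le
  omega

theorem strip_line (hinf : G.S ∉ AddSubmonoid.closure {a | a ∈ items}) {i : ℕ} (hi : i < G.m)
    {p : Fin 2 → ℝ} (hp : G.chain.Under p) (hJ : Strip G items i p)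
    (hne : p ≠ G.chain.apex G.m) :
    N G.m * p 0 + p 1 ≠ H G.m G.k G.S * w G.S * U G.m G.k G.S := by
  intro hline
  rcases hJ with ⟨A, hA, e, he0, he, h0 | h0, h1⟩ | ⟨-, h⟩
  · refine Chain.apex_not_under (c := G.chain) (i := 0) G.one_le_m ?_
    convert hp using 1
    ext j
    fin_cases j
    · simp [Chain.apex, h0]
    · rw [h0, mul_zero, zero_add] at hline
      simp [Chain.apex, hline]
  · have hB := G.realBounds
    have hW : (0 : ℝ) < w G.S * U G.m G.k G.S := by linarith [hB.U_le, hB.U_one]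
    have h2 : (w G.S * U G.m G.k G.S : ℝ) * (M G.m G.k * A + e : ℤ) =
        w G.S * U G.m G.k G.S * (H G.m G.k G.S - N G.m : ℤ) := by
      rw [h0, h1] at hline
      push_cast at hline ⊢
      linarith
    have h3 : M G.m G.k * A + e = H G.m G.k G.S - N G.m := by
      exact_mod_cast mul_left_cancel₀ hW.ne' h2
    exact hinf (eq_of_digits hi.le he0 he h3 ▸ hA)
  · exact hne (h hline)

/-- The only point on a tight row above the critical height and on the line through the apexes is
the optimum. -/
theorem eq_apex_of_high (hI : Admissible G.S items) {r : Fin 2 → ℝ}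
    (hbase : ∀ R ∈ stripBase G.m G.k G.S items, R.Holds r) (hr : G.chain.Under r)
    {R : HalfPlane} (hR : R ∈ stripBase G.m G.k G.S items ++ G.chain.rows) (ht : R.form r = R.c)
    (hhigh : (H G.m G.k G.S - N G.m : ℝ) * (w G.S * U G.m G.k G.S) < r 1)
    (hline : (N G.m : ℝ) * r 0 + r 1 = H G.m G.k G.S * w G.S * U G.m G.k G.S) :
    r = G.chain.apex G.m := by
  have hB := G.realBounds
  have hU := hB.U_one
  have hUw := hB.U_le
  have hN := hB.N_pos
  have hM := hB.M_pos
  have hS := hB.S_pos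
  have hlow := hB.low
  have h0 : 0 ≤ r 0 := holds_left.1 (hbase _ (mem_stripBase.2 (Or.inl rfl)))
  have hMS : 0 ≤ (M G.m G.k : ℝ) * G.S * (w G.S * U G.m G.k G.S) :=
    mul_nonneg (mul_nonneg (by linarith) (by linarith)) (by linarith)
  rcases List.mem_append.1 hR with h | h
  · exfalso
    rcases mem_stripBase.1 h with rfl | rfl | rfl | ⟨a, ha, rfl⟩
    · have h0' : r 0 = 0 := by simpa [HalfPlane.form, leftRow] using ht
      refine Chain.apex_not_under (c := G.chain) (i := 0) G.one_le_m ?_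
      convert hr using 1
      ext j
      fin_cases j
      · simp [Chain.apex, h0']
      · rw [h0', mul_zero, zero_add] at hline
        simp [Chain.apex, hline]
    · simp only [HalfPlane.form, bottomRow] at ht
      push_cast at ht
      have := mul_nonneg (show (0 : ℝ) ≤ N G.m by linarith) h0
      linarith
    · have h0' : r 0 = w G.S * U G.m G.k G.S := by simpa [HalfPlane.form, rightRow] using ht
      rw [h0'] at hline
      linarith
    · have ha1 : (1 : ℝ) ≤ a := by exact_mod_cast (hI.2 a ha).1
      have haS : (a : ℝ) ≤ G.S := by exact_mod_cast (hI.2 a ha).2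
      have h3 := holds_right.1 (hbase _ (mem_stripBase.2 (Or.inr (Or.inr (Or.inl rfl)))))
      simp only [HalfPlane.form, itemRow] at ht
      push_cast at ht
      have h4 : (M G.m G.k : ℝ) * a * r 0 ≤ M G.m G.k * a * (w G.S * U G.m G.k G.S) :=
        mul_le_mul_of_nonneg_left h3 (mul_nonneg (by linarith) (by linarith))
      have h5 : (a : ℝ) * (2 * G.S - a) ≤ G.S * w G.S := by nlinarith [hB.w_ge]
      have h6 : (M G.m G.k : ℝ) * U G.m G.k G.S * (a * (2 * G.S - a)) ≤
          M G.m G.k * U G.m G.k G.S * (G.S * w G.S) :=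
        mul_le_mul_of_nonneg_left h5 (mul_nonneg (by linarith) (by linarith))
      linarith
  · refine Chain.eq_apex_of_tight hr h ht ?_
    simp only [chain_N, chain_h, chain_U]
    push_cast
    exact hline

/-- A point on the edge of a number that is reached from the left side would be close to the right
side, hence higher than the edge. -/
theorem not_tight_item {M a S w U x y : ℝ} (hM : 0 < M) (ha : 1 ≤ a) (hU : 0 < U)
    (hw : S ^ 2 + 1 + 2 * S ≤ w) (hx : x ≤ w * U) (hy0 : 0 ≤ y) (hy : M * x ≤ y)
    (ht : y = M * a * x - M * a * (w + a - 2 * S) * U) : False := by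
  have hMa : 0 < M * a := by positivity
  have h1 : (w + a - 2 * S) * U ≤ x := by
    refine le_of_mul_le_mul_left ?_ hMa
    linarith
  have h2 : (S ^ 2 + 1) * U ≤ (w + a - 2 * S) * U :=
    mul_le_mul_of_nonneg_right (by linarith) hU.le
  have h3 : M * ((S ^ 2 + 1) * U) ≤ M * x := mul_le_mul_of_nonneg_left (by linarith) (by linarith)
  have h4 : M * a * x ≤ M * a * (w * U) := mul_le_mul_of_nonneg_left hx hMa.le
  have h5 : M * U * (a * (2 * S - a)) ≤ M * U * S ^ 2 :=
    mul_le_mul_of_nonneg_left (by linarith [sq_nonneg (a - S)]) (by positivity)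
  have h6 : 0 < M * U := by positivity
  linarith

/-- Below the critical height, the walk goes back and forth between the two sides. -/
theorem strip_step (hI : Admissible G.S items) {i : ℕ} {p r : Fin 2 → ℝ}
    (hr : ∀ R ∈ stripBase G.m G.k G.S items, R.Holds r) (hru : G.chain.Under r)
    (hJ : Strip G items i p) (hmono : p 1 < r 1)
    {l R : HalfPlane} (hl : l ∈ stripBase G.m G.k G.S items ++ G.chain.rows)
    (hlpr : l.form r = l.form p) (hR : R ∈ stripBase G.m G.k G.S items ++ G.chain.rows)
    (hlt : R.form p < R.form r) (ht : R.form r = R.c) : Strip G items (i + 1) r := by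
  have hB := G.realBounds
  have hU := hB.U_one
  have hUw := hB.U_le
  have hN := hB.N_pos
  have hM := hB.M_pos
  have hS := hB.S_pos
  have hm := hB.m_pos
  have hlow := hB.low
  have hKeq := hB.K_eq
  have hw := hB.w_ge
  rcases lt_or_ge ((H G.m G.k G.S - N G.m : ℝ) * (w G.S * U G.m G.k G.S)) (r 1) with hhigh | hhigh
  · exact Or.inr ⟨hhigh, eq_apex_of_high hI hr hru hR ht hhigh⟩
  left
  have hr0 : 0 ≤ r 0 := holds_left.1 (hr _ (mem_stripBase.2 (Or.inl rfl)))
  have hrW := holds_right.1 (hr _ (mem_stripBase.2 (Or.inr (Or.inr (Or.inl rfl)))))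
  have hRbase : R ∈ stripBase G.m G.k G.S items := by
    refine (List.mem_append.1 hR).resolve_right fun h => ?_
    have h1 := Chain.lt_of_tight (c := G.chain) (W := w G.S * U G.m G.k G.S) hUw hr0 hrW h ht
    simp only [chain_N, chain_h, chain_U] at h1
    push_cast at h1
    linarith
  rcases hJ with ⟨A, hA, e, he0, he, hp0, hp1⟩ | ⟨h, -⟩
  swap
  · exact absurd (h.trans hmono) (not_lt.2 hhigh)
  set W : ℝ := w G.S * U G.m G.k G.S with hWdef
  have hMA : 0 ≤ M G.m G.k * A + e := by
    have : 0 ≤ M G.m G.k := by unfold M N; positivity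
    positivity
  have hY : (0 : ℝ) ≤ (M G.m G.k * A + e : ℤ) := by exact_mod_cast hMA
  have hp1' : 0 ≤ p 1 := by rw [hp1]; exact mul_nonneg (by linarith) hY
  have hi1 : N G.m * ((i + 1 : ℕ) : ℤ) = N G.m * i + N G.m := by push_cast; ring
  have hNZ := G.N_pos
  rcases hp0 with hp0 | hp0
  · -- from the left side
    have hdir : (∃ b ∈ items, r 1 - p 1 = M G.m G.k * b * r 0) ∨
        (G.m * (r 1 - p 1) ≥ K G.m G.k G.S * r 0) ∨ r 0 = 0 := by
      rcases List.mem_append.1 hl with h | h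
      · rcases mem_stripBase.1 h with rfl | rfl | rfl | ⟨b, hb, rfl⟩
        · right; right
          have : r 0 = p 0 := by simpa [HalfPlane.form, leftRow] using hlpr
          rw [this, hp0]
        · exfalso
          simp only [HalfPlane.form, bottomRow, hp0] at hlpr
          push_cast at hlpr
          have := mul_nonneg (show (0 : ℝ) ≤ N G.m by linarith) hr0
          linarith
        · right; right
          have : r 0 = p 0 := by simpa [HalfPlane.form, rightRow] using hlpr
          rw [this, hp0]
        · left
          refine ⟨b, hb, ?_⟩
          simp only [HalfPlane.form, itemRow, hp0] at hlpr
          push_cast at hlpr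
          linarith
      · obtain ⟨j, h1j, hj, rfl | rfl⟩ := G.chain.mem_rows.1 h
        · right; left
          simp only [HalfPlane.form, Chain.left, hp0, chain_K] at hlpr
          push_cast at hlpr
          have hjm : (j : ℝ) ≤ G.m := by exact_mod_cast hj
          have : (j : ℝ) * (r 1 - p 1) ≤ G.m * (r 1 - p 1) :=
            mul_le_mul_of_nonneg_right hjm (by linarith)
          linarith
        · exfalso
          have hρ : (1 : ℝ) ≤ G.chain.rho j := by exact_mod_cast Chain.rho_nonneg hj
          simp only [HalfPlane.form, Chain.right, hp0] at hlpr
          push_cast at hlpr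
          have := mul_nonneg (show (0 : ℝ) ≤ G.chain.rho j by linarith) hr0
          linarith
    have hH := hB.le_H
    have hMSnn : 0 ≤ (M G.m G.k : ℝ) * G.S := mul_nonneg (by linarith) (by linarith)
    -- In every direction the height grows at least as fast as the distance to the left side.
    have hsteep : r 0 ≤ r 1 - p 1 := by
      rcases hdir with ⟨b, hb, h⟩ | h | h
      · have hb1 : (1 : ℝ) ≤ b := by exact_mod_cast (hI.2 b hb).1
        rw [h]
        exact le_mul_of_one_le_left hr0 (by nlinarith)
      · have h1 : (G.m : ℝ) * (1 * r 0) ≤ G.m * (4 * H G.m G.k G.S * r 0) :=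
          mul_le_mul_of_nonneg_left (mul_le_mul_of_nonneg_right (by linarith) hr0) (by linarith)
        rw [hKeq] at h
        refine le_of_mul_le_mul_left ?_ (show (0 : ℝ) < G.m by linarith)
        linarith
      · linarith
    have hrW' : r 0 = W := by
      rcases mem_stripBase.1 hRbase with rfl | rfl | rfl | ⟨a, ha, rfl⟩
      · exfalso
        simp only [HalfPlane.form, leftRow, hp0] at hlt
        push_cast at hlt
        linarith
      · exfalso
        simp only [HalfPlane.form, bottomRow, hp0] at hlt
        push_cast at hlt
        have := mul_nonneg (show (0 : ℝ) ≤ N G.m by linarith) hr0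
        linarith
      · simpa [HalfPlane.form, rightRow, hWdef] using ht
      · exfalso
        have ha1 : (1 : ℝ) ≤ a := by exact_mod_cast (hI.2 a ha).1
        have h3 : (M G.m G.k : ℝ) * r 0 ≤ r 1 - p 1 := by
          rcases hdir with ⟨b, hb, h⟩ | h | h
          · have hb1 : (1 : ℝ) ≤ b := by exact_mod_cast (hI.2 b hb).1
            rw [h]
            exact mul_le_mul_of_nonneg_right (le_mul_of_one_le_right (by linarith) hb1) hr0
          · rw [hKeq] at h
            refine le_of_mul_le_mul_left ?_ (show (0 : ℝ) < G.m by linarith)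
            have h5 : (M G.m G.k : ℝ) ≤ 4 * H G.m G.k G.S := by
              have := le_mul_of_one_le_right (show (0 : ℝ) ≤ M G.m G.k by linarith) hS
              linarith
            have h6 : (G.m : ℝ) * (M G.m G.k * r 0) ≤ G.m * (4 * H G.m G.k G.S * r 0) :=
              mul_le_mul_of_nonneg_left (mul_le_mul_of_nonneg_right h5 hr0) (by linarith)
            linarith
          · rw [h, mul_zero]; linarith
        simp only [HalfPlane.form, itemRow] at ht
        push_cast at ht
        exact not_tight_item (M := M G.m G.k) (U := U G.m G.k G.S) (y := r 1) (x := r 0)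
          (by linarith) ha1 (by linarith) hw.le hrW (by linarith)
          (by linarith) (by linarith)
    rcases hdir with ⟨b, hb, h⟩ | h | h
    · refine ⟨A + b, add_mem hA (AddSubmonoid.subset_closure hb), e, he0, by rw [hi1]; linarith,
        Or.inr hrW', ?_⟩
      rw [hrW', hp1] at h
      push_cast at h ⊢
      linarith
    · exfalso
      rw [hKeq, hrW'] at h
      have h1 : 4 * H G.m G.k G.S * W ≤ r 1 - p 1 := by
        refine le_of_mul_le_mul_left ?_ (show (0 : ℝ) < G.m by linarith)
        linarith
      have h2 : 0 < (H G.m G.k G.S : ℝ) * W := mul_pos (by linarith) (by linarith)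
      have h3 : 0 < (N G.m : ℝ) * W := mul_pos (by linarith) (by linarith)
      linarith
    · exfalso; linarith
  · -- from the right side
    have hrL : r 0 = 0 := by
      rcases mem_stripBase.1 hRbase with rfl | rfl | rfl | ⟨a, ha, rfl⟩
      · simpa [HalfPlane.form, leftRow] using ht
      · exfalso
        simp only [HalfPlane.form, bottomRow] at ht
        push_cast at ht
        have := mul_nonneg (show (0 : ℝ) ≤ N G.m by linarith) hr0
        linarith
      · exfalso
        simp only [HalfPlane.form, rightRow, hp0] at hlt
        push_cast at hlt
        linarith
      · exfalso
        simp only [HalfPlane.form, itemRow, hp0] at hlt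
        push_cast at hlt
        have : (M G.m G.k : ℝ) * a * r 0 ≤ M G.m G.k * a * W :=
          mul_le_mul_of_nonneg_left hrW (mul_nonneg (by linarith) (Nat.cast_nonneg a))
        linarith
    have hfin : ∀ f : ℤ, 0 ≤ f → f ≤ N G.m → r 1 - p 1 = f * W → ∃ A ∈ AddSubmonoid.closure
        {a | a ∈ items}, ∃ e : ℤ, 0 ≤ e ∧ e ≤ N G.m * ((i + 1 : ℕ) : ℤ) ∧ (r 0 = 0 ∨ r 0 = W) ∧
        r 1 = W * (M G.m G.k * A + e : ℤ) := by
      intro f hf0 hf h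
      refine ⟨A, hA, e + f, by linarith, by rw [hi1]; linarith, Or.inl hrL, ?_⟩
      rw [hp1] at h
      push_cast at h ⊢
      linarith
    rcases List.mem_append.1 hl with h | h
    · rcases mem_stripBase.1 h with rfl | rfl | rfl | ⟨b, hb, rfl⟩
      · exfalso
        have : r 0 = p 0 := by simpa [HalfPlane.form, leftRow] using hlpr
        linarith
      · refine hfin (N G.m) (by linarith) le_rfl ?_
        simp only [HalfPlane.form, bottomRow, hp0, hrL] at hlpr
        push_cast at hlpr
        linarith
      · exfalso
        have : r 0 = p 0 := by simpa [HalfPlane.form, rightRow] using hlpr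
        linarith
      · exfalso
        simp only [HalfPlane.form, itemRow, hp0, hrL] at hlpr
        push_cast at hlpr
        have : 0 ≤ (M G.m G.k : ℝ) * b * W :=
          mul_nonneg (mul_nonneg (by linarith) (Nat.cast_nonneg b)) (by linarith)
        linarith
    · obtain ⟨j, h1j, hj, rfl | rfl⟩ := G.chain.mem_rows.1 h
      · exfalso
        simp only [HalfPlane.form, Chain.left, hp0, hrL, chain_K] at hlpr
        push_cast at hlpr
        have h1 : 0 < (j : ℝ) * (r 1 - p 1) :=
          mul_pos (by exact_mod_cast h1j) (by linarith)
        have hH := hB.le_H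
        have hMSnn : 0 ≤ (M G.m G.k : ℝ) * G.S := mul_nonneg (by linarith) (by linarith)
        have h2 : 0 ≤ (K G.m G.k G.S : ℝ) * W := by
          rw [hKeq]; exact mul_nonneg (mul_nonneg (by linarith) (by linarith)) (by linarith)
        linarith
      · have h1 := Chain.rho_nonneg (c := G.chain) hj
        have h2 := Chain.rho_le (c := G.chain) h1j
        have h3 := G.chain.le_N
        simp only [chain_m, chain_N] at h2 h3
        refine hfin (G.chain.rho j) (by omega) (by omega) ?_
        simp only [HalfPlane.form, Chain.right, hp0, hrL] at hlpr
        push_cast at hlpr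
        linarith

/-- The data of the strip. -/
abbrev strip (G : Gadget) (items : List ℕ) : PlanarData :=
  PlanarData.ofRows (stripBase G.m G.k G.S items ++ G.chain.rows) 0 heightCost

theorem strip_low_mem (hI : Admissible G.S items) {x Y : ℝ}
    (hx : x = 0 ∧ 0 ≤ Y ∨ x = w G.S * U G.m G.k G.S ∧ (M G.m G.k : ℝ) ≤ Y)
    (hY : Y ≤ H G.m G.k G.S - N G.m) :
    ![x, w G.S * U G.m G.k G.S * Y] ∈ (strip G items).P := by
  have hB := G.realBounds
  have hU := hB.U_one
  have hUw := hB.U_le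
  have hN := hB.N_pos
  have hM := hB.M_pos
  have hS := hB.S_pos
  have hx0 : 0 ≤ x := by
    rcases hx with ⟨h, -⟩ | ⟨h, -⟩ <;> rw [h]
    linarith
  have hxW : x ≤ w G.S * U G.m G.k G.S := by
    rcases hx with ⟨h, -⟩ | ⟨h, -⟩ <;> rw [h]
    linarith
  have hY0 : 0 ≤ Y := by
    rcases hx with ⟨-, h⟩ | ⟨-, h⟩ <;> linarith
  have hWY : 0 ≤ (w G.S : ℝ) * U G.m G.k G.S * Y := mul_nonneg (by linarith) hY0
  refine Chain.mem_P_append.2 ⟨forall_stripBase (holds_left.2 hx0) (holds_bottom.2 ?_)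
    (holds_right.2 hxW) fun a ha => holds_item.2 ?_, Chain.under_of_low
      (W := w G.S * U G.m G.k G.S) hUw ?_ ?_ ?_⟩
  · simp only [Matrix.cons_val_zero, Matrix.cons_val_one, Matrix.cons_val_fin_one]
    have := mul_nonneg (show (0 : ℝ) ≤ N G.m by linarith) hx0
    linarith
  · have ha1 : (1 : ℝ) ≤ a := by exact_mod_cast (hI.2 a ha).1
    have haS : (a : ℝ) ≤ G.S := by exact_mod_cast (hI.2 a ha).2
    simp only [Matrix.cons_val_zero, Matrix.cons_val_one, Matrix.cons_val_fin_one]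
    rcases hx with ⟨h, -⟩ | ⟨h, hMY⟩
    · rw [h, mul_zero]
      linarith [hB.item_nonneg ha1]
    · have h1 : (w G.S : ℝ) * U G.m G.k G.S * M G.m G.k ≤ w G.S * U G.m G.k G.S * Y :=
        mul_le_mul_of_nonneg_left hMY (by linarith)
      have h2 : (a : ℝ) * (2 * G.S - a) ≤ w G.S := by
        nlinarith [hB.w_ge, sq_nonneg ((a : ℝ) - G.S)]
      have h3 : (M G.m G.k : ℝ) * U G.m G.k G.S * (a * (2 * G.S - a)) ≤
          M G.m G.k * U G.m G.k G.S * w G.S :=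
        mul_le_mul_of_nonneg_left h2 (mul_nonneg (by linarith) (by linarith))
      rw [h]
      linarith
  · simp only [Matrix.cons_val_zero]; linarith
  · simp only [Matrix.cons_val_zero]; linarith
  · simp only [Matrix.cons_val_one, Matrix.cons_val_fin_one, chain_h, chain_U, chain_N]
    push_cast
    have := mul_le_mul_of_nonneg_left hY (show 0 ≤ (w G.S : ℝ) * U G.m G.k G.S by linarith)
    linarith

theorem strip_zero_mem (hI : Admissible G.S items) :
    (0 : Fin 2 → ℝ) ∈ (strip G items).P := by
  have hB := G.realBounds
  have h := strip_low_mem (G := G) (x := 0) (Y := 0) hI (Or.inl ⟨rfl, le_rfl⟩) ?_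
  · convert h using 1
    ext j
    fin_cases j <;> simp
  · have h1 := hB.le_H
    have h2 : 0 ≤ (M G.m G.k : ℝ) * G.S :=
      mul_nonneg (by linarith [hB.N_pos, hB.M_pos]) (by linarith [hB.S_pos])
    linarith

theorem lt_dist_strip (hI : Admissible G.S items)
    (hinf : G.S ∉ AddSubmonoid.closure {a | a ∈ items}) :
    (G.m : ℕ∞) < (strip G items).dist := by
  refine Chain.lt_dist (c := G.chain) (strip_coefficients hI) (strip_corner hI) (Strip G items)
    ?_ ?_ ?_ (strip_zero_mem hI)
  · exact Or.inl ⟨0, zero_mem _, 0, le_rfl, by simp, Or.inl rfl, by simp⟩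
  · intro i hi p hp hJ hne l _ _ h
    refine strip_line hinf hi (Chain.mem_P_append.1 hp).2 hJ hne ?_
    simpa using h
  · intro i _ p _ r hr hJ hmono l hl hlpr R hR hlt ht
    exact strip_step hI (Chain.mem_P_append.1 hr).1 (Chain.mem_P_append.1 hr).2 hJ hmono hl hlpr
      hR hlt ht

end Gadget

end CircuitWalks

/-! ### Short walks in the strip of a feasible instance -/

namespace CircuitWalks

section Reaches

variable {rows : List HalfPlane} {s c : Fin 2 → ℚ}

/-- There is a monotone circuit walk of length `k` from `x` to an optimum. -/
def Reaches (D : PlanarData) (k : ℕ) (x : Fin 2 → ℝ) : Prop :=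
  ∃ f : ℕ → Fin 2 → ℝ, f 0 = x ∧ (∀ i ≤ k, f i ∈ D.P) ∧
    (∀ i < k, IsCircuitMove D.realA D.realB (f i) (f (i + 1))) ∧
    (∀ i < k, D.realC ⬝ᵥ f i < D.realC ⬝ᵥ f (i + 1)) ∧
    IsMaxOn (fun y => D.realC ⬝ᵥ y) D.P (f k)

theorem Reaches.refl {D : PlanarData} {x : Fin 2 → ℝ} (hx : x ∈ D.P)
    (hmax : IsMaxOn (fun y => D.realC ⬝ᵥ y) D.P x) : Reaches D 0 x :=
  ⟨fun _ => x, rfl, fun _ _ => hx, fun i hi => absurd hi (Nat.not_lt_zero i),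
    fun i hi => absurd hi (Nat.not_lt_zero i), hmax⟩

theorem Reaches.cons {D : PlanarData} {k : ℕ} {x y : Fin 2 → ℝ} (hx : x ∈ D.P)
    (hxy : IsCircuitMove D.realA D.realB x y) (hlt : D.realC ⬝ᵥ x < D.realC ⬝ᵥ y)
    (h : Reaches D k y) : Reaches D (k + 1) x := by
  obtain ⟨f, h0, h1, h2, h3, h4⟩ := h
  refine ⟨fun i => Nat.casesOn i x f, rfl, ?_, ?_, ?_, h4⟩
  · rintro (_ | i) hi
    · exact hx
    · exact h1 i (by omega)
  · rintro (_ | i) hi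
    · simpa [h0] using hxy
    · exact h2 i (by omega)
  · rintro (_ | i) hi
    · simpa [h0] using hlt
    · exact h3 i (by omega)

theorem Reaches.dist_le {k : ℕ} (h : Reaches (PlanarData.ofRows rows s c) k
    (PlanarData.ofRows rows s c).realS) : (PlanarData.ofRows rows s c).dist ≤ k := by
  obtain ⟨f, h0, h1, h2, h3, h4⟩ := h
  exact dist_le_of_sequence f h0 h1 h2 h3 h4

end Reaches

namespace Gadget

variable {G : Gadget} {items : List ℕ}

theorem apex_reaches (hI : Admissible G.S items) :
    Reaches (strip G items) 0 (G.chain.apex G.m) := by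
  refine Reaches.refl (Chain.apex_mem_P (c := G.chain) (strip_corner hI)) fun y hy => ?_
  simp only [realC_heightCost, Set.mem_ofPred_eq]
  by_contra! h
  rw [Chain.eq_apex_of_le (c := G.chain) (Chain.mem_P_append.1 hy).2 h.le] at h
  exact lt_irrefl _ h

/-- Walking back and forth once for each number, then to the apex. -/
theorem strip_reaches (hI : Admissible G.S items) (bs : List ℕ) (hbs : ∀ b ∈ bs, b ∈ items)
    (hne : bs ≠ []) (A e : ℕ) (hA : A + bs.sum = G.S) (he : e + bs.length = G.k) :
    Reaches (strip G items) (2 * bs.length)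
      ![0, w G.S * U G.m G.k G.S * (M G.m G.k * A + N G.m * e)] := by
  have hB := G.realBounds
  have hU := hB.U_one
  have hUw := hB.U_le
  have hN := hB.N_pos
  have hM := hB.M_pos
  have hw := hB.w_eq
  have hS := hB.S_pos
  have hW : (0 : ℝ) < w G.S * U G.m G.k G.S := by linarith
  induction bs generalizing A e with
  | nil => exact absurd rfl hne
  | cons b bs ih =>
    have hb : b ∈ items := hbs b (by simp)
    have hb1 : (1 : ℝ) ≤ b := by exact_mod_cast (hI.2 b hb).1
    have hMb : 0 < (M G.m G.k : ℝ) * b := mul_pos (by linarith) (by linarith)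
    simp only [List.sum_cons, List.length_cons] at hA he
    have hA' : (A : ℝ) + b ≤ G.S := by exact_mod_cast (show A + b ≤ G.S by omega)
    have he' : (e : ℝ) + 1 ≤ G.k := by exact_mod_cast (show e + 1 ≤ G.k by omega)
    have h1 : (M G.m G.k : ℝ) * (A + b) ≤ M G.m G.k * G.S :=
      mul_le_mul_of_nonneg_left hA' (by linarith)
    have h2 : (N G.m : ℝ) * (e + 1) ≤ N G.m * G.k := mul_le_mul_of_nonneg_left he' (by linarith)
    have h3 : 0 ≤ (M G.m G.k : ℝ) * A := mul_nonneg (by linarith) (by positivity)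
    have h4 : 0 ≤ (N G.m : ℝ) * e := mul_nonneg (by linarith) (by positivity)
    have h5 : (M G.m G.k : ℝ) * 1 ≤ M G.m G.k * b := mul_le_mul_of_nonneg_left hb1 (by linarith)
    have hH := hB.H_eq
    have hleft := strip_low_mem (G := G) (x := 0) (Y := M G.m G.k * A + N G.m * e) hI
      (Or.inl ⟨rfl, by linarith⟩) (by linarith)
    have hright := strip_low_mem (G := G) (Y := M G.m G.k * (A + b) + N G.m * e) hI
      (Or.inr ⟨rfl, by linarith⟩) (by linarith)
    have hmem : ∀ R, R = leftRow ∨ R = bottomRow G.m ∨ R = rightRow G.m G.k G.S ∨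
        (∃ a ∈ items, R = itemRow G.m G.k G.S a) →
        R ∈ stripBase G.m G.k G.S items ++ G.chain.rows :=
      fun R hR => List.mem_append_left _ (mem_stripBase.2 hR)
    rw [List.length_cons, show 2 * (bs.length + 1) = 2 * bs.length + 1 + 1 by ring]
    refine Reaches.cons hleft (isCircuitMove_of_rows hright (l := itemRow G.m G.k G.S b)
      (R := rightRow G.m G.k G.S) (hmem _ (Or.inr (Or.inr (Or.inr ⟨b, hb, rfl⟩)))) (by simp [itemRow]) ?_
      (hmem _ (Or.inr (Or.inr (Or.inl rfl)))) ?_ ?_) ?_ ?_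
    · simp only [HalfPlane.form, itemRow, Matrix.cons_val_zero, Matrix.cons_val_one,
        Matrix.cons_val_fin_one]
      push_cast
      ring
    · simpa [HalfPlane.form, rightRow] using hW
    · simp [HalfPlane.form, rightRow]
    · simp only [realC_heightCost, Matrix.cons_val_one, Matrix.cons_val_fin_one]
      exact mul_lt_mul_of_pos_left (by linarith) hW
    · rcases eq_or_ne bs [] with rfl | hne'
      · have hAS : (A : ℝ) + b = G.S := by
          exact_mod_cast (show A + b = G.S by simpa using hA)
        have hek : (e : ℝ) + 1 = G.k := by exact_mod_cast (show e + 1 = G.k by simpa using he)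
        have hu := (Chain.mem_P_append.1 hright).2
        have hap : G.chain.apex G.m 0 ≤ U G.m G.k G.S := (Chain.apex_corner (c := G.chain)).2.1
        have htop : (G.chain.left G.m).form (G.chain.apex G.m) = (G.chain.left G.m).c :=
          Chain.left_apex (c := G.chain)
        have hmm : G.chain.left G.m ∈ G.chain.rows := Chain.mem_rows_left G.one_le_m le_rfl
        have hline : (N G.m : ℝ) * G.chain.apex G.m 0 + G.chain.apex G.m 1 =
            H G.m G.k G.S * w G.S * U G.m G.k G.S := by
          simp [Chain.apex]
        have hap' : (G.chain.apex G.m 0 : ℝ) < w G.S * U G.m G.k G.S := by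
          have : 2 * (U G.m G.k G.S : ℝ) ≤ w G.S * U G.m G.k G.S :=
            mul_le_mul_of_nonneg_right (by nlinarith) (by linarith)
          linarith
        have hY : (M G.m G.k : ℝ) * (A + b) + N G.m * e = H G.m G.k G.S - N G.m := by
          rw [hAS, hH, ← hek]; ring
        refine Reaches.cons hright (isCircuitMove_of_rows
          (Chain.apex_mem_P (c := G.chain) (strip_corner hI)) (l := bottomRow G.m)
          (R := G.chain.left G.m) (hmem _ (Or.inr (Or.inl rfl))) (by simp [bottomRow]) ?_
          (List.mem_append_right _ hmm) ?_ ?_) ?_ (apex_reaches hI)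
        · simp only [HalfPlane.form, bottomRow, Matrix.cons_val_zero, Matrix.cons_val_one,
            Matrix.cons_val_fin_one, hY, chain_m]
          push_cast
          linarith
        · refine lt_of_lt_of_eq ?_ htop.symm
          refine lt_of_le_of_ne (hu _ hmm) fun h => ?_
          have h := Chain.lt_of_tight (c := G.chain) (W := w G.S * U G.m G.k G.S) hUw
            (by simpa using hW.le) (by simp) hmm h
          simp only [Matrix.cons_val_one, Matrix.cons_val_fin_one, hY, chain_h, chain_N,
            chain_U] at h
          push_cast at h
          linarith
        · exact htop
        · simp only [realC_heightCost, Matrix.cons_val_one, Matrix.cons_val_fin_one, hY, chain_m]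
          have := mul_lt_mul_of_pos_left hap' (show (0 : ℝ) < N G.m by linarith)
          linarith
      · have hne1 : 1 ≤ bs.length := List.length_pos_of_ne_nil hne'
        have he'' : (e : ℝ) + 2 ≤ G.k := by exact_mod_cast (show e + 2 ≤ G.k by omega)
        have h6 : (N G.m : ℝ) * (e + 2) ≤ N G.m * G.k :=
          mul_le_mul_of_nonneg_left he'' (by linarith)
        have hleft' := strip_low_mem (G := G) (x := 0)
          (Y := M G.m G.k * (A + b : ℕ) + N G.m * (e + 1 : ℕ)) hI
          (Or.inl ⟨rfl, by push_cast; linarith⟩) (by push_cast; linarith)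
        refine Reaches.cons hright (isCircuitMove_of_rows hleft' (l := bottomRow G.m)
          (R := leftRow) (hmem _ (Or.inr (Or.inl rfl))) (by simp [bottomRow]) ?_
          (hmem _ (Or.inl rfl)) ?_ ?_) ?_
          (ih (fun b' hb' => hbs b' (by simp [hb'])) hne' (A + b) (e + 1) (by omega) (by omega))
        · simp only [HalfPlane.form, bottomRow, Matrix.cons_val_zero, Matrix.cons_val_one,
            Matrix.cons_val_fin_one]
          push_cast
          ring
        · simpa [HalfPlane.form, leftRow] using hW
        · simp [HalfPlane.form, leftRow]
        · simp only [realC_heightCost, Matrix.cons_val_one, Matrix.cons_val_fin_one]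
          push_cast
          exact mul_lt_mul_of_pos_left (by linarith) hW

theorem dist_strip_le (hI : Admissible G.S items) (bs : List ℕ) (hbs : ∀ b ∈ bs, b ∈ items)
    (hsum : bs.sum = G.S) (hlen : bs.length = G.k) :
    (strip G items).dist ≤ ((2 * G.k : ℕ) : ℕ∞) := by
  refine Reaches.dist_le ?_
  have hne : bs ≠ [] := by
    rintro rfl
    have := G.one_le_k
    simp at hlen
    omega
  have h := strip_reaches hI bs hbs hne 0 0 (by omega) (by omega)
  rw [hlen] at h
  convert h using 1
  ext j
  fin_cases j <;> simp [PlanarData.realS]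

theorem strip_zero_extreme (hI : Admissible G.S items) :
    (strip G items).realS ∈ Set.extremePoints ℝ (strip G items).P := by
  have h0 := strip_zero_mem (G := G) hI
  refine zero_mem_extremePoints (N := N G.m) (fun R hR => ?_) fun x hx => ⟨?_, ?_⟩
  · have := mem_P_iff.1 h0 R hR
    simpa [HalfPlane.Holds, HalfPlane.form] using this
  · exact holds_left.1 (hx _ (List.mem_append_left _ (mem_stripBase.2 (Or.inl rfl))))
  · exact holds_bottom.1 (hx _ (List.mem_append_left _ (mem_stripBase.2 (Or.inr (Or.inl rfl)))))

theorem strip_length : (stripBase G.m G.k G.S items ++ G.chain.rows).length =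
    items.length + 3 + 2 * G.m := by
  simp [stripBase, Chain.rows_length]
  omega

theorem chain_rows_nonzero : ∀ R ∈ G.chain.rows, R.a ≠ 0 ∨ R.b ≠ 0 := by
  intro R hR
  obtain ⟨j, h1j, hj, rfl | rfl⟩ := G.chain.mem_rows.1 hR
  · left
    have := G.chain.K_pos
    simp only [Chain.left]
    omega
  · right
    simp [Chain.right]

theorem encard_edges_strip :
    (polygonEdges (strip G items).P).encard ≤ ((items.length + 3 + 2 * G.m : ℕ) : ℕ∞) := by
  rw [← strip_length (G := G) (items := items)]
  refine encard_polygonEdges_le fun R hR => ?_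
  rcases List.mem_append.1 hR with h | h
  · revert R
    refine fun R _ h => forall_stripBase (P := fun R => R.a ≠ 0 ∨ R.b ≠ 0) ?_ ?_ ?_ ?_ R h
    · simp [leftRow]
    · simp [bottomRow]
    · simp [rightRow]
    · simp [itemRow]
  · exact chain_rows_nonzero R h

/-! ### The wedge and the triangle -/

/-- The data of the wedge. -/
abbrev wedge (G : Gadget) : PlanarData :=
  PlanarData.ofRows (wedgeBase ++ G.chain.rows) 0 heightCost

theorem wedge_corner (r : Fin 2 → ℝ) (hr : G.chain.Corner r) : ∀ R ∈ wedgeBase, R.Holds r := by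
  have hB := G.realBounds
  have hlow := hB.low
  have hU := hB.U_one
  have hUw := hB.U_le
  have hN := hB.N_pos
  have hMS : 0 ≤ (M G.m G.k : ℝ) * G.S * (w G.S * U G.m G.k G.S) :=
    mul_nonneg (mul_nonneg (by linarith [hB.M_pos]) (by linarith [hB.S_pos])) (by linarith)
  have h8 : 8 * (w G.S * U G.m G.k G.S : ℝ) ≤ N G.m * (w G.S * U G.m G.k G.S) :=
    mul_le_mul_of_nonneg_right hN (by linarith)
  obtain ⟨h0, -, h2, -⟩ := hr
  simp only [chain_U, chain_h] at h2
  push_cast at h2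
  intro R hR
  simp only [wedgeBase, List.mem_cons, List.not_mem_nil, or_false] at hR
  rcases hR with rfl | rfl
  · exact holds_left.2 h0
  · simp [HalfPlane.Holds, HalfPlane.form]
    linarith

theorem holds_wedge {r : Fin 2 → ℝ} :
    (∀ R ∈ wedgeBase, R.Holds r) ↔ 0 ≤ r 0 ∧ 0 ≤ r 1 := by
  simp [wedgeBase, HalfPlane.Holds, HalfPlane.form, leftRow]

theorem wedge_under {x y : ℝ} (hx : -1 ≤ x) (hx1 : x ≤ 1) (hy : y ≤ 2) :
    G.chain.Under ![x, y] := by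
  have hB := G.realBounds
  have hlow := hB.low
  have hU := hB.U_one
  have hUw := hB.U_le
  have hN := hB.N_pos
  have hMS : 1 ≤ (M G.m G.k : ℝ) * G.S :=
    one_le_mul_of_one_le_of_one_le (by linarith [hB.M_pos]) hB.S_pos
  have hMSW := le_mul_of_one_le_left (show 0 ≤ (w G.S * U G.m G.k G.S : ℝ) by linarith) hMS
  refine Chain.under_of_low (W := w G.S * U G.m G.k G.S) hUw (by simpa using hx) ?_ ?_
  · simp only [Matrix.cons_val_zero]; linarith
  · simp only [Matrix.cons_val_one, Matrix.cons_val_fin_one, chain_h, chain_U, chain_N]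
    push_cast
    linarith

theorem wedge_zero_mem : (0 : Fin 2 → ℝ) ∈ (wedge G).P := by
  refine Chain.mem_P_append.2 ⟨by simp [holds_wedge], ?_⟩
  convert wedge_under (G := G) (x := 0) (y := 0) (by norm_num) (by norm_num) (by norm_num) using 1
  ext j
  fin_cases j <;> simp

theorem wedge_describesPolygon : (wedge G).DescribesPolygon := by
  refine Chain.describesPolygon (c := G.chain) (by simp [wedgeBase, leftRow]) ?_ ?_ ?_
    wedge_corner ?_
  · intro R hR hR'
    have hK := G.chain.K_pos
    obtain ⟨j, h1j, hj, h⟩ := G.chain.mem_rows.1 hR'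
    simp only [wedgeBase, leftRow, List.mem_cons, List.not_mem_nil, or_false] at hR
    rcases h with rfl | rfl <;> rcases hR with h | h <;>
      simp only [Chain.left, Chain.right, HalfPlane.mk.injEq] at h <;> omega
  · refine ⟨(G.chain.h * G.chain.U : ℤ), fun r hr hu => ?_⟩
    obtain ⟨h0, h1⟩ := holds_wedge.1 hr
    have := hu.add_le
    rw [abs_of_nonneg h0, abs_of_nonneg h1]
    constructor <;> linarith
  · refine ⟨![1 / 2, 1 / 2], ?_, ?_⟩
    · simp [wedgeBase, HalfPlane.form, leftRow]
    · exact wedge_under (by simp; norm_num) (by simp; norm_num) (by simp; norm_num)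
  · intro R hR
    simp only [wedgeBase, List.mem_cons, List.not_mem_nil, or_false] at hR
    rcases hR with rfl | rfl
    · refine ⟨![-1, 0], wedge_under (by norm_num) (by norm_num) (by norm_num), ?_, ?_⟩
      · simp [wedgeBase, HalfPlane.Holds, HalfPlane.form]
      · simp [HalfPlane.Holds, HalfPlane.form, leftRow]
    · refine ⟨![0, -1], wedge_under (by norm_num) (by norm_num) (by norm_num), ?_, ?_⟩
      · simp [wedgeBase, HalfPlane.Holds, HalfPlane.form, leftRow]
      · simp [HalfPlane.Holds, HalfPlane.form]

theorem lt_dist_wedge : (G.m : ℕ∞) < (wedge G).dist := by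
  have h1 : 0 < K G.m G.k G.S := G.chain.K_pos
  have hN := G.N_pos
  refine Chain.lt_dist (c := G.chain) ?_ wedge_corner (fun _ _ => True) trivial ?_
    (by intros; trivial) ?_
  · intro R hR
    simp only [wedgeBase, leftRow, List.mem_cons, List.not_mem_nil, or_false] at hR
    rcases hR with rfl | rfl <;> simp <;> omega
  · intro i _ p _ _ _ l hl h
    exfalso
    have hm := G.one_le_m
    rcases List.mem_append.1 hl with hl | hl
    · simp only [wedgeBase, leftRow, List.mem_cons, List.not_mem_nil, or_false] at hl
      rcases hl with rfl | rfl <;> simp at h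
      omega
    · obtain ⟨j, h1j, hj, rfl | rfl⟩ := G.chain.mem_rows.1 hl
      · simp only [Chain.left, chain_N, chain_K] at h
        have : 0 ≤ N G.m * (j : ℤ) := mul_nonneg (by linarith) (by positivity)
        omega
      · simp only [Chain.right, Chain.rho, chain_N, chain_m, N] at h
        omega
  · exact wedge_zero_mem

theorem wedge_zero_extreme :
    (wedge G).realS ∈ Set.extremePoints ℝ (wedge G).P := by
  refine zero_mem_extremePoints (N := 0) (fun R hR => ?_) fun x hx => ?_
  · have := mem_P_iff.1 (wedge_zero_mem (G := G)) R hR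
    simpa [HalfPlane.Holds, HalfPlane.form] using this
  · obtain ⟨h0, h1⟩ := holds_wedge.1 fun R hR => hx R (List.mem_append_left _ hR)
    exact ⟨h0, by linarith⟩

theorem encard_edges_wedge :
    (polygonEdges (wedge G).P).encard ≤ ((2 * G.m + 2 : ℕ) : ℕ∞) := by
  have h : (wedgeBase ++ G.chain.rows).length = 2 * G.m + 2 := by
    simp [wedgeBase, Chain.rows_length]
  rw [← h]
  refine encard_polygonEdges_le fun R hR => ?_
  rcases List.mem_append.1 hR with h | h
  · simp only [wedgeBase, leftRow, List.mem_cons, List.not_mem_nil, or_false] at h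
    rcases h with rfl | rfl <;> simp
  · exact chain_rows_nonzero R h

/-- The rows of the triangle with the vertices `(0, 0)`, `(1, 0)` and `(0, 1)`. -/
def triangleRows : List HalfPlane := [⟨-1, 0, 0⟩, ⟨0, -1, 0⟩, ⟨1, 1, 1⟩]

/-- The data of the triangle, with the cost vector `(S, 0)`. -/
abbrev triangle (S : ℕ) : PlanarData := PlanarData.ofRows triangleRows 0 ![S, 0]

theorem holds_triangle {r : Fin 2 → ℝ} :
    (∀ R ∈ triangleRows, R.Holds r) ↔ 0 ≤ r 0 ∧ 0 ≤ r 1 ∧ r 0 + r 1 ≤ 1 := by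
  simp [triangleRows, HalfPlane.Holds, HalfPlane.form]

theorem triangle_describesPolygon (S : ℕ) : (triangle S).DescribesPolygon := by
  refine describesPolygon_of (by simp [triangleRows]) ⟨1, fun x hx => ?_⟩ ⟨![1 / 3, 1 / 3], ?_⟩ ?_
  · obtain ⟨h0, h1, h2⟩ := holds_triangle.1 hx
    rw [abs_of_nonneg h0, abs_of_nonneg h1]
    constructor <;> linarith
  · simp [triangleRows, HalfPlane.form]
    norm_num
  · intro R hR
    simp only [triangleRows, List.mem_cons, List.not_mem_nil, or_false] at hR
    rcases hR with rfl | rfl | rfl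
    · exact ⟨![-1, 0], by simp [triangleRows, HalfPlane.Holds, HalfPlane.form]⟩
    · exact ⟨![0, -1], by simp [triangleRows, HalfPlane.Holds, HalfPlane.form]⟩
    · exact ⟨![1, 1], by simp [triangleRows, HalfPlane.Holds, HalfPlane.form]⟩

theorem triangle_zero_extreme (S : ℕ) :
    (triangle S).realS ∈ Set.extremePoints ℝ (triangle S).P := by
  refine zero_mem_extremePoints (N := 0) (fun R hR => ?_) fun x hx => ?_
  · simp only [triangleRows, List.mem_cons, List.not_mem_nil, or_false] at hR
    rcases hR with rfl | rfl | rfl <;> simp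
  · obtain ⟨h0, h1, -⟩ := holds_triangle.1 hx
    exact ⟨h0, by linarith⟩

theorem encard_edges_triangle (S : ℕ) : (polygonEdges (triangle S).P).encard ≤ 3 := by
  refine encard_polygonEdges_le (rows := triangleRows) fun R hR => ?_
  simp only [triangleRows, List.mem_cons, List.not_mem_nil, or_false] at hR
  rcases hR with rfl | rfl | rfl <;> simp

theorem triangle_realC (S : ℕ) (x : Fin 2 → ℝ) : (triangle S).realC ⬝ᵥ x = S * x 0 := by
  simp [PlanarData.realC, dotProduct, Fin.sum_univ_two]

theorem triangle_zero_mem (S : ℕ) : (0 : Fin 2 → ℝ) ∈ (triangle S).P :=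
  mem_P_iff.2 (holds_triangle.2 (by simp))

theorem triangle_realS (S : ℕ) : (triangle S).realS = 0 := by
  ext i; simp [PlanarData.realS]

/-- For `S = 0` the cost vector vanishes, and every point is optimal. -/
theorem dist_triangle_zero : (triangle 0).dist ≤ 0 := by
  refine Reaches.dist_le (k := 0) ?_
  rw [triangle_realS]
  refine Reaches.refl (triangle_zero_mem 0) fun y _ => ?_
  simp only [triangle_realC, Set.mem_ofPred_eq]
  simp

theorem dist_triangle_le_one (S : ℕ) : (triangle S).dist ≤ 1 := by
  rcases Nat.eq_zero_or_pos S with rfl | hS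
  · exact dist_triangle_zero.trans (by simp)
  · have hS' : (0 : ℝ) < S := by exact_mod_cast hS
    refine Reaches.dist_le (k := 1) ?_
    rw [triangle_realS]
    have h1 : (![1, 0] : Fin 2 → ℝ) ∈ (triangle S).P := mem_P_iff.2 (holds_triangle.2 (by simp))
    refine Reaches.cons (triangle_zero_mem S) (isCircuitMove_of_rows h1 (l := ⟨0, -1, 0⟩)
      (R := ⟨1, 1, 1⟩) (by simp [triangleRows]) (by simp) (by simp [HalfPlane.form])
      (by simp [triangleRows]) (by simp [HalfPlane.form]) (by simp [HalfPlane.form])) ?_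
      (Reaches.refl h1 fun y hy => ?_)
    · rw [triangle_realC, triangle_realC]
      simpa using hS
    · obtain ⟨h0, h2, h3⟩ := holds_triangle.1 (mem_P_iff.1 hy)
      simp only [triangle_realC, Set.mem_ofPred_eq]
      exact mul_le_mul_of_nonneg_left (by simp; linarith) hS'.le

theorem dist_triangle_pos {S : ℕ} (hS : 0 < S) : 0 < (triangle S).dist := by
  have hS' : (0 : ℝ) < S := by exact_mod_cast hS
  refine lt_dist_of_invariant (fun _ p => p = 0) (triangle_realS S) ?_ ?_
  · intro i hi; omega
  · rintro i - p rfl hmax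
    have h1 : (![1, 0] : Fin 2 → ℝ) ∈ (triangle S).P := mem_P_iff.2 (holds_triangle.2 (by simp))
    have := hmax h1
    simp only [triangle_realC, Set.mem_ofPred_eq] at this
    simp at this
    omega

end Gadget

end CircuitWalks

/-! ### The polygon of an instance -/

namespace ExactSubsetSumInstance

open CircuitWalks

variable (I : ExactSubsetSumInstance)

theorem one_le_S (hk : I.k ≠ 0) : 1 ≤ I.S := by
  by_contra! h
  have := I.exact 0 (by simp; omega)
  simp at this
  omega

theorem pos_of_not_feasible (h : ¬ I.Feasible) : 0 < I.S :=
  Nat.pos_of_ne_zero fun h0 => h ⟨0, by simp [h0]⟩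

/-- The numbers that may occur in a solution. -/
def usableNumbers : List ℕ := (List.ofFn I.a).filter fun a => 1 ≤ a ∧ a ≤ I.S

theorem admissible_usableNumbers : Gadget.Admissible I.S I.usableNumbers :=
  ⟨(List.nodup_ofFn.2 I.distinct).filter _, fun a ha => by simpa using (List.mem_filter.1 ha).2⟩

theorem usableNumbers_length : I.usableNumbers.length ≤ I.n :=
  (List.length_filter_le _ _).trans (by simp)

/-- A number that is used by a solution is positive: a zero could be used once more. -/
theorem mem_usableNumbers {r : Fin I.n → ℕ} (hr : ∑ i, r i * I.a i = I.S) {i : Fin I.n}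
    (hi : r i ≠ 0) : I.a i ∈ I.usableNumbers := by
  have hle : r i * I.a i ≤ I.S := hr ▸ Finset.single_le_sum (f := fun i => r i * I.a i)
    (fun _ _ => Nat.zero_le _) (Finset.mem_univ i)
  refine List.mem_filter.2 ⟨List.mem_ofFn.2 ⟨i, rfl⟩, ?_⟩
  have h1 : 1 ≤ I.a i := by
    by_contra! h0
    have h1 := I.exact r hr
    have h2 := I.exact (r + Pi.single i 1) (by
      simp only [Pi.add_apply, add_mul, Finset.sum_add_distrib, hr]
      simp [Pi.single_apply]
      omega)
    simp [Finset.sum_add_distrib, h1] at h2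
  have h2 : 1 * I.a i ≤ r i * I.a i := Nat.mul_le_mul_right _ (by omega)
  simp
  omega

/-- A solution, as a list of numbers with repetition. -/
theorem exists_list_of_feasible (h : I.Feasible) :
    ∃ bs : List ℕ, (∀ b ∈ bs, b ∈ I.usableNumbers) ∧ bs.sum = I.S ∧ bs.length = I.k := by
  obtain ⟨r, hr⟩ := h
  refine ⟨(List.ofFn fun i => List.replicate (r i) (I.a i)).flatten, ?_, ?_, ?_⟩
  · intro b hb
    obtain ⟨l, hl, hb⟩ := List.mem_flatten.1 hb
    obtain ⟨i, rfl⟩ := List.mem_ofFn.1 hl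
    obtain ⟨hi, rfl⟩ := List.mem_replicate.1 hb
    exact I.mem_usableNumbers hr hi
  · rw [List.sum_flatten, List.map_ofFn, List.sum_ofFn]
    simpa using hr
  · rw [List.length_flatten, List.map_ofFn, List.sum_ofFn]
    simpa using I.exact r hr

theorem feasible_of_mem_closure (h : I.S ∈ AddSubmonoid.closure {a | a ∈ I.usableNumbers}) :
    I.Feasible := by
  have key : ∀ x ∈ AddSubmonoid.closure {a | a ∈ I.usableNumbers},
      ∃ r : Fin I.n → ℕ, ∑ i, r i * I.a i = x := by
    intro x hx
    induction hx using AddSubmonoid.closure_induction with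
    | mem x hx =>
      obtain ⟨i, rfl⟩ := List.mem_ofFn.1 (List.mem_filter.1 hx).1
      exact ⟨Pi.single i 1, by simp [Pi.single_apply]⟩
    | zero => exact ⟨0, by simp⟩
    | add x y _ _ hx hy =>
      obtain ⟨r, rfl⟩ := hx
      obtain ⟨s, rfl⟩ := hy
      exact ⟨r + s, by simp [add_mul, Finset.sum_add_distrib]⟩
  exact key _ h

/-- The first two numbers, where a missing number is replaced by `0`. -/
def number (j : ℕ) : ℤ := (List.ofFn fun i => (I.a i : ℤ)).getD j 0

/-- For at most two numbers, this product vanishes exactly for the feasible instances. -/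
def test : ℤ := (I.S - I.number 0) * (I.S - I.number 1) * (I.S - 2 * I.number 0) *
  (I.S - I.number 0 - I.number 1) * (I.S - 2 * I.number 1)

theorem test_eq_zero_iff (hk : I.k ≠ 0) (hn : I.n ≤ 2) : I.test = 0 ↔ I.Feasible := by
  obtain ⟨n, a, S, k, hd, hkn, hex⟩ := I
  simp only at hk hn hkn
  simp only [test, number, Feasible, mul_eq_zero, sub_eq_zero]
  obtain rfl | rfl : n = 1 ∨ n = 2 := by omega
  · have hk1 : k = 1 := by omega
    subst hk1
    simp only [Fin.sum_univ_one, List.ofFn_succ, List.ofFn_zero] at hex ⊢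
    simp
    constructor
    · rintro ((((h | h) | h) | h) | h)
      · exact ⟨1, by simp; omega⟩
      · exact ⟨0, by simp; omega⟩
      · exact ⟨2, by simp; omega⟩
      · exact ⟨1, by simp; omega⟩
      · exact ⟨0, by simp; omega⟩
    · rintro ⟨r, hr⟩
      have := hex r hr
      simp [this] at hr
      omega
  · simp only [Fin.sum_univ_two, List.ofFn_succ, List.ofFn_zero] at hex ⊢
    simp
    constructor
    · rintro ((((h | h) | h) | h) | h)
      · exact ⟨![1, 0], by simp; omega⟩
      · exact ⟨![0, 1], by simp; omega⟩
      · exact ⟨![2, 0], by simp; omega⟩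
      · exact ⟨![1, 1], by simp; omega⟩
      · exact ⟨![0, 2], by simp; omega⟩
    · rintro ⟨r, hr⟩
      have h1 := hex r hr
      have h2 : r 0 ≤ 2 := by omega
      have h3 : r 1 ≤ 2 := by omega
      generalize r 0 = x at *
      generalize r 1 = y at *
      interval_cases x <;> interval_cases y <;> omega

/-- The parameters of the construction for the instance. -/
def gadget (C : ℕ) (h : C * I.k ≠ 0) : Gadget where
  m := C * I.k
  k := I.k
  S := I.S
  one_le_m := Nat.one_le_iff_ne_zero.2 h
  one_le_k := Nat.one_le_iff_ne_zero.2 (right_ne_zero_of_mul h)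
  one_le_S := I.one_le_S (right_ne_zero_of_mul h)

/-- The polygon of the reduction: the strip, except in the trivial case `C k = 0` and for at most
two numbers, when feasibility can be decided directly. -/
def polygon (C : ℕ) : PlanarData :=
  if h : C * I.k = 0 then Gadget.triangle I.S
  else if I.n ≤ 2 then
    if I.test = 0 then Gadget.triangle I.S else Gadget.wedge (I.gadget C h)
  else Gadget.strip (I.gadget C h) I.usableNumbers

/-- The required properties of the polygon, apart from its size and the running time. -/
theorem polygon_spec (C : ℕ) :
    (I.polygon C).DescribesPolygon ∧
    (I.polygon C).realS ∈ Set.extremePoints ℝ (I.polygon C).P ∧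
    (I.Feasible → (I.polygon C).dist ≤ ((2 * I.k : ℕ) : ℕ∞)) ∧
    (¬ I.Feasible → ((C * I.k : ℕ) : ℕ∞) < (I.polygon C).dist) ∧
    (polygonEdges (I.polygon C).P).encard ≤ ((max 3 (2 * C * I.k + 2 * I.n) : ℕ) : ℕ∞) := by
  have htri : (polygonEdges (Gadget.triangle I.S).P).encard ≤
      ((max 3 (2 * C * I.k + 2 * I.n) : ℕ) : ℕ∞) :=
    (Gadget.encard_edges_triangle I.S).trans (by exact_mod_cast le_max_left _ _)
  unfold polygon
  split_ifs with h0 hn ht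
  · refine ⟨Gadget.triangle_describesPolygon _, Gadget.triangle_zero_extreme _, fun hf => ?_,
      fun hf => ?_, htri⟩
    · rcases Nat.eq_zero_or_pos I.k with hk | hk
      · obtain ⟨r, hr⟩ := hf
        have h1 := I.exact r hr
        rw [hk, Finset.sum_eq_zero_iff] at h1
        have hS : I.S = 0 := by
          rw [← hr]
          exact Finset.sum_eq_zero fun i hi => by rw [h1 i hi, zero_mul]
        rw [hS, hk]
        exact Gadget.dist_triangle_zero
      · exact (Gadget.dist_triangle_le_one _).trans (by exact_mod_cast (by omega : 1 ≤ 2 * I.k))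
    · rw [h0]
      exact Gadget.dist_triangle_pos (I.pos_of_not_feasible hf)
  · have hk := right_ne_zero_of_mul h0
    refine ⟨Gadget.triangle_describesPolygon _, Gadget.triangle_zero_extreme _, fun _ =>
      (Gadget.dist_triangle_le_one _).trans (by exact_mod_cast (by omega : 1 ≤ 2 * I.k)),
      fun hf => absurd ((I.test_eq_zero_iff hk hn).1 ht) hf, htri⟩
  · have hk := right_ne_zero_of_mul h0
    refine ⟨Gadget.wedge_describesPolygon, Gadget.wedge_zero_extreme, fun hf =>
      absurd ((I.test_eq_zero_iff hk hn).2 hf) ht, fun _ => Gadget.lt_dist_wedge,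
      Gadget.encard_edges_wedge.trans ?_⟩
    have hkn := I.k_le
    have h1 : 2 * (C * I.k) + 2 ≤ max 3 (2 * C * I.k + 2 * I.n) := by
      rw [← mul_assoc]
      exact le_max_of_le_right (by omega)
    exact_mod_cast h1
  · have hI := I.admissible_usableNumbers
    refine ⟨Gadget.strip_describesPolygon hI, Gadget.strip_zero_extreme hI, fun hf => ?_,
      fun hf => Gadget.lt_dist_strip hI fun h => hf (I.feasible_of_mem_closure h),
      Gadget.encard_edges_strip.trans ?_⟩
    · obtain ⟨bs, h1, h2, h3⟩ := I.exists_list_of_feasible hf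
      exact Gadget.dist_strip_le hI bs h1 h2 h3
    · have hl := I.usableNumbers_length
      have h1 : I.usableNumbers.length + 3 + 2 * (C * I.k) ≤ max 3 (2 * C * I.k + 2 * I.n) := by
        rw [← mul_assoc]
        exact le_max_of_le_right (by omega)
      exact_mod_cast h1

end ExactSubsetSumInstance

/-! ### The cost of programs on a bounded memory -/

namespace LogCostRAM

open CircuitWalks (bitLength)

/-- All cells contain numbers of at most `B` bits. -/
def State.Bounded (B : ℕ) (σ : State) : Prop := ∀ a i, (σ.mem a i).natAbs < 2 ^ B

theorem State.Bounded.mono {B B' : ℕ} (h : B ≤ B') {σ : State} (hσ : σ.Bounded B) :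
    σ.Bounded B' :=
  fun a i => (hσ a i).trans_le (Nat.pow_le_pow_right (by norm_num) h)

theorem bitLength_le {z : ℤ} {B : ℕ} (h : z.natAbs < 2 ^ B) : bitLength z ≤ B + 1 :=
  Nat.add_le_add_right (Nat.size_le.2 h) 1

/-- A bound for the growth of bit lengths in the evaluation of an expression. -/
def Expr.weight : Expr → ℕ
  | lit z => bitLength z
  | get _ e => e.weight + 1
  | add e f => e.weight + f.weight + 1
  | sub e f => e.weight + f.weight + 1
  | mul e f => e.weight + f.weight

theorem Expr.weight_pos (e : Expr) : 1 ≤ e.weight := by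
  induction e with
  | lit z => simp [weight, bitLength]
  | get a e ih => simp [weight]
  | add e f he hf => simp [weight]
  | sub e f he hf => simp [weight]
  | mul e f he hf => simp only [weight]; omega

theorem natAbs_add_lt {x y : ℤ} {a b c : ℕ} (hx : x.natAbs < 2 ^ a) (hy : y.natAbs < 2 ^ b)
    (hc : a + b + 1 ≤ c) : (x + y).natAbs < 2 ^ c := by
  have h1 : 2 ^ a ≤ 2 ^ (a + b) := Nat.pow_le_pow_right (by norm_num) (by omega)
  have h2 : 2 ^ b ≤ 2 ^ (a + b) := Nat.pow_le_pow_right (by norm_num) (by omega)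
  have h3 : 2 ^ (a + b + 1) ≤ 2 ^ c := Nat.pow_le_pow_right (by norm_num) hc
  have h4 := Int.natAbs_add_le x y
  rw [pow_succ] at h3
  omega

theorem natAbs_mul_lt {x y : ℤ} {a b c : ℕ} (hx : x.natAbs < 2 ^ a) (hy : y.natAbs < 2 ^ b)
    (hc : a + b ≤ c) : (x * y).natAbs < 2 ^ c := by
  rw [Int.natAbs_mul]
  calc x.natAbs * y.natAbs < 2 ^ a * 2 ^ b := Nat.mul_lt_mul'' hx hy
    _ = 2 ^ (a + b) := (pow_add _ _ _).symm
    _ ≤ 2 ^ c := Nat.pow_le_pow_right (by norm_num) hc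

theorem Expr.val_lt {B : ℕ} (hB : 1 ≤ B) {σ : State} (hσ : σ.Bounded B) (e : Expr) :
    (e.val σ).natAbs < 2 ^ (e.weight * B) := by
  induction e with
  | lit z =>
    refine (Nat.lt_size_self z.natAbs).trans_le (Nat.pow_le_pow_right (by norm_num) ?_)
    simp only [weight, bitLength]
    nlinarith
  | get a e ih =>
    exact (hσ _ _).trans_le (Nat.pow_le_pow_right (by norm_num) (by simp only [weight]; nlinarith))
  | add e f he hf => exact natAbs_add_lt he hf (by simp only [weight]; nlinarith)
  | sub e f he hf =>
    rw [val, sub_eq_add_neg]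
    exact natAbs_add_lt he (by rwa [Int.natAbs_neg]) (by simp only [weight]; nlinarith)
  | mul e f he hf => exact natAbs_mul_lt he hf (by simp only [weight]; nlinarith)

theorem Expr.bitLength_val_le {B : ℕ} (hB : 1 ≤ B) {σ : State} (hσ : σ.Bounded B) (e : Expr) :
    bitLength (e.val σ) ≤ e.weight * B + 1 :=
  bitLength_le (e.val_lt hB hσ)

theorem Expr.cost_le {B : ℕ} (hB : 1 ≤ B) {σ : State} (hσ : σ.Bounded B) (e : Expr) :
    e.cost σ ≤ 4 * e.weight ^ 2 * B ^ 2 := by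
  induction e with
  | lit z =>
    have h1 := (lit z).weight_pos
    have h2 : (lit z).weight ≤ (lit z).weight ^ 2 := Nat.le_self_pow (by norm_num) _
    have h3 : 1 ≤ B ^ 2 := Nat.one_le_pow _ _ hB
    have : (lit z).cost σ = (lit z).weight := rfl
    nlinarith
  | get a e ih =>
    have h1 := e.bitLength_val_le hB hσ
    have h2 := bitLength_le (hσ a (e.val σ))
    have h3 : B ≤ B ^ 2 := Nat.le_self_pow (by norm_num) _
    have h4 : e.weight * B ≤ e.weight * B ^ 2 := Nat.mul_le_mul_left _ h3
    have h5 := e.weight_pos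
    simp only [cost, weight]
    nlinarith
  | add e f he hf =>
    have h1 := e.bitLength_val_le hB hσ
    have h2 := f.bitLength_val_le hB hσ
    have h3 : B ≤ B ^ 2 := Nat.le_self_pow (by norm_num) _
    have h4 : e.weight * B ≤ e.weight * B ^ 2 := Nat.mul_le_mul_left _ h3
    have h5 : f.weight * B ≤ f.weight * B ^ 2 := Nat.mul_le_mul_left _ h3
    have h6 : 0 ≤ e.weight * f.weight * B ^ 2 := Nat.zero_le _
    simp only [cost, weight]
    nlinarith
  | sub e f he hf =>
    have h1 := e.bitLength_val_le hB hσ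
    have h2 := f.bitLength_val_le hB hσ
    have h3 : B ≤ B ^ 2 := Nat.le_self_pow (by norm_num) _
    have h4 : e.weight * B ≤ e.weight * B ^ 2 := Nat.mul_le_mul_left _ h3
    have h5 : f.weight * B ≤ f.weight * B ^ 2 := Nat.mul_le_mul_left _ h3
    have h6 : 0 ≤ e.weight * f.weight * B ^ 2 := Nat.zero_le _
    simp only [cost, weight]
    nlinarith
  | mul e f he hf =>
    have h1 := e.bitLength_val_le hB hσ
    have h2 := f.bitLength_val_le hB hσ
    have h3 : 1 ≤ e.weight * B := Nat.mul_pos e.weight_pos hB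
    have h4 : 1 ≤ f.weight * B := Nat.mul_pos f.weight_pos hB
    have h5 : bitLength (e.val σ) * bitLength (f.val σ) ≤ (2 * (e.weight * B)) * (2 * (f.weight * B)) :=
      Nat.mul_le_mul (by omega) (by omega)
    simp only [cost, weight]
    calc _ ≤ 4 * e.weight ^ 2 * B ^ 2 + 4 * f.weight ^ 2 * B ^ 2 +
          (2 * (e.weight * B)) * (2 * (f.weight * B)) := by omega
      _ ≤ _ := by
        have : 0 ≤ e.weight * f.weight * B ^ 2 := Nat.zero_le _
        nlinarith

/-- The result of a program without loops. -/
def Program.exec : Program → State → State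
  | skip, σ => σ
  | set a i e, σ => σ.store a (i.val σ) (e.val σ)
  | out e, σ => σ.write (e.val σ)
  | seq p q, σ => q.exec (p.exec σ)
  | ite e p q, σ => if 0 < e.val σ then p.exec σ else q.exec σ
  | .while _ _, σ => σ

/-- The program does not contain a loop. -/
def Program.LoopFree : Program → Prop
  | skip => True
  | set _ _ _ => True
  | out _ => True
  | seq p q => p.LoopFree ∧ q.LoopFree
  | ite _ p q => p.LoopFree ∧ q.LoopFree
  | .while _ _ => False

/-- The factor by which the bit lengths in the memory grow at most in a program without loops. -/
def Program.growth : Program → ℕ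
  | skip => 1
  | set _ _ e => e.weight
  | out _ => 1
  | seq p q => q.growth * p.growth
  | ite _ p q => p.growth + q.growth
  | .while _ _ => 1

/-- A bound for the cost of a program without loops, in units of the squared bit length. -/
def Program.weight : Program → ℕ
  | skip => 1
  | set _ i e => 3 + 8 * i.weight ^ 2 + 8 * e.weight ^ 2
  | out e => 2 + 8 * e.weight ^ 2
  | seq p q => 1 + p.weight + q.weight * p.growth ^ 2
  | ite e p q => 2 + 8 * e.weight ^ 2 + p.weight + q.weight
  | .while e p => 2 + 8 * e.weight ^ 2 + p.weight

theorem Program.growth_pos : ∀ p : Program, 1 ≤ p.growth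
  | skip => le_rfl
  | set _ _ e => e.weight_pos
  | out _ => le_rfl
  | seq p q => Nat.mul_pos q.growth_pos p.growth_pos
  | ite _ p _ => p.growth_pos.trans (Nat.le_add_right _ _)
  | .while _ _ => le_rfl

theorem State.Bounded.store {B : ℕ} {σ : State} (hσ : σ.Bounded B) {v : ℤ} (a : ℕ) (i : ℤ)
    (hv : v.natAbs < 2 ^ B) : (σ.store a i v).Bounded B := by
  intro a' i'
  simp only [State.store, Function.update_apply]
  split_ifs with h1
  · rw [Function.update_apply]
    split_ifs
    · exact hv
    · exact hσ _ _
  · exact hσ _ _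

theorem one_le_sq {B : ℕ} (hB : 1 ≤ B) : 1 ≤ B ^ 2 := Nat.one_le_pow _ _ hB

/-- The cost of evaluating an expression and storing or testing its value. -/
theorem Expr.cost_add_le {B : ℕ} (hB : 1 ≤ B) {σ : State} (hσ : σ.Bounded B) (e : Expr) :
    e.cost σ + bitLength (e.val σ) ≤ (1 + 8 * e.weight ^ 2) * B ^ 2 := by
  have h1 := e.bitLength_val_le hB hσ
  have h2 := e.cost_le hB hσ
  have h3 : e.weight * B ≤ e.weight ^ 2 * B ^ 2 :=
    Nat.mul_le_mul (Nat.le_self_pow (by norm_num) _) (Nat.le_self_pow (by norm_num) _)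
  have h4 := one_le_sq hB
  nlinarith

/-- A program without loops takes a number of bit operations that is quadratic in the bit length of
the memory, and the bit length grows by a constant factor only. -/
theorem Program.runs_exec : ∀ (p : Program), p.LoopFree → ∀ {B : ℕ} {σ : State}, 1 ≤ B →
    σ.Bounded B → (∃ t, Runs p σ t (p.exec σ) ∧ t ≤ p.weight * B ^ 2) ∧
      (p.exec σ).Bounded (p.growth * B)
  | skip, _, B, σ, hB, hσ => by
    refine ⟨⟨1, .skip σ, ?_⟩, by simpa [exec, growth] using hσ⟩
    simpa [weight] using one_le_sq hB
  | set a i e, _, B, σ, hB, hσ => by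
    refine ⟨⟨_, .set σ a i e, ?_⟩, ?_⟩
    · have h1 := i.cost_add_le hB hσ
      have h2 := e.cost_add_le hB hσ
      have h3 := one_le_sq hB
      simp only [weight]
      nlinarith
    · refine State.Bounded.store (hσ.mono ?_) a _ (e.val_lt hB hσ)
      exact Nat.le_mul_of_pos_left _ e.weight_pos
  | out e, _, B, σ, hB, hσ => by
    refine ⟨⟨_, .out σ e, ?_⟩, by simpa [exec, growth, State.Bounded, State.write] using hσ⟩
    have h1 := e.cost_add_le hB hσ
    have h3 := one_le_sq hB
    simp only [weight]
    nlinarith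
  | seq p q, h, B, σ, hB, hσ => by
    obtain ⟨⟨t, ht, htB⟩, h1⟩ := p.runs_exec h.1 hB hσ
    obtain ⟨⟨u, hu, huB⟩, h2⟩ := q.runs_exec h.2
      (hB.trans (Nat.le_mul_of_pos_left _ p.growth_pos)) h1
    refine ⟨⟨_, .seq ht hu, ?_⟩, ?_⟩
    · have h3 := one_le_sq hB
      simp only [weight]
      rw [mul_pow] at huB
      nlinarith
    · rw [← mul_assoc] at h2
      exact h2
  | ite e p q, h, B, σ, hB, hσ => by
    have h1 := e.cost_add_le hB hσ
    have h3 := one_le_sq hB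
    by_cases he : 0 < e.val σ
    · obtain ⟨⟨t, ht, htB⟩, h2⟩ := p.runs_exec h.1 hB hσ
      simp only [exec, if_pos he, weight, growth]
      refine ⟨⟨_, .ite_pos he ht, ?_⟩, h2.mono (Nat.mul_le_mul_right _ (by omega))⟩
      have : 0 ≤ q.weight * B ^ 2 := Nat.zero_le _
      nlinarith
    · obtain ⟨⟨t, ht, htB⟩, h2⟩ := q.runs_exec h.2 hB hσ
      simp only [exec, if_neg he, weight, growth]
      refine ⟨⟨_, .ite_neg he ht, ?_⟩, h2.mono (Nat.mul_le_mul_right _ (by omega))⟩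
      have : 0 ≤ p.weight * B ^ 2 := Nat.zero_le _
      nlinarith
  | .while _ _, h, _, _, _, _ => h.elim

/-- The program leads from `σ` to `τ`; the number `l` bounds the lengths of the loops, and `B` the
bit length of the memory. -/
def Takes (p : Program) (σ τ : State) (l B : ℕ) : Prop :=
  ∃ t, Runs p σ t τ ∧ t ≤ p.weight * l * B ^ 2

section Takes

variable {l B : ℕ} {σ τ υ : State} {e : Expr} {p q : Program}

theorem takes_exec (hl : 1 ≤ l) (hB : 1 ≤ B) (hp : p.LoopFree) (hσ : σ.Bounded B)
    (hτ : p.exec σ = τ) : Takes p σ τ l B := by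
  obtain ⟨t, h1, h2⟩ := (p.runs_exec hp hB hσ).1
  exact ⟨t, hτ ▸ h1, h2.trans (Nat.mul_le_mul_right _ (Nat.le_mul_of_pos_right _ hl))⟩

theorem Takes.seq (hl : 1 ≤ l) (hB : 1 ≤ B) (hp : Takes p σ τ l B) (hq : Takes q τ υ l B) :
    Takes (.seq p q) σ υ l B := by
  obtain ⟨t, h1, h2⟩ := hp
  obtain ⟨u, h3, h4⟩ := hq
  refine ⟨_, .seq h1 h3, ?_⟩
  have h5 : 1 ≤ l * B ^ 2 := Nat.mul_pos hl (one_le_sq hB)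
  have h6 : q.weight * 1 ≤ q.weight * p.growth ^ 2 :=
    Nat.mul_le_mul_left _ (one_le_sq p.growth_pos)
  have h7 := Nat.mul_le_mul_right (l * B ^ 2) h6
  simp only [Program.weight]
  nlinarith

theorem Takes.ite_pos (hl : 1 ≤ l) (hB : 1 ≤ B) (hσ : σ.Bounded B) (he : 0 < e.val σ)
    (hp : Takes p σ τ l B) : Takes (.ite e p q) σ τ l B := by
  obtain ⟨t, h1, h2⟩ := hp
  refine ⟨_, .ite_pos he h1, ?_⟩
  have h3 := one_le_sq hB
  have h4 := e.cost_add_le hB hσ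
  have h5 : B ^ 2 ≤ l * B ^ 2 := Nat.le_mul_of_pos_left _ hl
  have h6 : 0 ≤ q.weight * (l * B ^ 2) := Nat.zero_le _
  have h7 := Nat.mul_le_mul_left (2 + 8 * e.weight ^ 2) h5
  simp only [Program.weight]
  nlinarith

theorem Takes.ite_neg (hl : 1 ≤ l) (hB : 1 ≤ B) (hσ : σ.Bounded B) (he : ¬ 0 < e.val σ)
    (hq : Takes q σ τ l B) : Takes (.ite e p q) σ τ l B := by
  obtain ⟨t, h1, h2⟩ := hq
  refine ⟨_, .ite_neg he h1, ?_⟩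
  have h3 := one_le_sq hB
  have h4 := e.cost_add_le hB hσ
  have h5 : B ^ 2 ≤ l * B ^ 2 := Nat.le_mul_of_pos_left _ hl
  have h6 : 0 ≤ p.weight * (l * B ^ 2) := Nat.zero_le _
  have h7 := Nat.mul_le_mul_left (2 + 8 * e.weight ^ 2) h5
  simp only [Program.weight]
  nlinarith

theorem runs_while (hp : p.LoopFree) {N : ℕ} (hB : 1 ≤ B)
    (s : ℕ → State) (hs : ∀ j ≤ N, (s j).Bounded B) (hpos : ∀ j < N, 0 < e.val (s j))
    (hend : ¬ 0 < e.val (s N)) (hstep : ∀ j < N, p.exec (s j) = s (j + 1)) :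
    ∃ t, Runs (.while e p) (s 0) t (s N) ∧ t ≤ (Program.while e p).weight * (N + 1) * B ^ 2 := by
  induction N generalizing s with
  | zero =>
    refine ⟨_, .while_neg hend, ?_⟩
    have h1 := one_le_sq hB
    have h2 := e.cost_add_le hB (hs 0 le_rfl)
    have h3 : 0 ≤ p.weight * B ^ 2 := Nat.zero_le _
    simp only [Program.weight]
    nlinarith
  | succ N ih =>
    obtain ⟨u, h1, h2⟩ := ih (fun j => s (j + 1)) (fun j hj => hs _ (by omega))
      (fun j hj => hpos _ (by omega)) hend (fun j hj => hstep _ (by omega))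
    obtain ⟨t, h3, h4⟩ := (p.runs_exec hp hB (hs 0 (by omega))).1
    rw [hstep 0 (by omega)] at h3
    refine ⟨_, .while_pos (hpos 0 (by omega)) h3 h1, ?_⟩
    have h5 := one_le_sq hB
    have h6 := e.cost_add_le hB (hs 0 (by omega))
    have h7 : 1 + e.cost (s 0) + bitLength (e.val (s 0)) + t ≤
        (Program.while e p).weight * B ^ 2 := by
      simp only [Program.weight]
      nlinarith
    calc _ ≤ (Program.while e p).weight * B ^ 2 +
          (Program.while e p).weight * (N + 1) * B ^ 2 := Nat.add_le_add h7 h2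
      _ = _ := by ring

/-- A loop whose body is free of loops passes through the states `s 0, …, s N`. -/
theorem takes_while (hp : p.LoopFree) {N : ℕ} (hN : N + 1 ≤ l) (hB : 1 ≤ B)
    (s : ℕ → State) (hs : ∀ j ≤ N, (s j).Bounded B) (hpos : ∀ j < N, 0 < e.val (s j))
    (hend : ¬ 0 < e.val (s N)) (hstep : ∀ j < N, p.exec (s j) = s (j + 1)) :
    Takes (.while e p) (s 0) (s N) l B := by
  obtain ⟨t, h1, h2⟩ := runs_while hp hB s hs hpos hend hstep
  exact ⟨t, h1, h2.trans (Nat.mul_le_mul_right _ (Nat.mul_le_mul_left _ hN))⟩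

end Takes

end LogCostRAM

namespace CircuitWalks

/-! ### The size of the numbers -/

section Encoding

variable {rows : List HalfPlane} {c0 c1 : ℤ}

theorem entries_ofRows {s c : Fin 2 → ℚ} : (PlanarData.ofRows rows s c).entries =
    (rows.flatMap fun R => [(R.a : ℚ), (R.b : ℚ), (R.c : ℚ)]) ++ [s 0, s 1, c 0, c 1] := by
  have h : (List.ofFn fun i : Fin rows.length =>
      [((rows.get i).a : ℚ), ((rows.get i).b : ℚ), ((rows.get i).c : ℚ)]) =
      rows.map fun R => [(R.a : ℚ), (R.b : ℚ), (R.c : ℚ)] := by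
    conv_rhs => rw [← List.ofFn_get rows, List.map_ofFn]
    rfl
  rw [List.flatMap_def, ← h]
  rfl

/-- The output that represents the rows, the point `0` and an integral cost vector. -/
def encode (rows : List HalfPlane) (c0 c1 : ℤ) : List ℤ :=
  (rows.length : ℤ) :: ((rows.flatMap fun R => [R.a, 1, R.b, 1, R.c, 1]) ++
    [0, 1, 0, 1, c0, 1, c1, 1])

theorem representedBy_encode {c : Fin 2 → ℚ} (h0 : c 0 = c0) (h1 : c 1 = c1) :
    (PlanarData.ofRows rows 0 c).RepresentedBy (encode rows c0 c1) := by
  refine ⟨(rows.flatMap fun R => [(R.a, 1), (R.b, 1), (R.c, 1)]) ++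
    [(0, 1), (0, 1), (c0, 1), (c1, 1)], ?_, ?_, ?_⟩
  · intro x hx
    simp only [List.mem_append, List.mem_flatMap, List.mem_cons, List.not_mem_nil, or_false] at hx
    rcases hx with ⟨R, -, rfl | rfl | rfl⟩ | rfl | rfl | rfl | rfl <;> simp
  · rw [entries_ofRows, List.map_append, List.map_flatMap]
    simp [h0, h1]
  · simp [encode, List.flatMap_append, List.flatMap_assoc]

theorem bitLength_natCast_le (n : ℕ) : bitLength n ≤ n + 1 :=
  Nat.add_le_add_right (Nat.size_le.2 (by simpa using Nat.lt_two_pow_self)) 1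

theorem encodingLength_le {c : Fin 2 → ℚ} (h0 : c 0 = c0) (h1 : c 1 = c1) {B : ℕ}
    (hR : ∀ R ∈ rows, R.a.natAbs < 2 ^ B ∧ R.b.natAbs < 2 ^ B ∧ R.c.natAbs < 2 ^ B)
    (hc0 : c0.natAbs < 2 ^ B) (hc1 : c1.natAbs < 2 ^ B) :
    (PlanarData.ofRows rows 0 c).encodingLength ≤
      rows.length + 1 + (3 * rows.length + 4) * (B + 3) := by
  have hent : ∀ q ∈ (PlanarData.ofRows rows 0 c).entries, ∃ z : ℤ, q = z ∧ z.natAbs < 2 ^ B := by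
    intro q hq
    simp only [entries_ofRows, List.mem_append, List.mem_flatMap, List.mem_cons, List.not_mem_nil,
      or_false] at hq
    rcases hq with ⟨R, h, rfl | rfl | rfl⟩ | rfl | rfl | rfl | rfl
    · exact ⟨_, rfl, (hR R h).1⟩
    · exact ⟨_, rfl, (hR R h).2.1⟩
    · exact ⟨_, rfl, (hR R h).2.2⟩
    · exact ⟨0, by simp, by simp⟩
    · exact ⟨0, by simp, by simp⟩
    · exact ⟨c0, h0, hc0⟩
    · exact ⟨c1, h1, hc1⟩
  have hsum := List.sum_le_card_nsmul
    ((PlanarData.ofRows rows 0 c).entries.map fun q => bitLength q.num + bitLength q.den) (B + 3)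
    (by
      intro x hx
      obtain ⟨q, hq, rfl⟩ := List.mem_map.1 hx
      obtain ⟨z, rfl, hz⟩ := hent q hq
      have h2 : bitLength z ≤ B + 1 := LogCostRAM.bitLength_le hz
      have h3 : bitLength ((z : ℚ).den : ℤ) = 2 := by simp [bitLength]
      rw [h3, Rat.num_intCast]
      omega)
  have hlen : (PlanarData.ofRows rows 0 c).entries.length = 3 * rows.length + 4 := by
    simp [entries_ofRows, List.length_flatMap, mul_comm]
  rw [List.length_map, hlen, smul_eq_mul] at hsum
  exact Nat.add_le_add (bitLength_natCast_le rows.length) hsum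

end Encoding

namespace Gadget

variable {G : Gadget} {items : List ℕ} {Z : ℤ}

/-- The number `Z` bounds the parameters from which the polygon is built. -/
structure Below (G : Gadget) (Z : ℤ) : Prop where
  four_le : 4 ≤ Z
  m_le : (G.m : ℤ) ≤ Z
  k_le : (G.k : ℤ) ≤ Z
  S_le : (G.S : ℤ) ≤ Z

theorem le_pow_of_le {x : ℤ} {a b : ℕ} (hZ : 4 ≤ Z) (hx : x ≤ Z ^ a) (hab : a ≤ b) : x ≤ Z ^ b :=
  hx.trans (pow_le_pow_right₀ (by linarith) hab)

theorem add_le_pow {x y : ℤ} {a b : ℕ} (hZ : 4 ≤ Z) (hx : x ≤ Z ^ a) (hy : y ≤ Z ^ a)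
    (hab : a + 1 ≤ b) : x + y ≤ Z ^ b := by
  refine le_pow_of_le hZ ?_ hab
  rw [pow_succ]
  have : 0 < Z ^ a := by positivity
  nlinarith

theorem mul_le_pow {x y : ℤ} {a b c : ℕ} (hZ : 4 ≤ Z) (hx : x ≤ Z ^ a) (hy0 : 0 ≤ y)
    (hy : y ≤ Z ^ b) (hab : a + b ≤ c) : x * y ≤ Z ^ c := by
  refine le_pow_of_le hZ ?_ hab
  rw [pow_add]
  exact mul_le_mul hx hy hy0 (by positivity)

theorem N_nonneg (m : ℕ) : 0 ≤ N m := by unfold N; positivity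

theorem M_nonneg (m k : ℕ) : 0 ≤ M m k := by
  have := N_nonneg m
  unfold M; positivity

theorem H_nonneg (m k S : ℕ) : 0 ≤ H m k S := by
  have := N_nonneg m
  have := M_nonneg m k
  unfold H; positivity

theorem w_nonneg (S : ℕ) : 0 ≤ w S := by unfold w; positivity

theorem K_nonneg (m k S : ℕ) : 0 ≤ K m k S := by
  have := H_nonneg m k S
  unfold K; positivity

/-- The exponent that bounds the powers of `β`. -/
def powerBound (m : ℕ) : ℕ := 19 * (m + 4) * m

namespace Below

theorem N_le (h : G.Below Z) : N G.m ≤ Z ^ 3 := by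
  have := h.four_le
  have := h.m_le
  have : (16 : ℤ) ≤ Z ^ 2 := by nlinarith
  unfold N
  nlinarith

theorem M_le (h : G.Below Z) : M G.m G.k ≤ Z ^ 5 := by
  have hm : (G.m : ℤ) ≤ Z ^ 1 := by simpa using h.m_le
  have hk : (G.k : ℤ) ≤ Z ^ 1 := by simpa using h.k_le
  exact mul_le_pow h.four_le h.N_le (by positivity) (add_le_pow h.four_le hm hk le_rfl) le_rfl

theorem H_le (h : G.Below Z) : H G.m G.k G.S ≤ Z ^ 7 := by
  have hk : (G.k : ℤ) ≤ Z ^ 1 := by simpa using h.k_le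
  have hS : (G.S : ℤ) ≤ Z ^ 1 := by simpa using h.S_le
  exact add_le_pow h.four_le
    (mul_le_pow h.four_le h.M_le (by positivity) hS le_rfl)
    (mul_le_pow h.four_le h.N_le (by positivity) hk (by norm_num)) le_rfl

theorem K_le (h : G.Below Z) : K G.m G.k G.S ≤ Z ^ 9 := by
  have h4 : (4 : ℤ) ≤ Z ^ 1 := by simpa using h.four_le
  have hm : (G.m : ℤ) ≤ Z ^ 1 := by simpa using h.m_le
  exact mul_le_pow h.four_le (mul_le_pow h.four_le h4 (by positivity) hm le_rfl)
    (H_nonneg _ _ _) h.H_le (by norm_num)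

theorem w_le (h : G.Below Z) : w G.S ≤ Z ^ 4 := by
  have hS : (G.S : ℤ) ≤ Z ^ 1 := by simpa using h.S_le
  have h1 : (1 : ℤ) ≤ Z ^ 1 := by have := h.four_le; simp; linarith
  have h2 : (G.S : ℤ) + 1 ≤ Z ^ 2 := add_le_pow h.four_le hS h1 le_rfl
  rw [w, sq]
  exact mul_le_pow h.four_le h2 (by positivity) h2 le_rfl

theorem h_le (h : G.Below Z) : H G.m G.k G.S * w G.S ≤ Z ^ 11 :=
  mul_le_pow h.four_le h.H_le (w_nonneg _) h.w_le le_rfl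

theorem base_le (h : G.Below Z) : 2 * K G.m G.k G.S ^ 2 ≤ Z ^ 19 := by
  have h2 : (2 : ℤ) ≤ Z ^ 1 := by have := h.four_le; simp; linarith
  rw [sq]
  exact mul_le_pow (b := 18) h.four_le h2 (mul_self_nonneg _)
    (mul_le_pow h.four_le h.K_le (K_nonneg _ _ _) h.K_le le_rfl) le_rfl

theorem base_pow_le (h : G.Below Z) {t : ℕ} (ht : t ≤ G.m + 4) :
    (2 * K G.m G.k G.S ^ 2) ^ t ≤ Z ^ (19 * (G.m + 4)) := by
  have h1 := pow_le_pow_left₀ (by positivity) h.base_le t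
  rw [← pow_mul] at h1
  exact le_pow_of_le h.four_le h1 (Nat.mul_le_mul_left _ ht)

theorem β_pow_le (h : G.Below Z) {t : ℕ} (ht : t ≤ G.m) :
    β G.m G.k G.S ^ t ≤ Z ^ powerBound G.m := by
  have h1 : β G.m G.k G.S ^ t ≤ (Z ^ (19 * (G.m + 4))) ^ t :=
    pow_le_pow_left₀ (by positivity) (h.base_pow_le le_rfl) t
  rw [← pow_mul] at h1
  exact le_pow_of_le h.four_le h1 (Nat.mul_le_mul_left _ ht)

theorem U_le (h : G.Below Z) : U G.m G.k G.S ≤ Z ^ powerBound G.m := h.β_pow_le le_rfl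

theorem hU_le (h : G.Below Z) :
    H G.m G.k G.S * w G.S * U G.m G.k G.S ≤ Z ^ (powerBound G.m + 11) :=
  mul_le_pow h.four_le h.h_le (by unfold U β; positivity) h.U_le (by omega)

end Below

theorem K_del_le_U {j : ℕ} (hj : j ≤ G.m) : 32 * (K G.m G.k G.S * G.chain.del j) ≤ U G.m G.k G.S :=
  G.chain.del_le_U hj

/-- The entries of the rows of the chains. -/
theorem Below.chain_rows_le (h : G.Below Z) : ∀ R ∈ G.chain.rows,
    |R.a| ≤ Z ^ (powerBound G.m + 12) ∧ |R.b| ≤ Z ^ (powerBound G.m + 12) ∧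
      |R.c| ≤ Z ^ (powerBound G.m + 12) := by
  intro R hR
  have hU := h.hU_le
  have hU0 : 0 ≤ U G.m G.k G.S := G.chain.U_pos.le
  have hH := H_nonneg G.m G.k G.S
  have hw := w_nonneg G.S
  have hK := G.chain.four_N_le_K
  simp only [chain_N, chain_K] at hK
  have hN := G.N_pos
  have hm : (G.m : ℤ) ≤ Z ^ 1 := by simpa using h.m_le
  have hUle : U G.m G.k G.S ≤ H G.m G.k G.S * w G.S * U G.m G.k G.S := by
    refine le_mul_of_one_le_left hU0 ?_
    have h1 : 1 ≤ H G.m G.k G.S := by linarith [G.N_le_H]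
    have h2 : 1 ≤ w G.S := by unfold w; nlinarith [(Nat.cast_nonneg G.S : (0 : ℤ) ≤ G.S)]
    exact one_le_mul_of_one_le_of_one_le h1 h2
  obtain ⟨j, h1j, hj, rfl | rfl⟩ := G.chain.mem_rows.1 hR
  · have hd0 := G.chain.del_nonneg j
    have hd := K_del_le_U hj
    have hjm : (j : ℤ) ≤ G.m := by exact_mod_cast hj
    have hj1 : (1 : ℤ) ≤ j := by exact_mod_cast h1j
    have hjN : 4 * ((j : ℤ) * N G.m) ≤ K G.m G.k G.S := G.chain.mN_le_K hj
    have hjZ : (j : ℤ) ≤ Z ^ 1 := hjm.trans hm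
    refine ⟨?_, ?_, ?_⟩
    · simp only [Chain.left, chain_K, abs_neg]
      rw [abs_of_nonneg (K_nonneg _ _ _)]
      exact le_pow_of_le h.four_le h.K_le (by omega)
    · simp only [Chain.left]
      rw [abs_of_nonneg (by omega)]
      exact le_pow_of_le h.four_le hjZ (by omega)
    · simp only [Chain.left, chain_K, chain_N, chain_h, chain_U]
      have h1 : (j : ℤ) * (H G.m G.k G.S * w G.S * U G.m G.k G.S) ≤ Z ^ (powerBound G.m + 12) :=
        mul_le_pow h.four_le hjZ (by positivity) hU (by omega)
      have h2 : 0 ≤ (K G.m G.k G.S + j * N G.m) * G.chain.del j :=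
        mul_nonneg (by nlinarith) hd0
      have h3 : (K G.m G.k G.S + j * N G.m) * G.chain.del j ≤
          (2 * K G.m G.k G.S) * G.chain.del j :=
        mul_le_mul_of_nonneg_right (by linarith [K_nonneg G.m G.k G.S]) hd0
      have h4 : H G.m G.k G.S * w G.S * U G.m G.k G.S ≤
          j * (H G.m G.k G.S * w G.S * U G.m G.k G.S) :=
        le_mul_of_one_le_left (by positivity) hj1
      rw [abs_of_nonneg (by linarith)]
      linarith
  · have hd0 := G.chain.del_nonneg j
    have hd := K_del_le_U hj
    have hρ1 : 1 ≤ G.chain.rho j := Chain.rho_nonneg hj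
    have hρm : G.chain.rho j ≤ G.m := Chain.rho_le h1j
    have hmN : (G.m : ℤ) ≤ N G.m := by unfold N; omega
    refine ⟨?_, ?_, ?_⟩
    · simp only [Chain.right]
      rw [abs_of_nonneg (by omega)]
      exact le_pow_of_le h.four_le (hρm.trans hm) (by omega)
    · simp only [Chain.right, abs_one]
      exact one_le_pow₀ (by linarith [h.four_le])
    · simp only [Chain.right, chain_N, chain_h, chain_U]
      have h2 : 0 ≤ (N G.m - G.chain.rho j) * G.chain.del j := mul_nonneg (by linarith) hd0
      have h3 : (N G.m - G.chain.rho j) * G.chain.del j ≤ K G.m G.k G.S * G.chain.del j :=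
        mul_le_mul_of_nonneg_right (by linarith) hd0
      rw [abs_of_nonneg (by linarith)]
      have := le_pow_of_le (b := powerBound G.m + 12) h.four_le hU (by omega)
      linarith

theorem Below.item_le (h : G.Below Z) {a : ℕ} (ha : 1 ≤ a) (haS : a ≤ G.S) :
    M G.m G.k * a * (w G.S + a - 2 * G.S) * U G.m G.k G.S ≤ Z ^ (powerBound G.m + 12) ∧
      0 ≤ M G.m G.k * a * (w G.S + a - 2 * G.S) * U G.m G.k G.S := by
  have ha1 : (1 : ℤ) ≤ a := by exact_mod_cast ha
  have haS' : (a : ℤ) ≤ G.S := by exact_mod_cast haS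
  have haZ : (a : ℤ) ≤ Z ^ 1 := by simpa using haS'.trans h.S_le
  have hU0 : 0 ≤ U G.m G.k G.S := G.chain.U_pos.le
  have hM := M_nonneg G.m G.k
  have h0 : 0 ≤ w G.S + a - 2 * G.S := by unfold w; nlinarith
  constructor
  · refine mul_le_pow (a := 10) h.four_le ?_ hU0 h.U_le (by omega)
    refine mul_le_pow (a := 6) (b := 4) h.four_le ?_ h0 ?_ le_rfl
    · exact mul_le_pow h.four_le h.M_le (by positivity) haZ le_rfl
    · linarith [h.w_le]
  · positivity

theorem Below.strip_rows_le (h : G.Below Z) (hI : Admissible G.S items) :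
    ∀ R ∈ stripBase G.m G.k G.S items ++ G.chain.rows,
    |R.a| ≤ Z ^ (powerBound G.m + 12) ∧ |R.b| ≤ Z ^ (powerBound G.m + 12) ∧
      |R.c| ≤ Z ^ (powerBound G.m + 12) := by
  intro R hR
  have h1 : 1 ≤ Z ^ (powerBound G.m + 12) := one_le_pow₀ (by linarith [h.four_le])
  have hN := N_nonneg G.m
  have hU0 : 0 ≤ U G.m G.k G.S := G.chain.U_pos.le
  have hw := w_nonneg G.S
  rcases List.mem_append.1 hR with hR | hR
  · revert R
    refine fun R _ hR => forall_stripBase (P := fun R => |R.a| ≤ Z ^ (powerBound G.m + 12) ∧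
      |R.b| ≤ Z ^ (powerBound G.m + 12) ∧ |R.c| ≤ Z ^ (powerBound G.m + 12)) ?_ ?_ ?_ ?_ R hR
    · exact ⟨by simpa [leftRow] using h1, by simp [leftRow]; linarith, by simp [leftRow]; linarith⟩
    · refine ⟨?_, by simpa [bottomRow] using h1, by simp [bottomRow]; linarith⟩
      simp only [bottomRow, abs_neg]
      rw [abs_of_nonneg hN]
      exact le_pow_of_le h.four_le h.N_le (by omega)
    · refine ⟨by simpa [rightRow] using h1, by simp [rightRow]; linarith, ?_⟩
      simp only [rightRow]
      rw [abs_of_nonneg (by positivity)]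
      exact mul_le_pow h.four_le h.w_le hU0 h.U_le (by omega)
    · intro a ha
      obtain ⟨ha1, haS⟩ := hI.2 a ha
      obtain ⟨h2, h3⟩ := h.item_le ha1 haS
      have haZ : (a : ℤ) ≤ Z ^ 1 := by
        have : (a : ℤ) ≤ G.S := by exact_mod_cast haS
        simpa using this.trans h.S_le
      refine ⟨?_, by simpa [itemRow] using h1, ?_⟩
      · simp only [itemRow]
        rw [abs_of_nonneg (mul_nonneg (M_nonneg _ _) (by positivity))]
        exact mul_le_pow h.four_le h.M_le (by positivity) haZ (by omega)
      · simp only [itemRow]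
        rwa [abs_of_nonneg h3]
  · exact h.chain_rows_le R hR

theorem Below.wedge_rows_le (h : G.Below Z) : ∀ R ∈ wedgeBase ++ G.chain.rows,
    |R.a| ≤ Z ^ (powerBound G.m + 12) ∧ |R.b| ≤ Z ^ (powerBound G.m + 12) ∧
      |R.c| ≤ Z ^ (powerBound G.m + 12) := by
  intro R hR
  have h1 : 1 ≤ Z ^ (powerBound G.m + 12) := one_le_pow₀ (by linarith [h.four_le])
  rcases List.mem_append.1 hR with hR | hR
  · simp only [wedgeBase, leftRow, List.mem_cons, List.not_mem_nil, or_false] at hR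
    rcases hR with rfl | rfl <;> simp <;> omega
  · exact h.chain_rows_le R hR

/-- The bit length of all numbers that are bounded by the powers of `2 ^ z` above. -/
def bits (m z : ℕ) : ℕ := z * (powerBound m + 12) + 1

theorem natAbs_lt_bits {m z : ℕ} {x : ℤ} (hx : |x| ≤ ((2 : ℤ) ^ z) ^ (powerBound m + 12)) :
    x.natAbs < 2 ^ bits m z := by
  have h1 : (x.natAbs : ℤ) ≤ ((2 ^ (z * (powerBound m + 12)) : ℕ) : ℤ) := by
    rw [Int.natCast_natAbs, pow_mul]
    exact_mod_cast hx
  have h2 : x.natAbs ≤ 2 ^ (z * (powerBound m + 12)) := by exact_mod_cast h1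
  rw [bits, pow_succ]
  have : 0 < 2 ^ (z * (powerBound m + 12)) := by positivity
  omega

end Gadget

end CircuitWalks

namespace ExactSubsetSumInstance

open CircuitWalks

/-- A bound for the bit length of the numbers, in terms of the logarithm `l` of the target or of
the largest number. -/
def logBound (n k C l : ℕ) : ℕ := n + k + C + C * k + l + 2

theorem le_two_pow {x z : ℕ} (h : x ≤ z) : (x : ℤ) ≤ 2 ^ z := by
  exact_mod_cast h.trans (Nat.lt_two_pow_self).le

theorem le_two_pow_log {x y z : ℕ} (hxy : x ≤ y) (h : Nat.log 2 y + 1 ≤ z) : (x : ℤ) ≤ 2 ^ z := by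
  have h1 : x < 2 ^ (Nat.log 2 y + 1) := hxy.trans_lt (Nat.lt_pow_succ_log_self (by norm_num) y)
  have h2 : 2 ^ (Nat.log 2 y + 1) ≤ 2 ^ z := Nat.pow_le_pow_right (by norm_num) h
  exact_mod_cast (h1.trans_le h2).le

variable (I : ExactSubsetSumInstance)

theorem gadget_below (C : ℕ) (h : C * I.k ≠ 0) {y : ℕ} (hy : I.S ≤ y) :
    (I.gadget C h).Below (2 ^ logBound I.n I.k C (Nat.log 2 y)) where
  four_le := by
    have : (2 : ℤ) ^ 2 ≤ 2 ^ logBound I.n I.k C (Nat.log 2 y) :=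
      pow_le_pow_right₀ (by norm_num) (by unfold logBound; omega)
    linarith
  m_le := le_two_pow (by simp only [gadget, logBound]; omega)
  k_le := le_two_pow (by simp only [gadget, logBound]; omega)
  S_le := le_two_pow_log hy (by unfold logBound; omega)

/-- The encoding length of the polygon. -/
theorem encodingLength_polygon_le (C : ℕ) : (I.polygon C).encodingLength ≤
    (I.n + 2 * (C * I.k) + 3) + 1 + (3 * (I.n + 2 * (C * I.k) + 3) + 4) *
      (Gadget.bits (C * I.k) (logBound I.n I.k C (Nat.log 2 I.S)) + 3) := by
  set z := logBound I.n I.k C (Nat.log 2 I.S) with hz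
  have hB : 1 ≤ Gadget.bits (C * I.k) z := by unfold Gadget.bits; omega
  have hone : (1 : ℤ).natAbs < 2 ^ Gadget.bits (C * I.k) z := Nat.one_lt_two_pow (by omega)
  have hzero : (0 : ℤ).natAbs < 2 ^ Gadget.bits (C * I.k) z := by simp
  have mono : ∀ {r : ℕ}, r ≤ I.n + 2 * (C * I.k) + 3 →
      r + 1 + (3 * r + 4) * (Gadget.bits (C * I.k) z + 3) ≤
      (I.n + 2 * (C * I.k) + 3) + 1 + (3 * (I.n + 2 * (C * I.k) + 3) + 4) *
      (Gadget.bits (C * I.k) z + 3) := fun hr =>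
    Nat.add_le_add (by omega) (Nat.mul_le_mul_right _ (by omega))
  have htri : (Gadget.triangle I.S).encodingLength ≤ 
      (I.n + 2 * (C * I.k) + 3) + 1 + (3 * (I.n + 2 * (C * I.k) + 3) + 4) *
      (Gadget.bits (C * I.k) z + 3) := by
    refine (encodingLength_le (c0 := I.S) (c1 := 0) (B := Gadget.bits (C * I.k) z) (by simp)
      (by simp) ?_ ?_ hzero).trans
      (mono (by simp [Gadget.triangleRows]))
    · intro R hR
      simp only [Gadget.triangleRows, List.mem_cons, List.not_mem_nil, or_false] at hR
      rcases hR with rfl | rfl | rfl <;> simpa using hone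
    · refine Gadget.natAbs_lt_bits ?_
      rw [abs_of_nonneg (by positivity)]
      refine (le_two_pow_log (z := z) le_rfl (by rw [hz]; unfold logBound; omega)).trans ?_
      exact le_self_pow₀ (one_le_pow₀ (by norm_num)) (by omega)
  unfold polygon
  split_ifs with h0 hn ht
  · exact htri
  · exact htri
  · have hbelow := I.gadget_below C h0 le_rfl
    refine (encodingLength_le (c0 := 0) (c1 := 1) (by simp [heightCost]) (by simp [heightCost])
      (fun R hR => ?_) hzero hone).trans (mono ?_)
    · obtain ⟨h1, h2, h3⟩ := hbelow.wedge_rows_le R hR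
      exact ⟨Gadget.natAbs_lt_bits h1, Gadget.natAbs_lt_bits h2, Gadget.natAbs_lt_bits h3⟩
    · simp [Gadget.wedgeBase, Chain.rows_length, gadget]
      omega
  · have hbelow := I.gadget_below C h0 le_rfl
    have hl := I.usableNumbers_length
    refine (encodingLength_le (c0 := 0) (c1 := 1) (by simp [heightCost]) (by simp [heightCost])
      (fun R hR => ?_) hzero hone).trans (mono ?_)
    · obtain ⟨h1, h2, h3⟩ := hbelow.strip_rows_le I.admissible_usableNumbers R hR
      exact ⟨Gadget.natAbs_lt_bits h1, Gadget.natAbs_lt_bits h2, Gadget.natAbs_lt_bits h3⟩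
    · simp [Gadget.stripBase, Chain.rows_length, gadget]
      omega

end ExactSubsetSumInstance

/-! ### The program -/

namespace LogCostRAM

instance : Add Expr := ⟨Expr.add⟩

instance : Sub Expr := ⟨Expr.sub⟩

instance : Mul Expr := ⟨Expr.mul⟩

instance (n : ℕ) : OfNat Expr n := ⟨Expr.lit n⟩

namespace Reduction

/-- The state with the given input, the given registers (in array `1`) and the given output. -/
def state (inp regs out : List ℤ) : State where
  mem := fun a i => if a = 0 ∧ 0 ≤ i then inp.getD i.toNat 0
    else if a = 1 ∧ 0 ≤ i then regs.getD i.toNat 0 else 0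
  output := out

/-- The register number `r`. -/
def reg (r : ℕ) : Expr := .get 1 (.lit r)

/-- The assignment of a value to a register. -/
def assign (r : ℕ) (e : Expr) : Program := .set 1 (.lit r) e

/-- The input cell number `r`. -/
def inputCell (r : ℕ) : Expr := .get 0 (.lit r)

/-- The consecutive execution of several programs. -/
def block : List Program → Program
  | [] => .skip
  | p :: ps => .seq p (block ps)

variable {inp regs out : List ℤ} {e f : Expr} {σ : State}

@[simp] theorem val_add : (e + f).val σ = e.val σ + f.val σ := rfl

@[simp] theorem val_sub : (e - f).val σ = e.val σ - f.val σ := rfl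

@[simp] theorem val_mul : (e * f).val σ = e.val σ * f.val σ := rfl

@[simp] theorem val_ofNat (n : ℕ) : (no_index (OfNat.ofNat n) : Expr).val σ = (n : ℤ) := rfl

@[simp] theorem val_zero : (0 : Expr).val σ = 0 := rfl

@[simp] theorem val_one : (1 : Expr).val σ = 1 := rfl

@[simp] theorem val_reg (r : ℕ) : (reg r).val (state inp regs out) = regs.getD r 0 := by
  simp [reg, Expr.val, state]

@[simp] theorem val_inputCell (r : ℕ) :
    (inputCell r).val (state inp regs out) = inp.getD r 0 := by
  simp [inputCell, Expr.val, state]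

theorem exec_assign {r : ℕ} (hr : r < regs.length) :
    (assign r e).exec (state inp regs out) =
      state inp (regs.set r (e.val (state inp regs out))) out := by
  simp only [assign, Program.exec, State.store, state, State.mk.injEq, and_true]
  funext a i
  simp only [Function.update_apply, Expr.val]
  by_cases ha : a = 1
  · subst ha
    by_cases hi : i = r
    · subst hi
      simp [hr]
    · by_cases hi0 : 0 ≤ i
      · have : r ≠ i.toNat := by omega
        simp [hi, hi0, List.getElem?_set_ne this]
      · simp [hi, hi0]
  · simp [ha]

theorem exec_out : (Program.out e).exec (state inp regs out) =
    state inp regs (out ++ [e.val (state inp regs out)]) := rfl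

theorem exec_skip : Program.skip.exec σ = σ := rfl

theorem exec_seq {p q : Program} : (Program.seq p q).exec σ = q.exec (p.exec σ) := rfl

theorem exec_ite {p q : Program} :
    (Program.ite e p q).exec σ = if 0 < e.val σ then p.exec σ else q.exec σ := rfl

theorem state_bounded {B : ℕ} (hi : ∀ x ∈ inp, x.natAbs < 2 ^ B)
    (hr : ∀ x ∈ regs, x.natAbs < 2 ^ B) : (state inp regs out).Bounded B := by
  have key : ∀ (l : List ℤ) (i : ℕ), (∀ x ∈ l, x.natAbs < 2 ^ B) →
      (l.getD i 0).natAbs < 2 ^ B := by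
    intro l i hl
    rcases lt_or_ge i l.length with h | h
    · rw [List.getD_eq_getElem _ _ h]
      exact hl _ (List.getElem_mem h)
    · rw [List.getD_eq_default _ _ h]
      simp
  intro a i
  simp only [state]
  split_ifs
  · exact key _ _ hi
  · exact key _ _ hr
  · simp

theorem init_eq (k : ℕ) : State.init inp = state inp (List.replicate k 0) [] := by
  simp only [State.init, state, State.mk.injEq, and_true]
  funext a i
  have : (List.replicate k (0 : ℤ)).getD i.toNat 0 = 0 := by
    simp only [List.getD_eq_getElem?_getD, List.getElem?_replicate]
    split <;> rfl
  rw [this]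
  simp

/-! The registers contain `m, N, M, K, h, w, β, U, del, eps`, a counter and the number of usable
numbers. -/

/-- The output of one row. -/
def outRow (a b c : Expr) : Program :=
  block [.out a, .out 1, .out b, .out 1, .out c, .out 1]

/-- The output of the point `0` and of a cost vector. -/
def outTail (c0 c1 : Expr) : Program :=
  block [.out 0, .out 1, .out 0, .out 1, .out c0, .out 1, .out c1, .out 1]

/-- The computation of the first parameters. -/
def parameters : Program :=
  block [assign 1 (4 * reg 0 + 4), assign 2 (reg 1 * (reg 0 + inputCell 2)),
    assign 5 ((inputCell 1 + 1) * (inputCell 1 + 1)),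
    assign 3 (4 * reg 0 * (reg 2 * inputCell 1 + reg 1 * inputCell 2)),
    assign 4 ((reg 2 * inputCell 1 + reg 1 * inputCell 2) * reg 5),
    assign 6 1, assign 7 1, assign 10 (reg 0 + 4)]

/-- The computation of `β`. -/
def powerLoop : Program :=
  .while (reg 10) (block [assign 6 (reg 6 * (2 * (reg 3 * reg 3))), assign 10 (reg 10 - 1)])

/-- The computation of `U` and of the first coordinate of the optimum. -/
def apexLoop : Program :=
  .while (reg 10)
    (block [assign 8 (reg 8 + reg 7), assign 7 (reg 7 * reg 6), assign 10 (reg 10 - 1)])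

/-- The computation of all parameters. -/
def prepare : Program :=
  .seq parameters (.seq powerLoop (.seq (assign 10 (reg 0)) apexLoop))

/-- The output of the chains from the top to the bottom. The counter is the level, and the registers
`8` and `9` contain `del` and `eps` of this level. -/
def chainLoop : Program :=
  .while (reg 10) (block
    [outRow (0 - reg 3) (reg 10)
      (reg 10 * (reg 4 * reg 7) - (reg 3 + reg 10 * reg 1) * reg 8),
    outRow (reg 0 + 1 - reg 10) 1
      (reg 4 * reg 7 - (reg 1 - (reg 0 + 1 - reg 10)) * reg 8),
    assign 8 (reg 8 - reg 9), assign 9 (reg 9 * reg 6), assign 10 (reg 10 - 1)])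

/-- The output of the chains and of the remaining data. -/
def outChain : Program :=
  .seq (block [assign 9 1, assign 10 (reg 0)]) (.seq chainLoop (outTail 0 1))

/-- The output of the wedge. -/
def outWedge : Program :=
  .seq (block [.out (2 * reg 0 + 2), outRow (0 - 1) 0 0, outRow 0 (0 - 1) 0]) outChain

/-- The number of the instance to which the counter points. -/
def current : Expr := .get 0 (reg 10 + 4)

/-- The execution of a program for the usable numbers only. -/
def ifUsable (p : Program) : Program :=
  .ite current (.ite (inputCell 1 + 1 - current) p .skip) .skip

/-- A loop over the usable numbers. -/
def forUsable (p : Program) : Program :=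
  .while (inputCell 0 - reg 10) (.seq (ifUsable p) (assign 10 (reg 10 + 1)))

/-- The counting of the usable numbers. -/
def countLoop : Program := forUsable (assign 11 (reg 11 + 1))

/-- The output of the edges of the numbers. -/
def itemLoop : Program :=
  forUsable (outRow (reg 2 * current) (0 - 1)
    (reg 2 * current * (reg 5 + current - 2 * inputCell 1) * reg 7))

/-- The output of the strip. -/
def outStrip : Program :=
  .seq (assign 10 0) (.seq countLoop (.seq
    (block [.out (reg 11 + 3 + 2 * reg 0), outRow (0 - 1) 0 0, outRow (0 - reg 1) (0 - 1) 0,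
      outRow 1 0 (reg 5 * reg 7), assign 10 0]) (.seq itemLoop outChain)))

/-- The output of the triangle. -/
def outTriangle : Program :=
  block [.out 3, outRow (0 - 1) 0 0, outRow 0 (0 - 1) 0, outRow 1 1 1, outTail (inputCell 1) 0]

/-- The product that vanishes exactly for the feasible instances with at most two numbers; missing
numbers are read as `0`. -/
def testExpr : Expr :=
  (inputCell 1 - inputCell 4) * (inputCell 1 - inputCell 5) * (inputCell 1 - 2 * inputCell 4) *
    (inputCell 1 - inputCell 4 - inputCell 5) * (inputCell 1 - 2 * inputCell 5)

/-- The reduction. -/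
def program : Program :=
  .seq (assign 0 (inputCell 3 * inputCell 2)) (.ite (reg 0)
    (.ite (3 - inputCell 0)
      (.ite (testExpr * testExpr) (.seq prepare outWedge) outTriangle)
      (.seq prepare outStrip))
    outTriangle)

end Reduction

end LogCostRAM

/-! ### The parameters and the chains computed by the program -/

namespace LogCostRAM

namespace Reduction

open CircuitWalks CircuitWalks.Gadget

/-- The registers after the computation of the first parameters. -/
abbrev registers (G : Gadget) (β' U' δ ε i count : ℤ) : List ℤ :=
  [G.m, N G.m, M G.m G.k, K G.m G.k G.S, H G.m G.k G.S * w G.S, w G.S, β', U', δ, ε, i, count]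

variable {G : Gadget} {n C : ℤ} {as : List ℕ} {out : List ℤ}

/-- The input. -/
abbrev inputList (n : ℤ) (S k : ℕ) (C : ℤ) (as : List ℕ) : List ℤ :=
  n :: (S : ℤ) :: (k : ℤ) :: C :: as.map (fun a : ℕ => (a : ℤ))

theorem exec_parameters :
    parameters.exec (state (inputList n G.S G.k C as) (G.m :: List.replicate 11 0) []) =
      state (inputList n G.S G.k C as) (registers G 1 1 0 0 (G.m + 4) 0) [] := by
  simp [parameters, block, exec_seq, exec_assign, exec_skip, List.replicate, registers, N, M, K, H,
    w]
  ring_nf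

theorem exec_outRow {inp regs : List ℤ} {a b c : Expr} {x y z : ℤ}
    (ha : ∀ out, a.val (state inp regs out) = x) (hb : ∀ out, b.val (state inp regs out) = y)
    (hc : ∀ out, c.val (state inp regs out) = z) : (outRow a b c).exec (state inp regs out) =
      state inp regs (out ++ [x, 1, y, 1, z, 1]) := by
  simp [outRow, block, exec_seq, exec_out, exec_skip, ha, hb, hc]

theorem exec_outTail {inp regs : List ℤ} {a b : Expr} {x y : ℤ}
    (ha : ∀ out, a.val (state inp regs out) = x) (hb : ∀ out, b.val (state inp regs out) = y) :
    (outTail a b).exec (state inp regs out) =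
      state inp regs (out ++ [0, 1, 0, 1, x, 1, y, 1]) := by
  simp [outTail, block, exec_seq, exec_out, exec_skip, ha, hb]

/-- The numerators and denominators that the program writes for one row. -/
abbrev encodeRow (R : HalfPlane) : List ℤ := [R.a, 1, R.b, 1, R.c, 1]

variable {l z : ℕ} {inp : List ℤ}

/-- All values of the registers are between `0` and this number. -/
abbrev maxValue (m z : ℕ) : ℤ := (2 ^ z) ^ (powerBound m + 12)

theorem registers_bounded (hG : G.Below (2 ^ z)) (hi : ∀ x ∈ inp, x.natAbs < 2 ^ bits G.m z)
    {β' U' δ ε i count : ℤ} (hβ : 0 ≤ β' ∧ β' ≤ maxValue G.m z)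
    (hU : 0 ≤ U' ∧ U' ≤ maxValue G.m z) (hδ : 0 ≤ δ ∧ δ ≤ maxValue G.m z)
    (hε : 0 ≤ ε ∧ ε ≤ maxValue G.m z) (hc : 0 ≤ i ∧ i ≤ maxValue G.m z)
    (hcount : 0 ≤ count ∧ count ≤ maxValue G.m z) :
    (state inp (registers G β' U' δ ε i count) out).Bounded (bits G.m z) := by
  refine state_bounded hi ?_
  have h4 := hG.four_le
  have key : ∀ {x : ℤ}, 0 ≤ x ∧ x ≤ maxValue G.m z → x.natAbs < 2 ^ bits G.m z := fun hx =>
    natAbs_lt_bits (by rw [abs_of_nonneg hx.1]; exact hx.2)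
  have hm : (G.m : ℤ) ≤ (2 ^ z) ^ 1 := by simpa using hG.m_le
  have hw := w_nonneg G.S
  have hH := H_nonneg G.m G.k G.S
  simp only [List.forall_mem_cons]
  refine ⟨key ⟨by positivity, le_pow_of_le h4 hm (by omega)⟩,
    key ⟨N_nonneg _, le_pow_of_le h4 hG.N_le (by omega)⟩,
    key ⟨M_nonneg _ _, le_pow_of_le h4 hG.M_le (by omega)⟩,
    key ⟨K_nonneg _ _ _, le_pow_of_le h4 hG.K_le (by omega)⟩,
    key ⟨by positivity, le_pow_of_le h4 hG.h_le (by omega)⟩,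
    key ⟨hw, le_pow_of_le h4 hG.w_le (by omega)⟩,
    key hβ, key hU, key hδ, key hε, key hc, key hcount, by simp⟩

theorem maxValue_bounds (hG : G.Below (2 ^ z)) :
    (∀ t ≤ G.m + 4, (2 * K G.m G.k G.S ^ 2) ^ t ≤ maxValue G.m z) ∧
    (∀ t ≤ G.m, β G.m G.k G.S ^ t ≤ maxValue G.m z) ∧
    (∀ t ≤ G.m, G.chain.del t ≤ maxValue G.m z) ∧
    (∀ x : ℤ, x ≤ G.m + 4 → x ≤ maxValue G.m z) := by
  have h4 := hG.four_le
  have hm : (G.m : ℤ) ≤ (2 ^ z) ^ 1 := by simpa using hG.m_le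
  refine ⟨fun t ht => le_pow_of_le h4 (hG.base_pow_le ht) ?_,
    fun t ht => le_pow_of_le h4 (hG.β_pow_le ht) (by omega), fun t ht => ?_, fun x hx => ?_⟩
  · have := Nat.le_mul_of_pos_right (19 * (G.m + 4)) (show 0 < G.m from G.one_le_m)
    unfold powerBound
    omega
  · have h1 := K_del_le_U ht
    have h2 := G.chain.del_nonneg t
    have h3 : 1 ≤ K G.m G.k G.S := G.chain.K_pos
    refine le_pow_of_le h4 (le_trans ?_ hG.U_le) (by omega)
    nlinarith
  · have h1 : (4 : ℤ) ≤ (2 ^ z) ^ 1 := by simpa using h4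
    exact hx.trans (add_le_pow h4 hm h1 (by omega))

theorem takes_powerLoop (hG : G.Below (2 ^ z)) (hi : ∀ x ∈ inp, x.natAbs < 2 ^ bits G.m z)
    (hl : G.m + 5 ≤ l) :
    Takes powerLoop (state inp (registers G 1 1 0 0 (G.m + 4) 0) [])
      (state inp (registers G (β G.m G.k G.S) 1 0 0 0 0) []) l (bits G.m z) := by
  obtain ⟨h1, -, -, h4⟩ := maxValue_bounds hG
  have h : Takes powerLoop _ _ l (bits G.m z) := takes_while (N := G.m + 4)
    (by simp [block, Program.LoopFree, assign]) (by omega) (by unfold bits; omega)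
    (fun t => state inp (registers G ((2 * K G.m G.k G.S ^ 2) ^ t) 1 0 0 (G.m + 4 - t) 0) [])
    (fun t ht => registers_bounded hG hi ⟨by positivity, h1 t ht⟩ ⟨by simp, h4 _ (by omega)⟩
      ⟨by simp, h4 _ (by omega)⟩ ⟨by simp, h4 _ (by omega)⟩ ⟨by omega, h4 _ (by omega)⟩
      ⟨by simp, h4 _ (by omega)⟩)
    (fun t ht => by simp; omega) (by simp) (fun t ht => by
      simp [block, exec_seq, exec_assign, exec_skip, registers]
      ring_nf)
  simpa [β] using h

/-- The partial sums of the powers of `β` approach the first coordinate of the optimum. -/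
theorem del_eq_sum : G.chain.del G.m = ∑ t ∈ Finset.range G.m, β G.m G.k G.S ^ t := by
  rw [Chain.del, ← Finset.sum_range_reflect]
  refine Finset.sum_congr rfl fun t ht => ?_
  have := Finset.mem_range.1 ht
  change β G.m G.k G.S ^ (G.m - _) = _
  congr 1
  omega

theorem one_le_β : 1 ≤ β G.m G.k G.S := G.chain.β_pos

theorem takes_apexLoop (hG : G.Below (2 ^ z)) (hi : ∀ x ∈ inp, x.natAbs < 2 ^ bits G.m z)
    (hl : G.m + 5 ≤ l) :
    Takes apexLoop (state inp (registers G (β G.m G.k G.S) 1 0 0 G.m 0) [])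
      (state inp (registers G (β G.m G.k G.S) (U G.m G.k G.S) (G.chain.del G.m) 0 0 0) []) l
      (bits G.m z) := by
  obtain ⟨-, h2, h3, h4⟩ := maxValue_bounds hG
  have hβ0 : 0 ≤ β G.m G.k G.S := by linarith [one_le_β (G := G)]
  have hβ1 : β G.m G.k G.S ≤ maxValue G.m z := by simpa using h2 1 G.one_le_m
  have h : Takes apexLoop _ _ l (bits G.m z) := takes_while (N := G.m)
    (by simp [block, Program.LoopFree, assign]) (by omega) (by unfold bits; omega)
    (fun t => state inp (registers G (β G.m G.k G.S) (β G.m G.k G.S ^ t)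
      (∑ t ∈ Finset.range t, β G.m G.k G.S ^ t) 0 (G.m - t) 0) [])
    (fun t ht => registers_bounded hG hi ⟨hβ0, hβ1⟩ ⟨by positivity, h2 t ht⟩
      ⟨Finset.sum_nonneg fun t _ => by positivity, ?_⟩ ⟨by simp, h4 _ (by omega)⟩
      ⟨by omega, h4 _ (by omega)⟩ ⟨by simp, h4 _ (by omega)⟩)
    (fun t ht => by simp; omega) (by simp) (fun t ht => by
      simp [block, exec_seq, exec_assign, exec_skip, registers, Finset.sum_range_succ]
      ring_nf)
  · simpa [U, del_eq_sum] using h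
  · refine le_trans ?_ (h3 G.m le_rfl)
    rw [del_eq_sum]
    exact Finset.sum_le_sum_of_subset_of_nonneg (Finset.range_mono ht) fun t _ _ => by positivity

theorem takes_prepare (hG : G.Below (2 ^ z))
    (hi : ∀ x ∈ inputList n G.S G.k C as, x.natAbs < 2 ^ bits G.m z) (hl : G.m + 5 ≤ l) :
    Takes prepare (state (inputList n G.S G.k C as) (G.m :: List.replicate 11 0) [])
      (state (inputList n G.S G.k C as)
        (registers G (β G.m G.k G.S) (U G.m G.k G.S) (G.chain.del G.m) 0 0 0) []) l
      (bits G.m z) := by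
  obtain ⟨-, h2, -, h4⟩ := maxValue_bounds hG
  have hβ0 : 0 ≤ β G.m G.k G.S := by linarith [one_le_β (G := G)]
  have hβ1 : β G.m G.k G.S ≤ maxValue G.m z := by simpa using h2 1 G.one_le_m
  have hB : 1 ≤ bits G.m z := by unfold bits; omega
  have hl1 : 1 ≤ l := by omega
  refine .seq hl1 hB (takes_exec hl1 hB (by simp [parameters, block, Program.LoopFree, assign])
    (state_bounded hi ?_) exec_parameters) (.seq hl1 hB (takes_powerLoop hG hi hl)
    (.seq hl1 hB (takes_exec hl1 hB (by simp [Program.LoopFree, assign])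
      (registers_bounded hG hi ⟨hβ0, hβ1⟩ ⟨by simp, h4 _ (by omega)⟩
      ⟨by simp, h4 _ (by omega)⟩ ⟨by simp, h4 _ (by omega)⟩ ⟨by omega, h4 _ (by omega)⟩
      ⟨by simp, h4 _ (by omega)⟩) ?_) (takes_apexLoop hG hi hl)))
  · simp only [List.forall_mem_cons]
    refine ⟨natAbs_lt_bits ?_, fun x hx => ?_⟩
    · rw [abs_of_nonneg (by positivity)]
      exact h4 _ (by omega)
    · rw [List.eq_of_mem_replicate hx]
      simp
  · simp [exec_assign, registers]

/-- The output of the rows from the top of the chains. -/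
theorem takes_chainLoop (hG : G.Below (2 ^ z)) (hi : ∀ x ∈ inp, x.natAbs < 2 ^ bits G.m z)
    (hl : G.m + 5 ≤ l) {count : ℤ} (hc : 0 ≤ count ∧ count ≤ maxValue G.m z) :
    ∃ ε, (state inp (registers G (β G.m G.k G.S) (U G.m G.k G.S) 0 ε 0 count)
        (out ++ G.chain.rows.flatMap encodeRow)).Bounded (bits G.m z) ∧
      Takes chainLoop
      (state inp (registers G (β G.m G.k G.S) (U G.m G.k G.S) (G.chain.del G.m) 1 G.m count) out)
      (state inp (registers G (β G.m G.k G.S) (U G.m G.k G.S) 0 ε 0 count)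
        (out ++ G.chain.rows.flatMap encodeRow)) l (bits G.m z) := by
  obtain ⟨-, h2, h3, h4⟩ := maxValue_bounds hG
  have hβ0 : 0 ≤ β G.m G.k G.S := by linarith [one_le_β (G := G)]
  have hβ1 : β G.m G.k G.S ≤ maxValue G.m z := by simpa using h2 1 G.one_le_m
  set s : ℕ → State := fun t => state inp (registers G (β G.m G.k G.S) (U G.m G.k G.S)
    (G.chain.del (G.m - t)) (β G.m G.k G.S ^ t) (G.m - t) count)
    (out ++ (List.range t).flatMap fun t =>
      encodeRow (G.chain.left (G.m - t)) ++ encodeRow (G.chain.right (G.m - t))) with hs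
  have hbd : ∀ t ≤ G.m, (s t).Bounded (bits G.m z) := fun t ht =>
    registers_bounded hG hi ⟨hβ0, hβ1⟩ ⟨G.chain.U_pos.le, h2 _ le_rfl⟩
      ⟨G.chain.del_nonneg _, h3 _ (by omega)⟩ ⟨by positivity, h2 t ht⟩
      ⟨by omega, h4 _ (by omega)⟩ hc
  have hend : s G.m = state inp (registers G (β G.m G.k G.S) (U G.m G.k G.S) 0
      (β G.m G.k G.S ^ G.m) 0 count) (out ++ G.chain.rows.flatMap encodeRow) := by
    simp only [hs, Nat.sub_self, sub_self, Chain.del_zero, Chain.rows, List.flatMap_assoc]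
    rfl
  refine ⟨β G.m G.k G.S ^ G.m, hend ▸ hbd G.m le_rfl, ?_⟩
  have h : Takes chainLoop _ _ l (bits G.m z) := takes_while (N := G.m)
    (by simp [block, Program.LoopFree, assign, outRow]) (by omega) (by unfold bits; omega) s hbd
    (fun t ht => by simp [hs]; omega) (by simp [hs]) (fun t ht => ?_)
  · rw [hend] at h
    simpa [hs] using h
  · have hcast : ((G.m - t : ℕ) : ℤ) = G.m - t := by push_cast [ht.le]; ring
    have hdel : G.chain.del (G.m - t) - β G.m G.k G.S ^ t = G.chain.del (G.m - (t + 1)) := by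
      obtain ⟨r, hr⟩ : ∃ r, G.m - t = r + 1 := ⟨G.m - t - 1, by omega⟩
      have hr' : G.m - (t + 1) = r := by omega
      have hE : G.chain.eps (r + 1) = β G.m G.k G.S ^ t := by
        change β G.m G.k G.S ^ (G.m - (r + 1)) = _
        congr 1
        omega
      rw [hr, hr', Chain.del, Finset.sum_range_succ, hE, Chain.del]
      ring
    simp only [hs, block, exec_seq, exec_skip]
    rw [exec_outRow (x := (G.chain.left (G.m - t)).a) (y := (G.chain.left (G.m - t)).b)
      (z := (G.chain.left (G.m - t)).c), exec_outRow (x := (G.chain.right (G.m - t)).a)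
      (y := (G.chain.right (G.m - t)).b) (z := (G.chain.right (G.m - t)).c)]
    · simp [exec_assign, registers, List.range_succ, List.flatMap_append, hdel, pow_succ, encodeRow, sub_sub]
    all_goals
      intro o
      simp [Chain.left, Chain.right, Chain.rho, hcast]

end Reduction

end LogCostRAM

/-! ### The output of the three polygons -/

namespace LogCostRAM

namespace Reduction

open CircuitWalks CircuitWalks.Gadget

variable {G : Gadget} {n C : ℤ} {as : List ℕ} {out : List ℤ} {l z : ℕ} {inp : List ℤ}

/-- The numbers between `1` and `S`. -/
abbrev usable (S : ℕ) (as : List ℕ) : List ℕ := as.filter fun a => 1 ≤ a ∧ a ≤ S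

theorem usable_take_succ {S t : ℕ} (ht : t < as.length) : usable S (as.take (t + 1)) =
    usable S (as.take t) ++ if 1 ≤ as[t] ∧ as[t] ≤ S then [as[t]] else [] := by
  rw [usable, List.take_add_one, List.getElem?_eq_getElem ht, List.filter_append]
  congr 1
  by_cases h : 1 ≤ as[t] ∧ as[t] ≤ S <;> simp [h]

theorem val_current {S k t : ℕ} (ht : t < as.length) {β' U' δ ε count : ℤ} :
    current.val (state (inputList n S k C as) (registers G β' U' δ ε t count) out) = as[t] := by
  have h : ((t : ℤ) + 4).toNat = t + 4 := by omega
  have h0 : (0 : ℤ) ≤ (t : ℤ) + 4 := by omega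
  simp only [current, Expr.val, val_reg]
  simp [state, h, h0, ht]

theorem exec_ifUsable {p : Program} {σ : State} {a S : ℕ} (ha : current.val σ = a)
    (hS : (inputCell 1).val σ = S) :
    (ifUsable p).exec σ = if 1 ≤ a ∧ a ≤ S then p.exec σ else σ := by
  simp only [ifUsable, exec_ite, exec_skip, val_sub, val_add, val_one, ha, hS]
  split_ifs <;> first | rfl | omega

theorem loopFree_ifUsable {p : Program} : (ifUsable p).LoopFree ↔ p.LoopFree := by
  simp [ifUsable, Program.LoopFree]

section Strip

/-- The registers, with everything computed but the counters. -/
abbrev finalRegisters (G : Gadget) (i count : ℤ) : List ℤ :=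
  registers G (β G.m G.k G.S) (U G.m G.k G.S) (G.chain.del G.m) 0 i count

theorem finalRegisters_bounded (hG : G.Below (2 ^ z))
    (hi : ∀ x ∈ inp, x.natAbs < 2 ^ bits G.m z) {i count : ℤ}
    (hc : 0 ≤ i ∧ i ≤ maxValue G.m z) (hcount : 0 ≤ count ∧ count ≤ maxValue G.m z) :
    (state inp (finalRegisters G i count) out).Bounded (bits G.m z) := by
  obtain ⟨-, h2, h3, h4⟩ := maxValue_bounds hG
  have hβ0 : 0 ≤ β G.m G.k G.S := by linarith [one_le_β (G := G)]
  have hβ1 : β G.m G.k G.S ≤ maxValue G.m z := by simpa using h2 1 G.one_le_m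
  exact registers_bounded hG hi ⟨hβ0, hβ1⟩ ⟨G.chain.U_pos.le, h2 _ le_rfl⟩
    ⟨G.chain.del_nonneg _, h3 _ le_rfl⟩ ⟨by simp, h4 _ (by omega)⟩ hc hcount

theorem takes_countLoop (hG : G.Below (2 ^ z)) (hn : n = as.length)
    (hi : ∀ x ∈ inputList n G.S G.k C as, x.natAbs < 2 ^ bits G.m z)
    (hnz : n ≤ maxValue G.m z) (hl : as.length + 1 ≤ l) :
    Takes countLoop (state (inputList n G.S G.k C as) (finalRegisters G 0 0) out)
      (state (inputList n G.S G.k C as) (finalRegisters G n (usable G.S as).length) out) l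
      (bits G.m z) := by
  subst hn
  have h : Takes countLoop _ _ l (bits G.m z) := takes_while (N := as.length)
    (by simp [Program.LoopFree, loopFree_ifUsable, assign]) hl (by unfold bits; omega)
    (fun t => state (inputList as.length G.S G.k C as)
      (finalRegisters G t (usable G.S (as.take t)).length) out)
    (fun t ht => finalRegisters_bounded hG hi ⟨by positivity, by omega⟩ ⟨by positivity, ?_⟩)
    (fun t ht => by simp; omega) (by simp) (fun t ht => ?_)
  · simpa using h
  · have h1 : (usable G.S (as.take t)).length ≤ as.length :=
      (List.length_filter_le _ _).trans (by simp)
    omega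
  · rw [exec_seq, exec_ifUsable (val_current ht) (by simp; rfl), usable_take_succ ht]
    split_ifs <;> simp [exec_assign, registers]

theorem takes_itemLoop (hG : G.Below (2 ^ z)) (hn : n = as.length)
    (hi : ∀ x ∈ inputList n G.S G.k C as, x.natAbs < 2 ^ bits G.m z)
    (hnz : n ≤ maxValue G.m z) (hl : as.length + 1 ≤ l) {count : ℤ}
    (hcount : 0 ≤ count ∧ count ≤ maxValue G.m z) :
    Takes itemLoop (state (inputList n G.S G.k C as) (finalRegisters G 0 count) out)
      (state (inputList n G.S G.k C as) (finalRegisters G n count)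
        (out ++ ((usable G.S as).map (itemRow G.m G.k G.S)).flatMap encodeRow)) l
      (bits G.m z) := by
  subst hn
  have h : Takes itemLoop _ _ l (bits G.m z) := takes_while (N := as.length)
    (by simp [Program.LoopFree, loopFree_ifUsable, assign, outRow, block]) hl
    (by unfold bits; omega)
    (fun t => state (inputList as.length G.S G.k C as) (finalRegisters G t count)
      (out ++ ((usable G.S (as.take t)).map (itemRow G.m G.k G.S)).flatMap encodeRow))
    (fun t ht => finalRegisters_bounded hG hi ⟨by positivity, by omega⟩ hcount)
    (fun t ht => by simp; omega) (by simp) (fun t ht => ?_)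
  · simpa using h
  · rw [exec_seq, exec_ifUsable (val_current ht) (by simp; rfl), usable_take_succ ht,
      exec_outRow (x := (itemRow G.m G.k G.S as[t]).a) (y := (itemRow G.m G.k G.S as[t]).b)
      (z := (itemRow G.m G.k G.S as[t]).c)]
    · split_ifs <;> simp [exec_assign, registers, encodeRow]
    all_goals
      intro o
      simp [itemRow, val_current ht]

theorem takes_outChain (hG : G.Below (2 ^ z)) (hi : ∀ x ∈ inp, x.natAbs < 2 ^ bits G.m z)
    (hl : G.m + 5 ≤ l) {i count : ℤ} (hc : 0 ≤ i ∧ i ≤ maxValue G.m z)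
    (hcount : 0 ≤ count ∧ count ≤ maxValue G.m z) :
    ∃ regs, Takes outChain (state inp (finalRegisters G i count) out)
      (state inp regs (out ++ (G.chain.rows.flatMap encodeRow ++ [0, 1, 0, 1, 0, 1, 1, 1]))) l
      (bits G.m z) := by
  have hB : 1 ≤ bits G.m z := by unfold bits; omega
  have hl1 : 1 ≤ l := by omega
  obtain ⟨ε, h1, h2⟩ := takes_chainLoop (out := out) hG hi hl hcount
  refine ⟨registers G (β G.m G.k G.S) (U G.m G.k G.S) 0 ε 0 count, .seq hl1 hB
    (takes_exec hl1 hB (by simp [block, Program.LoopFree, assign])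
    (finalRegisters_bounded hG hi hc hcount) ?_) (.seq hl1 hB h2
      (takes_exec hl1 hB (by simp [outTail, block, Program.LoopFree]) h1 ?_))⟩
  · simp [block, exec_seq, exec_assign, exec_skip, registers]
  · rw [exec_outTail (x := 0) (y := 1) (by simp) (by simp), List.append_assoc]

theorem takes_outWedge (hG : G.Below (2 ^ z)) (hi : ∀ x ∈ inp, x.natAbs < 2 ^ bits G.m z)
    (hl : G.m + 5 ≤ l) :
    ∃ regs, Takes outWedge (state inp (finalRegisters G 0 0) [])
      (state inp regs (encode (wedgeBase ++ G.chain.rows) 0 1)) l (bits G.m z) := by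
  have hB : 1 ≤ bits G.m z := by unfold bits; omega
  have hl1 : 1 ≤ l := by omega
  obtain ⟨-, -, -, h4⟩ := maxValue_bounds hG
  have h0 : (0 : ℤ) ≤ 0 ∧ 0 ≤ maxValue G.m z := ⟨le_rfl, h4 _ (by omega)⟩
  obtain ⟨regs, h⟩ := takes_outChain (out := ((2 * G.m + 2 : ℤ) :: wedgeBase.flatMap encodeRow))
    hG hi hl h0 h0
  refine ⟨regs, .seq (τ := state inp (finalRegisters G 0 0)
    ((2 * G.m + 2 : ℤ) :: wedgeBase.flatMap encodeRow)) hl1 hB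
    (takes_exec hl1 hB (by simp [block, Program.LoopFree, outRow])
    (finalRegisters_bounded hG hi h0 h0) ?_) ?_⟩
  · simp only [block, exec_seq, exec_skip, exec_out]
    rw [exec_outRow (x := -1) (y := 0) (z := 0), exec_outRow (x := 0) (y := -1) (z := 0)]
    · simp [wedgeBase, encodeRow, leftRow]
    all_goals simp
  · convert h using 2
    simp [encode, wedgeBase, encodeRow, Chain.rows_length]
    ring

theorem takes_outStrip (hG : G.Below (2 ^ z)) (hn : n = as.length)
    (hi : ∀ x ∈ inputList n G.S G.k C as, x.natAbs < 2 ^ bits G.m z)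
    (hnz : n ≤ maxValue G.m z) (hl : as.length + 1 ≤ l) (hlm : G.m + 5 ≤ l) :
    ∃ regs, Takes outStrip (state (inputList n G.S G.k C as) (finalRegisters G 0 0) [])
      (state (inputList n G.S G.k C as) regs
        (encode (stripBase G.m G.k G.S (usable G.S as) ++ G.chain.rows) 0 1)) l
      (bits G.m z) := by
  have hB : 1 ≤ bits G.m z := by unfold bits; omega
  have hl1 : 1 ≤ l := by omega
  obtain ⟨-, -, -, h4⟩ := maxValue_bounds hG
  have h0 : (0 : ℤ) ≤ 0 ∧ 0 ≤ maxValue G.m z := ⟨le_rfl, h4 _ (by omega)⟩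
  have hn0 : 0 ≤ n := by omega
  have hc : (0 : ℤ) ≤ ((usable G.S as).length : ℤ) ∧
      ((usable G.S as).length : ℤ) ≤ maxValue G.m z := by
    have h1 : (usable G.S as).length ≤ as.length := List.length_filter_le _ _
    exact ⟨by positivity, by omega⟩
  obtain ⟨regs, h⟩ := takes_outChain (inp := inputList n G.S G.k C as)
    (out := (((usable G.S as).length + 3 + 2 * G.m : ℤ) ::
      [leftRow, bottomRow G.m, rightRow G.m G.k G.S].flatMap encodeRow) ++
      ((usable G.S as).map (itemRow G.m G.k G.S)).flatMap encodeRow) hG hi hlm ⟨hn0, hnz⟩ hc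
  refine ⟨regs, .seq hl1 hB (takes_exec hl1 hB (by simp [Program.LoopFree, assign])
    (finalRegisters_bounded hG hi h0 h0) ?_) (.seq hl1 hB
    (takes_countLoop (out := []) hG hn hi hnz hl) (.seq (τ := state _
      (finalRegisters G 0 (usable G.S as).length) (((usable G.S as).length + 3 + 2 * G.m : ℤ) ::
      [leftRow, bottomRow G.m, rightRow G.m G.k G.S].flatMap encodeRow)) hl1 hB
    (takes_exec hl1 hB (by simp [block, Program.LoopFree, outRow, assign])
    (finalRegisters_bounded hG hi ⟨hn0, hnz⟩ hc) ?_) (.seq hl1 hB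
    (takes_itemLoop hG hn hi hnz hl hc) ?_)))⟩
  · simp [exec_assign]
  · simp only [block, exec_seq, exec_skip, exec_out]
    rw [exec_outRow (x := -1) (y := 0) (z := 0), exec_outRow (x := -N G.m) (y := -1) (z := 0),
      exec_outRow (x := 1) (y := 0) (z := w G.S * U G.m G.k G.S)]
    · simp [exec_assign, encodeRow, leftRow, bottomRow, rightRow]
    all_goals simp
  · convert h using 2
    simp [encode, stripBase, encodeRow, Chain.rows_length]
    ring

end Strip

theorem takes_outTriangle {B S : ℕ} {regs : List ℤ} (hl : 1 ≤ l) (hB : 1 ≤ B)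
    (hS : inp.getD 1 0 = S) (hb : (state inp regs []).Bounded B) :
    Takes outTriangle (state inp regs []) (state inp regs (encode triangleRows S 0)) l B := by
  refine takes_exec hl hB (by simp [outTriangle, block, outRow, outTail, Program.LoopFree]) hb ?_
  simp only [outTriangle, block, exec_seq, exec_skip, exec_out]
  rw [exec_outRow (x := -1) (y := 0) (z := 0), exec_outRow (x := 0) (y := -1) (z := 0),
    exec_outRow (x := 1) (y := 1) (z := 1), exec_outTail (x := S) (y := 0)]
  · simp [encode, triangleRows]
  all_goals simp
  simpa using hS

end Reduction

end LogCostRAM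

/-! ### Running time and encoding length -/

namespace ExactSubsetSumInstance

open CircuitWalks LogCostRAM LogCostRAM.Reduction

variable (I : ExactSubsetSumInstance)

theorem input_eq (C : ℕ) : I.input C = inputList I.n I.S I.k C (List.ofFn I.a) := by
  simp only [input, inputList, List.map_ofFn]
  rfl

theorem natAbs_lt_of_mem_input (C : ℕ) : ∀ x ∈ I.input C, x.natAbs <
    2 ^ Gadget.bits (C * I.k) (logBound I.n I.k C (Nat.log 2 I.maxNumber)) := by
  have key : ∀ x : ℕ, (x : ℤ) ≤ 2 ^ logBound I.n I.k C (Nat.log 2 I.maxNumber) →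
      (x : ℤ).natAbs <
        2 ^ Gadget.bits (C * I.k) (logBound I.n I.k C (Nat.log 2 I.maxNumber)) := by
    intro x hx
    refine Gadget.natAbs_lt_bits ?_
    rw [abs_of_nonneg (by positivity)]
    exact hx.trans (le_self_pow₀ (one_le_pow₀ (by norm_num)) (by omega))
  intro x hx
  simp only [input, List.mem_append, List.mem_cons, List.not_mem_nil, or_false, List.mem_ofFn]
    at hx
  rcases hx with (rfl | rfl | rfl | rfl) | ⟨i, rfl⟩
  · exact key _ (le_two_pow (by unfold logBound; omega))
  · exact key _ (le_two_pow_log (y := I.maxNumber) (le_max_left _ _) (by unfold logBound; omega))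
  · exact key _ (le_two_pow (by unfold logBound; omega))
  · exact key _ (le_two_pow (by unfold logBound; omega))
  · exact key _ (le_two_pow_log (y := I.maxNumber)
      ((Finset.le_sup (f := I.a) (Finset.mem_univ i)).trans (le_max_right _ _))
      (by unfold logBound; omega))

theorem val_testExpr (C : ℕ) {regs out : List ℤ} :
    testExpr.val (state (I.input C) regs out) = I.test := by
  simp [testExpr, test, number, input]

/-- The program outputs the polygon. -/
theorem takes_program (C : ℕ) : ∃ τ, Takes program (State.init (I.input C)) τ
    (I.n + C * I.k + 5)
    (Gadget.bits (C * I.k) (logBound I.n I.k C (Nat.log 2 I.maxNumber))) ∧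
    (I.polygon C).RepresentedBy τ.output := by
  set z := logBound I.n I.k C (Nat.log 2 I.maxNumber) with hz
  have hB : 1 ≤ Gadget.bits (C * I.k) z := by unfold Gadget.bits; omega
  have hl : 1 ≤ I.n + C * I.k + 5 := by omega
  have hi := I.natAbs_lt_of_mem_input C
  rw [← hz] at hi
  have hzero : ∀ x ∈ List.replicate 12 (0 : ℤ), x.natAbs < 2 ^ Gadget.bits (C * I.k) z := by
    intro x hx
    rw [List.eq_of_mem_replicate hx]
    simp
  have hCk : ((C : ℤ) * I.k).natAbs < 2 ^ Gadget.bits (C * I.k) z := by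
    refine Gadget.natAbs_lt_bits ?_
    rw [abs_of_nonneg (by positivity)]
    have h1 : ((C * I.k : ℕ) : ℤ) ≤ 2 ^ z := le_two_pow (by rw [hz]; unfold logBound; omega)
    push_cast at h1
    exact h1.trans (le_self_pow₀ (one_le_pow₀ (by norm_num)) (by omega))
  -- The first step computes `C k`.
  have hstart : Takes (assign 0 (inputCell 3 * inputCell 2)) (State.init (I.input C))
      (state (I.input C) ((C : ℤ) * I.k :: List.replicate 11 0) []) (I.n + C * I.k + 5)
      (Gadget.bits (C * I.k) z) := by
    rw [init_eq 12]
    refine takes_exec hl hB (by simp [assign, Program.LoopFree]) (state_bounded hi hzero) ?_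
    rw [exec_assign (by simp)]
    simp [input, List.replicate]
  have hbd : (state (I.input C) ((C : ℤ) * I.k :: List.replicate 11 0) []).Bounded
      (Gadget.bits (C * I.k) z) := by
    refine state_bounded hi (List.forall_mem_cons.2 ⟨hCk, fun x hx => ?_⟩)
    rw [List.eq_of_mem_replicate hx]
    simp
  have hreg : (reg 0).val (state (I.input C) ((C : ℤ) * I.k :: List.replicate 11 0) []) =
      ((C * I.k : ℕ) : ℤ) := by
    simp
  have htri : Takes outTriangle (state (I.input C) ((C : ℤ) * I.k :: List.replicate 11 0) [])
      (state (I.input C) ((C : ℤ) * I.k :: List.replicate 11 0) (encode Gadget.triangleRows I.S 0))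
      (I.n + C * I.k + 5) (Gadget.bits (C * I.k) z) :=
    takes_outTriangle hl hB (by simp [input]) hbd
  have htri' : (Gadget.triangle I.S).RepresentedBy (encode Gadget.triangleRows I.S 0) :=
    representedBy_encode (by simp) (by simp)
  have hn3 : (3 - inputCell 0).val (state (I.input C) ((C : ℤ) * I.k :: List.replicate 11 0) []) =
      3 - I.n := by
    simp [input]
  unfold polygon program
  split_ifs with h0 hn ht
  · exact ⟨_, .seq hl hB hstart (.ite_neg hl hB hbd (by rw [hreg, h0]; simp) htri), htri'⟩
  · refine ⟨_, .seq hl hB hstart (.ite_pos hl hB hbd (by rw [hreg]; omega)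
      (.ite_pos hl hB hbd (by rw [hn3]; omega) (.ite_neg hl hB hbd ?_ htri))), htri'⟩
    rw [val_mul, val_testExpr, ht]
    simp
  all_goals
    have hbelow := I.gadget_below C h0 (y := I.maxNumber) (le_max_left _ _)
    have hin : I.input C = inputList I.n (I.gadget C h0).S (I.gadget C h0).k C (List.ofFn I.a) :=
      I.input_eq C
    have hm : ((I.gadget C h0).m : ℤ) = C * I.k := Nat.cast_mul C I.k
    have hlm : (I.gadget C h0).m + 5 ≤ I.n + C * I.k + 5 := by simp only [gadget]; omega
    rw [← hz] at hbelow
    have hprep := takes_prepare (n := I.n) (C := C) (as := List.ofFn I.a)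
      (l := I.n + C * I.k + 5) hbelow (hin ▸ hi) hlm
    rw [← hin, hm] at hprep
  · obtain ⟨regs, hout⟩ := takes_outWedge (inp := I.input C) (l := I.n + C * I.k + 5) hbelow hi hlm
    refine ⟨_, .seq hl hB hstart (.ite_pos hl hB hbd (by rw [hreg]; omega)
      (.ite_pos hl hB hbd (by rw [hn3]; omega) (.ite_pos hl hB hbd ?_
      (.seq hl hB hprep hout)))), representedBy_encode (by simp [heightCost])
      (by simp [heightCost])⟩
    rw [val_mul, val_testExpr]
    exact mul_self_pos.2 ht
  · obtain ⟨regs, hout⟩ := takes_outStrip (n := I.n) (C := C) (as := List.ofFn I.a)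
      (l := I.n + C * I.k + 5) hbelow (by simp) (hin ▸ hi)
      (by
        refine (le_two_pow (z := z) (by rw [hz]; unfold logBound; omega)).trans ?_
        exact le_self_pow₀ (one_le_pow₀ (by norm_num)) (by omega))
      (by simp; omega) hlm
    rw [← hin] at hout
    exact ⟨_, .seq hl hB hstart (.ite_pos hl hB hbd (by rw [hreg]; omega)
      (.ite_neg hl hB hbd (by rw [hn3]; omega) (.seq hl hB hprep hout))),
      representedBy_encode (by simp [heightCost]) (by simp [heightCost])⟩

end ExactSubsetSumInstance

namespace ExactSubsetSumInstance

open MvPolynomial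

/-- The polynomial for the parameter `m = C k`. -/
noncomputable def chainLength : MvPolynomial (Fin 4) ℕ := X 3 * X 2

/-- The polynomial for the bit length of the numbers. -/
noncomputable def bitPolynomial : MvPolynomial (Fin 4) ℕ :=
  (X 0 + X 2 + X 3 + X 3 * X 2 + X 1 + 2) * (19 * (chainLength + 4) * chainLength + 12) + 1

/-- The polynomial for the running time. -/
noncomputable def timePolynomial : MvPolynomial (Fin 4) ℕ :=
  C LogCostRAM.Reduction.program.weight * (X 0 + chainLength + 5) * bitPolynomial ^ 2

/-- The polynomial for the encoding length. -/
noncomputable def lengthPolynomial : MvPolynomial (Fin 4) ℕ :=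
  (X 0 + 2 * chainLength + 3) + 1 + (3 * (X 0 + 2 * chainLength + 3) + 4) * (bitPolynomial + 3)

theorem eval_chainLength (n l k c : ℕ) : eval ![n, l, k, c] chainLength = c * k := by
  simp [chainLength]

theorem eval_bitPolynomial (n l k c : ℕ) : eval ![n, l, k, c] bitPolynomial =
    CircuitWalks.Gadget.bits (c * k) (logBound n k c l) := by
  simp [bitPolynomial, eval_chainLength, CircuitWalks.Gadget.bits,
    CircuitWalks.Gadget.powerBound, logBound]

theorem eval_timePolynomial (n l k c : ℕ) : eval ![n, l, k, c] timePolynomial =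
    LogCostRAM.Reduction.program.weight * (n + c * k + 5) *
      CircuitWalks.Gadget.bits (c * k) (logBound n k c l) ^ 2 := by
  simp [timePolynomial, eval_chainLength, eval_bitPolynomial]

theorem eval_lengthPolynomial (n l k c : ℕ) : eval ![n, l, k, c] lengthPolynomial =
    (n + 2 * (c * k) + 3) + 1 + (3 * (n + 2 * (c * k) + 3) + 4) *
      (CircuitWalks.Gadget.bits (c * k) (logBound n k c l) + 3) := by
  simp [lengthPolynomial, eval_chainLength, eval_bitPolynomial]

end ExactSubsetSumInstance

theorem mainTheorem6 :
    ∃ (prog : LogCostRAM.Program) (T L : MvPolynomial (Fin 4) ℕ),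
      ∀ (I : ExactSubsetSumInstance) (C : ℕ),
        ∃ D : CircuitWalks.PlanarData,
          D.DescribesPolygon ∧
          D.realS ∈ Set.extremePoints ℝ D.P ∧
          (I.Feasible → D.dist ≤ ((2 * I.k : ℕ) : ℕ∞)) ∧
          (¬ I.Feasible → ((C * I.k : ℕ) : ℕ∞) < D.dist) ∧
          (∃ (t : ℕ) (τ : LogCostRAM.State),
            LogCostRAM.Runs prog (LogCostRAM.State.init (I.input C)) t τ ∧
            D.RepresentedBy τ.output ∧
            t ≤ MvPolynomial.eval ![I.n, Nat.log 2 I.maxNumber, I.k, C] T) ∧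
          D.encodingLength ≤ MvPolynomial.eval ![I.n, Nat.log 2 I.S, I.k, C] L ∧
          (CircuitWalks.polygonEdges D.P).encard ≤
            ((max 3 (2 * C * I.k + 2 * I.n) : ℕ) : ℕ∞) := by
  refine ⟨LogCostRAM.Reduction.program, ExactSubsetSumInstance.timePolynomial,
    ExactSubsetSumInstance.lengthPolynomial, fun I C => ⟨I.polygon C, ?_⟩⟩
  obtain ⟨h1, h2, h3, h4, h5⟩ := I.polygon_spec C
  obtain ⟨τ, ⟨t, hrun, ht⟩, hτ⟩ := I.takes_program C
  refine ⟨h1, h2, h3, h4, ⟨t, τ, hrun, hτ, ?_⟩, ?_, h5⟩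
  · rwa [ExactSubsetSumInstance.eval_timePolynomial]
  · rw [ExactSubsetSumInstance.eval_lengthPolynomial]
    exact I.encodingLength_polygon_le C
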